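/- Let $k$ be an algebraically closed field and let $f\in(x,y)\subset k[[x,y]]$ be such that $k[[x,y]]/(f,\partial_xf,\partial_yf)$ is a finite-dimensional $k$-vector space. Put $A=k[[x,y]]/(f)$ and let $\tilde A$ be the normalization of $A$ in its total ring of fractions. Let $\mathrm{Art}_k$ be the category of Artinian local $k$-algebras with residue field $k$. For $R\in\mathrm{Art}_k$, a deformation over $R$ of a $k$-algebra $B$ (here $B=A$ or $\tilde A$) is a flat $R$-algebra $B_R$ with an identification $B_R/\mathfrak m_RB_R\cong B$; isomorphisms of deformations induce the identity on $B$. (For these $B$, the adic topology of $B_R$ is determined by its ring structure and all homomorphisms below are automatically continuous.) Consider the following functors $\mathrm{Art}_k\to\mathrm{Sets}$, functorial by base change: * $\mathrm{Def}^{top}_{A\hookrightarrow\tilde A}(R)$: isomorphism classes of $R$-algebra homomorphisms $A_R\to\tilde A_R$ between deformations of $A$ and of $\tilde A$ which reduce to $A\subset\tilde A$; * $\mathrm{Def}^{top}_{k[[x,y]]\to\tilde A}(R)$: isomorphism classes of $R$-algebra homomorphisms $R[[x,y]]\to\tilde A_R$, with $\tilde A_R$ a deformation of $\tilde A$, which reduce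 to the composite $k[[x,y]]\twoheadrightarrow A\hookrightarrow\tilde A$ (isomorphisms are the identity on $R[[x,y]]$); * $\mathrm{Def}^{top}_{k[[x,y]]\twoheadrightarrow A\hookrightarrow\tilde A}(R)$: isomorphism classes of triples consisting of a homomorphism $R[[x,y]]\to A_R$ reducing to $k[[x,y]]\twoheadrightarrow A$, a homomorphism $A'_R\to\tilde A_R$ reducing to $A\hookrightarrow\tilde A$, and an isomorphism $A_R\cong A'_R$ of deformations of $A$ (equivalently, of chains $R[[x,y]]\to A_R\to\tilde A_R$). Then: 1. The morphism of functors $\mathrm{Def}^{top}_{k[[x,y]]\twoheadrightarrow A\hookrightarrow\tilde A}\to\mathrm{Def}^{top}_{k[[x,y]]\to\tilde A}$ given by composition is an isomorphism. 2. Its inverse is the "Div" construction. Precisely: (a) there is an exact sequence of $k[[x,y]]$-modules $0\to k[[x,y]]^n\xrightarrow{F}k[[x,y]]^n\to\tilde A\to0$ with $\det F=f$; (b) for every $R\in\mathrm{Art}_k$ and every deformation $R[[x,y]]\to\tilde A_R$ of $k[[x,y]]\to\tilde A$, every exact sequence $0\to k[[x,y]]^n\xrightarrow{F}k[[x,y]]^n\to\tilde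 A\to0$ lifts to an exact sequence of $R[[x,y]]$-modules $0\to R[[x,y]]^n\xrightarrow{F_R}R[[x,y]]^n\to\tilde A_R\to0$; (c) for every such exact sequence over $R$ (lifted or not), the deformation $R[[x,y]]\to\tilde A_R$ is, up to isomorphism, the composite of an element $R[[x,y]]\to A_R\to\tilde A_R$ of $\mathrm{Def}^{top}_{k[[x,y]]\twoheadrightarrow A\hookrightarrow\tilde A}(R)$ for which $R[[x,y]]\to A_R$ is surjective with kernel $(\det F_R)$, i.e. $A_R=R[[x,y]]/(\det F_R)$. 3. The functors $\mathrm{Def}^{top}_{k[[x,y]]\twoheadrightarrow A\hookrightarrow\tilde A}$ and $\mathrm{Def}^{top}_{A\hookrightarrow\tilde A}$ are formally smooth: for every surjection $R\to R'$ in $\mathrm{Art}_k$, every element over $R'$ lifts to an element over $R$. -/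

import Mathlib

open CategoryTheory TensorProduct

universe u

namespace PlaneCurveDef

/-! ### Artinian local `k`-algebras with residue field `k` -/

/-- An object of `Art_k`: an Artinian local `k`-algebra with residue field `k`. -/
structure ArtAlg (k : Type u) [Field k] where
  carrier : Type u
  [commRing : CommRing carrier]
  [algebra : Algebra k carrier]
  [isLocalRing : IsLocalRing carrier]
  [isArtinianRing : IsArtinianRing carrier]
  residue_surjective :
    Function.Surjective (algebraMap k (IsLocalRing.ResidueField carrier))

namespace ArtAlg

instance (k : Type u) [Field k] : CoeSort (ArtAlg k) (Type u) := ⟨ArtAlg.carrier⟩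

attribute [instance] ArtAlg.commRing ArtAlg.algebra ArtAlg.isLocalRing ArtAlg.isArtinianRing

variable {k : Type u} [Field k]

/-- Morphisms of `Art_k` are the homomorphisms of `k`-algebras (they are automatically local). -/
instance : Category (ArtAlg k) where
  Hom R R' := R →ₐ[k] R'
  id R := AlgHom.id k R
  comp u v := v.comp u

/-- The reduction `R → R / 𝔪_R = k`. -/
noncomputable def aug (R : ArtAlg k) : R →ₐ[k] k :=
  ((AlgEquiv.ofBijective (Algebra.ofId k (IsLocalRing.ResidueField R))
    ⟨(algebraMap k (IsLocalRing.ResidueField R)).injective, R.residue_surjective⟩).symm :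
      IsLocalRing.ResidueField R →ₐ[k] k).comp
    (IsScalarTower.toAlgHom k R (IsLocalRing.ResidueField R))

theorem ker_aug (R : ArtAlg k) : RingHom.ker R.aug = IsLocalRing.maximalIdeal R := by
  ext r
  rw [RingHom.mem_ker, aug, AlgHom.comp_apply]
  simp [IsLocalRing.ResidueField.algebraMap_eq]

theorem ker_algHom (R : ArtAlg k) (v : R →ₐ[k] k) :
    RingHom.ker v = IsLocalRing.maximalIdeal R := by
  have hs : Function.Surjective v := fun c => ⟨algebraMap k R c, by simp⟩
  have : (RingHom.ker v).IsMaximal := RingHom.ker_isMaximal_of_surjective (v : R →+* k) hs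
  exact IsLocalRing.eq_maximalIdeal this

theorem algHom_eq_aug (R : ArtAlg k) (v : R →ₐ[k] k) : v = R.aug := by
  ext r
  have h : r - algebraMap k R (R.aug r) ∈ RingHom.ker R.aug := by
    rw [RingHom.mem_ker]; simp
  rw [ker_aug, ← ker_algHom R v, RingHom.mem_ker] at h
  simpa [sub_eq_zero] using h

theorem aug_map {R R' : ArtAlg k} (v : R →ₐ[k] R') (r : R) : R'.aug (v r) = R.aug r :=
  DFunLike.congr_fun (algHom_eq_aug R (R'.aug.comp v)) r

theorem map_mem {R R' : ArtAlg k} (v : R →ₐ[k] R') {r : R}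
    (hr : r ∈ IsLocalRing.maximalIdeal R) : v r ∈ IsLocalRing.maximalIdeal R' := by
  rw [← ker_aug, RingHom.mem_ker] at hr ⊢
  exact (aug_map v r).trans hr

theorem sub_aug_mem (R : ArtAlg k) (r : R) :
    r - algebraMap k R (R.aug r) ∈ IsLocalRing.maximalIdeal R := by
  rw [← ker_aug, RingHom.mem_ker]; simp

theorem finite_of_isFiniteLength (R : ArtAlg k) (M : Type u) [AddCommGroup M] [Module R M]
    (h : IsFiniteLength R M) :
    ∀ [Module k M] [IsScalarTower k R M], Module.Finite k M := by
  induction h with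
  | of_subsingleton => intros; infer_instance
  | @of_simple_quotient M _ _ N hs hN ih =>
    intro _ _
    have h1 : Module.Finite k (N.restrictScalars k) := @ih inferInstance inferInstance
    have h2 : Module.Finite k (M ⧸ N.restrictScalars k) := by
      obtain ⟨I, hI, ⟨e⟩⟩ := isSimpleModule_iff_quot_maximal.mp hs
      rw [IsLocalRing.eq_maximalIdeal hI] at e
      let g : k →ₗ[k] (M ⧸ N) :=
        (e.symm.toLinearMap.restrictScalars k).comp
          (Algebra.ofId k (R ⧸ IsLocalRing.maximalIdeal R)).toLinearMap
      have hg : Function.Surjective g :=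
        e.symm.surjective.comp R.residue_surjective
      exact Module.Finite.of_surjective g hg
    exact Module.Finite.of_submodule_quotient (N.restrictScalars k)

instance (R : ArtAlg k) : Module.Finite k R :=
  finite_of_isFiniteLength R R
    (isFiniteLength_iff_isNoetherian_isArtinian.mpr ⟨inferInstance, inferInstance⟩)

end ArtAlg

/-! ### Base change of algebras along a ring homomorphism -/

section BaseChange

variable {R R' : Type u} [CommRing R] [CommRing R'] (v : R →+* R')
  (X : Type u) [CommRing X] [Algebra R X]

/-- The ring `R'`, regarded as an `R`-algebra through `v : R → R'`. -/
def Via (_ : R →+* R') : Type u := R'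

instance : CommRing (Via v) := inferInstanceAs (CommRing R')

instance : Algebra R (Via v) := RingHom.toAlgebra (S := Via v) v

/-- The base change `R' ⊗_R X` along `v : R → R'`. -/
def BC : Type u := Via v ⊗[R] X

noncomputable instance : CommRing (BC v X) := inferInstanceAs (CommRing (Via v ⊗[R] X))

noncomputable instance : Algebra R' (BC v X) :=
  inferInstanceAs (Algebra (Via v) (Via v ⊗[R] X))

namespace BC

variable {X}

/-- The canonical map `X → R' ⊗_R X`. -/
noncomputable def incl : X →+* BC v X :=
  (Algebra.TensorProduct.includeRight : X →ₐ[R] Via v ⊗[R] X).toRingHom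

theorem incl_algebraMap (r : R) :
    incl v (algebraMap R X r) = algebraMap R' (BC v X) (v r) :=
  ((Algebra.TensorProduct.includeRight : X →ₐ[R] Via v ⊗[R] X).commutes r).trans
    (IsScalarTower.algebraMap_apply R (Via v) (Via v ⊗[R] X) r)

theorem induction_on {p : BC v X → Prop} (z : BC v X) (h0 : p 0)
    (hm : ∀ (r : R') (x : X), p (algebraMap R' (BC v X) r * incl v x))
    (ha : ∀ a b, p a → p b → p (a + b)) : p z := by
  refine TensorProduct.induction_on (R := R) (M := Via v) (N := X) (motive := p) z h0 ?_ ha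
  intro r x
  have h : algebraMap R' (BC v X) r * incl v x = (r ⊗ₜ[R] x : Via v ⊗[R] X) := by
    change (r ⊗ₜ[R] (1 : X) : Via v ⊗[R] X) * ((1 : Via v) ⊗ₜ[R] x) = _
    rw [Algebra.TensorProduct.tmul_mul_tmul, mul_one, one_mul]
  rw [← h]
  exact hm r x

variable {Z : Type u} [CommRing Z] [Algebra R' Z]

theorem exists_lift {S : Type u} [CommRing S] [Algebra R S] [Algebra S Z] (f : X →+* Z)
    (hf : ∀ r, f (algebraMap R X r) = algebraMap S Z (algebraMap R S r)) :
    ∃ g : S ⊗[R] X →ₐ[S] Z, ∀ x, g (1 ⊗ₜ[R] x) = f x := by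
  let _ : Algebra R Z := ((algebraMap S Z).comp (algebraMap R S)).toAlgebra
  have : IsScalarTower R S Z := IsScalarTower.of_algebraMap_eq fun _ => rfl
  refine ⟨Algebra.TensorProduct.lift (Algebra.ofId S Z) (⟨f, hf⟩ : X →ₐ[R] Z)
    (fun _ _ => Commute.all _ _), fun x => ?_⟩
  rw [Algebra.TensorProduct.lift_tmul]
  simp

theorem exists_algHom (f : X →+* Z)
    (hf : ∀ r, f (algebraMap R X r) = algebraMap R' Z (v r)) :
    ∃ g : BC v X →ₐ[R'] Z, ∀ x, g (incl v x) = f x := by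
  let _ : Algebra (Via v) Z := inferInstanceAs (Algebra R' Z)
  exact exists_lift (S := Via v) f hf

/-- The `R'`-algebra homomorphism `R' ⊗_R X → Z` given by the universal property. -/
noncomputable def lift (f : X →+* Z)
    (hf : ∀ r, f (algebraMap R X r) = algebraMap R' Z (v r)) : BC v X →ₐ[R'] Z :=
  (exists_algHom v f hf).choose

theorem lift_incl (f : X →+* Z)
    (hf : ∀ r, f (algebraMap R X r) = algebraMap R' Z (v r)) (x : X) :
    lift v f hf (incl v x) = f x :=
  (exists_algHom v f hf).choose_spec x

variable {v}

theorem algHom_ext {f g : BC v X →ₐ[R'] Z} (h : ∀ x, f (incl v x) = g (incl v x)) : f = g := by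
  ext z
  refine induction_on v (p := fun z => f z = g z) z (by rw [map_zero, map_zero]) ?_ ?_
  · intro r x; rw [map_mul, map_mul, h, AlgHom.commutes, AlgHom.commutes]
  · intro a b ha hb; rw [map_add, map_add, ha, hb]

variable (v)

theorem flat [Module.Flat R X] : Module.Flat R' (BC v X) :=
  inferInstanceAs (Module.Flat (Via v) (Via v ⊗[R] X))

theorem exists_ringHom {Z : Type u} [CommRing Z] (a : R' →+* Z) (f : X →+* Z)
    (hf : ∀ r, f (algebraMap R X r) = a (v r)) :
    ∃ g : BC v X →+* Z, (∀ r, g (algebraMap R' _ r) = a r) ∧ ∀ x, g (incl v x) = f x := by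
  let _ : Algebra R' Z := a.toAlgebra
  obtain ⟨g, hg⟩ := exists_algHom v f hf
  exact ⟨g, g.commutes, hg⟩

theorem ringHom_ext {Z : Type u} [CommRing Z] {f g : BC v X →+* Z}
    (h₁ : ∀ r, f (algebraMap R' _ r) = g (algebraMap R' _ r))
    (h₂ : ∀ x, f (incl v x) = g (incl v x)) (z : BC v X) : f z = g z := by
  refine induction_on v (p := fun z => f z = g z) z (by rw [map_zero, map_zero]) ?_ ?_
  · intro r x; rw [map_mul, map_mul, h₁, h₂]
  · intro a b ha hb; rw [map_add, map_add, ha, hb]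

variable {Y : Type u} [CommRing Y] [Algebra R Y]

/-- Functoriality of the base change. -/
noncomputable def map (f : X →ₐ[R] Y) : BC v X →ₐ[R'] BC v Y :=
  lift v ((incl v).comp (f : X →+* Y)) fun r => by
    rw [RingHom.comp_apply, RingHom.coe_coe, f.commutes, incl_algebraMap]

theorem map_incl (f : X →ₐ[R] Y) (x : X) : map v f (incl v x) = incl v (f x) :=
  lift_incl _ _ _ x

/-- The base change of an isomorphism. -/
noncomputable def mapEquiv (e : X ≃ₐ[R] Y) : BC v X ≃ₐ[R'] BC v Y :=
  AlgEquiv.ofAlgHom (map v e) (map v e.symm)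
    (algHom_ext fun x => by simp [map_incl]) (algHom_ext fun x => by simp [map_incl])

theorem mapEquiv_incl (e : X ≃ₐ[R] Y) (x : X) : mapEquiv v e (incl v x) = incl v (e x) :=
  map_incl v (e : X →ₐ[R] Y) x

variable (X) in
/-- Base change along the identity. -/
noncomputable def idEquiv (w : R →+* R) (hw : ∀ r, w r = r) : BC w X ≃ₐ[R] X :=
  AlgEquiv.ofAlgHom (lift w (RingHom.id X) fun r => by rw [hw]; rfl)
    ⟨incl w, fun r => by
      change incl w (algebraMap R X r) = _
      rw [incl_algebraMap, hw]⟩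
    (AlgHom.ext fun x => lift_incl w _ _ x)
    (algHom_ext fun x => congrArg (incl w) (lift_incl w _ _ x))

theorem idEquiv_incl (w : R →+* R) (hw : ∀ r, w r = r) (x : X) :
    idEquiv X w hw (incl w x) = x :=
  lift_incl w _ _ x

variable {R'' : Type u} [CommRing R''] (v' : R' →+* R'') (w : R →+* R'')
  (hw : ∀ r, w r = v' (v r))

variable (X) in
/-- Base change along a composition. -/
noncomputable def compEquiv : BC w X ≃ₐ[R''] BC v' (BC v X) :=
  AlgEquiv.ofAlgHom
    (lift w ((incl v').comp (incl v)) fun r => by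
      rw [RingHom.comp_apply, incl_algebraMap, incl_algebraMap, hw])
    (lift v' (exists_ringHom v ((algebraMap R'' (BC w X)).comp v') (incl w) fun r => by
      rw [incl_algebraMap, hw]; rfl).choose fun r =>
        (exists_ringHom v ((algebraMap R'' (BC w X)).comp v') (incl w) fun r => by
          rw [incl_algebraMap, hw]; rfl).choose_spec.1 r)
    (by
      refine algHom_ext fun z => ?_
      rw [AlgHom.comp_apply, lift_incl, AlgHom.id_apply]
      have h := (exists_ringHom v ((algebraMap R'' (BC w X)).comp v') (incl w) fun r => by
          rw [incl_algebraMap, hw]; rfl).choose_spec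
      set g := (exists_ringHom v ((algebraMap R'' (BC w X)).comp v') (incl w) fun r => by
          rw [incl_algebraMap, hw]; rfl).choose
      refine ringHom_ext v (f := RingHom.comp (AlgHom.toRingHom (lift w _ _)) g) (g := incl v') ?_ ?_ z
      · intro r
        change lift w _ _ (g (algebraMap R' (BC v X) r)) = _
        rw [h.1 r, RingHom.comp_apply, AlgHom.commutes, incl_algebraMap]
      · intro x
        change lift w _ _ (g (incl v x)) = _
        rw [h.2 x, lift_incl]
        rfl)
    (by
      refine algHom_ext fun x => ?_
      rw [AlgHom.comp_apply, lift_incl, AlgHom.id_apply, RingHom.comp_apply, lift_incl]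
      exact (exists_ringHom v ((algebraMap R'' (BC w X)).comp v') (incl w) fun r => by
          rw [incl_algebraMap, hw]; rfl).choose_spec.2 x)

theorem compEquiv_incl (x : X) : compEquiv v X v' w hw (incl w x) = incl v' (incl v x) :=
  lift_incl w _ _ x

end BC

end BaseChange

/-! ### Power series in two variables -/

/-- The ring `R[[x, y]]`. -/
abbrev PS (R : Type u) : Type u := MvPowerSeries (Fin 2) R

section PowerSeries

variable {k : Type u} [Field k]

theorem ps_bijective (R : Type u) [CommRing R] [Algebra k R] [Module.Finite k R] :
    Function.Bijective
      (Algebra.TensorProduct.lift (Algebra.ofId R (PS R))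
        (MvPowerSeries.mapAlgHom (Algebra.ofId k R) : PS k →ₐ[k] PS R)
        (fun _ _ => Commute.all _ _) : R ⊗[k] PS k →ₐ[R] PS R) := by
  classical
  set g := (Algebra.TensorProduct.lift (Algebra.ofId R (PS R))
        (MvPowerSeries.mapAlgHom (Algebra.ofId k R) : PS k →ₐ[k] PS R)
        (fun _ _ => Commute.all _ _) : R ⊗[k] PS k →ₐ[R] PS R) with hg
  let b := Module.finBasis k R
  have key : ∀ (c : Fin (Module.finrank k R) → PS k) (n : Fin 2 →₀ ℕ),
      MvPowerSeries.coeff n (g (∑ i, b i ⊗ₜ[k] c i)) =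
        ∑ i, MvPowerSeries.coeff n (c i) • b i := by
    intro c n
    rw [map_sum, map_sum]
    refine Finset.sum_congr rfl fun i _ => ?_
    rw [hg, Algebra.TensorProduct.lift_tmul, Algebra.ofId_apply, MvPowerSeries.mapAlgHom_apply,
      MvPowerSeries.algebraMap_apply, Algebra.algebraMap_self_apply, MvPowerSeries.coeff_C_mul,
      MvPowerSeries.coeff_map, Algebra.smul_def, mul_comm]
    rfl
  have rep : ∀ z : R ⊗[k] PS k,
      ∃ c : Fin (Module.finrank k R) → PS k, z = ∑ i, b i ⊗ₜ[k] c i := by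
    intro z
    induction z using TensorProduct.induction_on with
    | zero => exact ⟨0, by simp⟩
    | tmul r p =>
      refine ⟨fun i => b.repr r i • p, ?_⟩
      conv_lhs => rw [← b.sum_repr r, TensorProduct.sum_tmul]
      exact Finset.sum_congr rfl fun i _ => TensorProduct.smul_tmul _ _ _
    | add x y hx hy =>
      obtain ⟨c, rfl⟩ := hx
      obtain ⟨d, rfl⟩ := hy
      exact ⟨c + d, by simp [TensorProduct.tmul_add, Finset.sum_add_distrib]⟩
  constructor
  · rw [injective_iff_map_eq_zero]
    intro z hz
    obtain ⟨c, rfl⟩ := rep z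
    have h0 : ∀ i, c i = 0 := by
      intro i
      ext n
      have h := key c n
      rw [hz, map_zero] at h
      have := Fintype.linearIndependent_iff.mp b.linearIndependent _ h.symm i
      simpa using this
    simp [h0]
  · intro p
    let c : Fin (Module.finrank k R) → PS k :=
      fun i n => b.repr (MvPowerSeries.coeff n p) i
    refine ⟨∑ i, b i ⊗ₜ[k] c i, ?_⟩
    ext n
    rw [key]
    exact b.sum_repr _

/-- `R ⊗_k k[[x, y]] = R[[x, y]]` for a finite `k`-algebra `R`. -/
noncomputable def psEquiv (R : Type u) [CommRing R] [Algebra k R] [Module.Finite k R] :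
    R ⊗[k] PS k ≃ₐ[R] PS R :=
  AlgEquiv.ofBijective _ (ps_bijective R)

variable {R : Type u} [CommRing R] [Algebra k R]

/-- The inclusion `k[[x, y]] → R[[x, y]]`. -/
noncomputable abbrev psIncl (R : Type u) [CommRing R] [Algebra k R] : PS k →+* PS R :=
  MvPowerSeries.map (algebraMap k R)

variable [Module.Finite k R] {Z : Type u} [CommRing Z]

theorem ps_exists [Algebra R Z] (h : PS k →+* Z)
    (hh : ∀ c : k, h (algebraMap k (PS k) c) = algebraMap R Z (algebraMap k R c)) :
    ∃ φ : PS R →ₐ[R] Z, ∀ p, φ (psIncl R p) = h p := by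
  obtain ⟨g, hg⟩ := BC.exists_lift (R := k) (S := R) (X := PS k) (Z := Z) h hh
  refine ⟨g.comp (psEquiv (k := k) R).symm, fun p => ?_⟩
  have : psIncl R p = psEquiv (k := k) R (1 ⊗ₜ[k] p) := by
    rw [psEquiv, AlgEquiv.coe_ofBijective, Algebra.TensorProduct.lift_tmul, map_one, one_mul]
    rfl
  rw [this]
  simp [hg]

/-- The extension of a homomorphism from `k[[x, y]]` to one from `R[[x, y]] = R ⊗_k k[[x, y]]`. -/
noncomputable def psLift [Algebra R Z] (h : PS k →+* Z)
    (hh : ∀ c : k, h (algebraMap k (PS k) c) = algebraMap R Z (algebraMap k R c)) :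
    PS R →ₐ[R] Z :=
  (ps_exists h hh).choose

theorem psLift_incl [Algebra R Z] (h : PS k →+* Z)
    (hh : ∀ c : k, h (algebraMap k (PS k) c) = algebraMap R Z (algebraMap k R c)) (p : PS k) :
    psLift h hh (psIncl R p) = h p :=
  (ps_exists h hh).choose_spec p

theorem ps_ringHom_ext {f g : PS R →+* Z}
    (h₁ : ∀ r : R, f (algebraMap R (PS R) r) = g (algebraMap R (PS R) r))
    (h₂ : ∀ p : PS k, f (psIncl R p) = g (psIncl R p)) (p : PS R) : f p = g p := by
  obtain ⟨z, rfl⟩ := (psEquiv (k := k) R).surjective p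
  induction z using TensorProduct.induction_on with
  | zero => rw [map_zero, map_zero, map_zero]
  | add a b ha hb => rw [map_add, map_add, map_add, ha, hb]
  | tmul r p =>
    have : psEquiv (k := k) R (r ⊗ₜ[k] p) = algebraMap R (PS R) r * psIncl R p := by
      rw [psEquiv, AlgEquiv.coe_ofBijective, Algebra.TensorProduct.lift_tmul]
      rfl
    rw [this, map_mul, map_mul, h₁, h₂]

end PowerSeries

/-! ### Deformations of algebras -/

section Deformations

variable {k : Type u} [Field k]

/-- A deformation over `R ∈ Art_k` of a `k`-algebra `B`: a flat `R`-algebra together with an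
identification of its reduction modulo `𝔪_R` with `B`, given as a surjection onto `B` with kernel
generated by `𝔪_R`.

For a complete Noetherian semilocal `k`-algebra `B` (with the topology defined by its Jacobson
radical), such as a quotient of `k[[x, y]]` or its normalization, every such deformation is again
Noetherian and complete for the topology defined by its Jacobson radical, because `𝔪_R` is
nilpotent and finitely generated, and every homomorphism of `R`-algebras between such deformations
is continuous. So there is no further condition on the topologies. -/
structure Deformation (B : Type u) [CommRing B] [Algebra k B] (R : ArtAlg k) where
  carrier : Type u
  [commRing : CommRing carrier]
  [algebra : Algebra R carrier]
  flat : Module.Flat R carrier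
  red : carrier →+* B
  red_algebraMap : ∀ r : R, red (algebraMap R carrier r) = algebraMap k B (R.aug r)
  red_surjective : Function.Surjective red
  ker_red : RingHom.ker red = (IsLocalRing.maximalIdeal R).map (algebraMap R carrier)

namespace Deformation

variable {B : Type u} [CommRing B] [Algebra k B] {R R' R'' : ArtAlg k}

instance : CoeSort (Deformation B R) (Type u) := ⟨Deformation.carrier⟩

attribute [instance] Deformation.commRing Deformation.algebra

/-- Isomorphisms of deformations: isomorphisms of `R`-algebras inducing the identity of `B`. -/
structure Iso (X Y : Deformation B R) where
  equiv : X ≃ₐ[R] Y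
  red_equiv : ∀ x, Y.red (equiv x) = X.red x

/-- The identity. -/
def Iso.refl (X : Deformation B R) : Iso X X := ⟨AlgEquiv.refl, fun _ => rfl⟩

/-- The inverse isomorphism. -/
def Iso.symm {X Y : Deformation B R} (e : Iso X Y) : Iso Y X :=
  ⟨e.equiv.symm, fun y => by rw [← e.red_equiv, AlgEquiv.apply_symm_apply]⟩

/-- The composition of isomorphisms. -/
def Iso.trans {X Y Z : Deformation B R} (e : Iso X Y) (e' : Iso Y Z) : Iso X Z :=
  ⟨e.equiv.trans e'.equiv, fun x => by
    rw [AlgEquiv.trans_apply, e'.red_equiv, e.red_equiv]⟩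

theorem exists_red (v : R →ₐ[k] R') (X : Deformation B R) :
    ∃ g : BC (v : R →+* R') X →+* B,
      (∀ r, g (algebraMap R' _ r) = algebraMap k B (R'.aug r)) ∧
        ∀ x, g (BC.incl (v : R →+* R') x) = X.red x :=
  BC.exists_ringHom (v : R →+* R') ((algebraMap k B).comp (R'.aug : R' →+* k)) X.red fun r => by
    rw [X.red_algebraMap, ← ArtAlg.aug_map v]; rfl

/-- The reduction of the base change. -/
noncomputable def bcRed (v : R →ₐ[k] R') (X : Deformation B R) : BC (v : R →+* R') X →+* B :=
  (exists_red v X).choose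

theorem bcRed_algebraMap (v : R →ₐ[k] R') (X : Deformation B R) (r : R') :
    bcRed v X (algebraMap R' _ r) = algebraMap k B (R'.aug r) :=
  (exists_red v X).choose_spec.1 r

theorem bcRed_incl (v : R →ₐ[k] R') (X : Deformation B R) (x : X) :
    bcRed v X (BC.incl (v : R →+* R') x) = X.red x :=
  (exists_red v X).choose_spec.2 x

theorem bc_exists_sub_mem (v : R →ₐ[k] R') (X : Deformation B R) (z : BC (v : R →+* R') X) :
    ∃ x : X, z - BC.incl (v : R →+* R') x ∈
      (IsLocalRing.maximalIdeal R').map (algebraMap R' (BC (v : R →+* R') X)) := by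
  refine BC.induction_on (v : R →+* R') (p := fun z => ∃ x : X, z - BC.incl (v : R →+* R') x ∈
      (IsLocalRing.maximalIdeal R').map (algebraMap R' (BC (v : R →+* R') X))) z ?_ ?_ ?_
  · exact ⟨0, by rw [map_zero, sub_zero]; exact zero_mem _⟩
  · intro r x
    refine ⟨algebraMap R X (algebraMap k R (R'.aug r)) * x, ?_⟩
    rw [map_mul, BC.incl_algebraMap, ← sub_mul, ← map_sub]
    refine Ideal.mul_mem_right _ _ (Ideal.mem_map_of_mem _ ?_)
    have := R'.sub_aug_mem r
    rwa [← v.commutes] at this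
  · rintro a b ⟨x, hx⟩ ⟨y, hy⟩
    refine ⟨x + y, ?_⟩
    rw [map_add, add_sub_add_comm]
    exact add_mem hx hy

theorem bc_map_le_ker (v : R →ₐ[k] R') (X : Deformation B R) :
    (IsLocalRing.maximalIdeal R').map (algebraMap R' (BC (v : R →+* R') X)) ≤
      RingHom.ker (bcRed v X) := by
  rw [Ideal.map_le_iff_le_comap]
  intro r hr
  rw [← ArtAlg.ker_aug, RingHom.mem_ker] at hr
  rw [Ideal.mem_comap, RingHom.mem_ker, bcRed_algebraMap, hr, map_zero]

/-- The base change of a deformation. -/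
noncomputable def bc (v : R →ₐ[k] R') (X : Deformation B R) : Deformation B R' where
  carrier := BC (v : R →+* R') X
  flat := by
    have := X.flat
    exact BC.flat _
  red := bcRed v X
  red_algebraMap := bcRed_algebraMap v X
  red_surjective b := by
    obtain ⟨x, rfl⟩ := X.red_surjective b
    exact ⟨_, bcRed_incl v X x⟩
  ker_red := by
    refine le_antisymm (fun z hz => ?_) (bc_map_le_ker v X)
    obtain ⟨x, hx⟩ := bc_exists_sub_mem v X z
    have h := bc_map_le_ker v X hx
    rw [RingHom.mem_ker] at h hz
    rw [map_sub, hz, zero_sub, neg_eq_zero, bcRed_incl, ← RingHom.mem_ker, X.ker_red] at h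
    have h2 := Ideal.mem_map_of_mem (BC.incl (v : R →+* R')) h
    have h3 : ((IsLocalRing.maximalIdeal R).map (algebraMap R X)).map (BC.incl (v : R →+* R')) ≤
        (IsLocalRing.maximalIdeal R').map (algebraMap R' (BC (v : R →+* R') X)) := by
      rw [Ideal.map_map, Ideal.map_le_iff_le_comap]
      intro r hr
      rw [Ideal.mem_comap, RingHom.comp_apply, BC.incl_algebraMap]
      exact Ideal.mem_map_of_mem _ (ArtAlg.map_mem v hr)
    have h4 := add_mem hx (h3 h2)
    rwa [sub_add_cancel] at h4

/-- The canonical map from a deformation to its base change. -/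
noncomputable def toBC (v : R →ₐ[k] R') (X : Deformation B R) : X →+* X.bc v :=
  BC.incl (v : R →+* R')

theorem red_toBC (v : R →ₐ[k] R') (X : Deformation B R) (x : X) :
    (X.bc v).red (X.toBC v x) = X.red x :=
  bcRed_incl v X x

theorem toBC_algebraMap (v : R →ₐ[k] R') (X : Deformation B R) (r : R) :
    X.toBC v (algebraMap R X r) = algebraMap R' (X.bc v) (v r) :=
  BC.incl_algebraMap _ r

theorem bc_ext {v : R →ₐ[k] R'} {X : Deformation B R} {Z : Type u} [CommRing Z]
    {f g : X.bc v →+* Z} (h₁ : ∀ r, f (algebraMap R' (X.bc v) r) = g (algebraMap R' (X.bc v) r))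
    (h₂ : ∀ x, f (X.toBC v x) = g (X.toBC v x)) (z : X.bc v) : f z = g z :=
  BC.ringHom_ext (v : R →+* R') (f := f) (g := g) h₁ h₂ z

/-- The base change of a homomorphism of `R`-algebras between deformations. -/
noncomputable def bcMap {C : Type u} [CommRing C] [Algebra k C] {X : Deformation B R}
    {Y : Deformation C R} (v : R →ₐ[k] R') (f : X →ₐ[R] Y) : X.bc v →ₐ[R'] Y.bc v :=
  BC.map (v : R →+* R') f

theorem bcMap_toBC {C : Type u} [CommRing C] [Algebra k C] {X : Deformation B R}
    {Y : Deformation C R} (v : R →ₐ[k] R') (f : X →ₐ[R] Y) (x : X) :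
    bcMap v f (X.toBC v x) = Y.toBC v (f x) :=
  BC.map_incl _ f x

theorem red_eq {X : Deformation B R} {C : Type u} [CommRing C] [Algebra k C] (g : B →ₐ[k] C)
    {v : R →ₐ[k] R'} {Y : Deformation C R'} (f : X.bc v →ₐ[R'] Y)
    (h : ∀ x, Y.red (f (X.toBC v x)) = g (X.red x)) (z : X.bc v) :
    Y.red (f z) = g ((X.bc v).red z) := by
  refine bc_ext (f := Y.red.comp (f : X.bc v →+* Y)) (g := (g : B →+* C).comp (X.bc v).red)
    ?_ ?_ z
  · intro r
    simp only [RingHom.comp_apply, RingHom.coe_coe]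
    rw [f.commutes, Y.red_algebraMap, (X.bc v).red_algebraMap, g.commutes]
  · intro x
    simp only [RingHom.comp_apply, RingHom.coe_coe]
    rw [h, red_toBC]

/-- The base change of an isomorphism of deformations. -/
noncomputable def Iso.bc {X Y : Deformation B R} (v : R →ₐ[k] R') (e : Iso X Y) :
    Iso (X.bc v) (Y.bc v) where
  equiv := BC.mapEquiv (v : R →+* R') e.equiv
  red_equiv := red_eq (AlgHom.id k B) (Y := Y.bc v)
    (AlgEquiv.toAlgHom (BC.mapEquiv (v : R →+* R') e.equiv)) fun x => by
      change (Y.bc v).red (BC.mapEquiv (v : R →+* R') e.equiv (BC.incl (v : R →+* R') x)) = _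
      rw [BC.mapEquiv_incl]
      exact (red_toBC v Y _).trans (e.red_equiv x)

theorem Iso.bc_toBC {X Y : Deformation B R} (v : R →ₐ[k] R') (e : Iso X Y) (x : X) :
    (e.bc v).equiv (X.toBC v x) = Y.toBC v (e.equiv x) :=
  BC.mapEquiv_incl (v : R →+* R') e.equiv x

/-- Base change along the identity. -/
noncomputable def idIso (X : Deformation B R) : Iso (X.bc (AlgHom.id k R)) X where
  equiv := BC.idEquiv X _ fun _ => rfl
  red_equiv := red_eq (AlgHom.id k B) (Y := X)
    (AlgEquiv.toAlgHom (BC.idEquiv X ((AlgHom.id k R : R →ₐ[k] R) : R →+* R) fun _ => rfl))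
    fun x => congrArg X.red (BC.idEquiv_incl _ (fun _ => rfl) x)

theorem idIso_toBC (X : Deformation B R) (x : X) : X.idIso.equiv (X.toBC _ x) = x :=
  BC.idEquiv_incl _ (fun _ => rfl) x

/-- Base change along a composition. -/
noncomputable def compIso (v : R →ₐ[k] R') (v' : R' →ₐ[k] R'') (X : Deformation B R) :
    Iso (X.bc (v'.comp v)) ((X.bc v).bc v') where
  equiv := BC.compEquiv (v : R →+* R') X (v' : R' →+* R'') _ fun _ => rfl
  red_equiv := red_eq (AlgHom.id k B) (Y := (X.bc v).bc v')
    (AlgEquiv.toAlgHom (BC.compEquiv (v : R →+* R') X (v' : R' →+* R'')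
      ((v'.comp v : R →ₐ[k] R'') : R →+* R'') fun _ => rfl)) fun x =>
    (congrArg ((X.bc v).bc v').red (BC.compEquiv_incl _ _ _ (fun _ => rfl) x)).trans
      ((red_toBC v' (X.bc v) _).trans (red_toBC v X x))

theorem compIso_toBC (v : R →ₐ[k] R') (v' : R' →ₐ[k] R'') (X : Deformation B R) (x : X) :
    (X.compIso v v').equiv (X.toBC _ x) = (X.bc v).toBC v' (X.toBC v x) :=
  BC.compEquiv_incl _ _ _ (fun _ => rfl) x

theorem bc_algHom_ext {v : R →ₐ[k] R'} {X : Deformation B R} {Z : Type u} [CommRing Z]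
    [Algebra R' Z] (f g : X.bc v →ₐ[R'] Z) (H : ∀ x, f (X.toBC v x) = g (X.toBC v x))
    (z : X.bc v) : f z = g z :=
  bc_ext (f := (f : X.bc v →+* Z)) (g := (g : X.bc v →+* Z))
    (fun r => (f.commutes r).trans (g.commutes r).symm) H z

section Squares

variable {C : Type u} [CommRing C] [Algebra k C]

theorem bcMap_square (v : R →ₐ[k] R') {X X' : Deformation B R} {Y Y' : Deformation C R}
    (f : X →ₐ[R] Y) (f' : X' →ₐ[R] Y') (α : Iso X X') (β : Iso Y Y')
    (H : ∀ x, f' (α.equiv x) = β.equiv (f x)) (z : X.bc v) :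
    bcMap v f' ((α.bc v).equiv z) = (β.bc v).equiv (bcMap v f z) := by
  refine bc_algHom_ext ((bcMap v f').comp (α.bc v).equiv.toAlgHom)
    ((β.bc v).equiv.toAlgHom.comp (bcMap v f)) (fun x => ?_) z
  change bcMap v f' ((α.bc v).equiv (X.toBC v x)) = (β.bc v).equiv (bcMap v f (X.toBC v x))
  rw [Iso.bc_toBC, bcMap_toBC, bcMap_toBC, Iso.bc_toBC, H]

theorem bcMap_id {X : Deformation B R} {Y : Deformation C R} (f : X →ₐ[R] Y)
    (z : X.bc (AlgHom.id k R)) :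
    f (X.idIso.equiv z) = Y.idIso.equiv (bcMap (AlgHom.id k R) f z) := by
  refine bc_algHom_ext (f.comp X.idIso.equiv.toAlgHom)
    (Y.idIso.equiv.toAlgHom.comp (bcMap (AlgHom.id k R) f)) (fun x => ?_) z
  change f (X.idIso.equiv (X.toBC _ x)) = Y.idIso.equiv (bcMap _ f (X.toBC _ x))
  rw [bcMap_toBC, idIso_toBC, idIso_toBC]

theorem bcMap_comp (v : R →ₐ[k] R') (v' : R' →ₐ[k] R'') {X : Deformation B R}
    {Y : Deformation C R} (f : X →ₐ[R] Y) (z : X.bc (v'.comp v)) :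
    bcMap v' (bcMap v f) ((X.compIso v v').equiv z) =
      (Y.compIso v v').equiv (bcMap (v'.comp v) f z) := by
  refine bc_algHom_ext ((bcMap v' (bcMap v f)).comp (X.compIso v v').equiv.toAlgHom)
    ((Y.compIso v v').equiv.toAlgHom.comp (bcMap (v'.comp v) f)) (fun x => ?_) z
  change bcMap v' (bcMap v f) ((X.compIso v v').equiv (X.toBC _ x)) =
    (Y.compIso v v').equiv (bcMap _ f (X.toBC _ x))
  rw [bcMap_toBC, compIso_toBC, compIso_toBC, bcMap_toBC, bcMap_toBC]

end Squares

end Deformation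

/-! ### Deformations of diagrams -/

variable {B C : Type u} [CommRing B] [Algebra k B] [CommRing C] [Algebra k C]

/-- A deformation over `R` of a homomorphism of `k`-algebras `h : B → C`: a homomorphism of
`R`-algebras between a deformation of `B` and a deformation of `C` whose reduction is `h`. -/
structure ArrowDef (h : B →ₐ[k] C) (R : ArtAlg k) where
  src : Deformation B R
  tgt : Deformation C R
  hom : src →ₐ[R] tgt
  red_hom : ∀ b, tgt.red (hom b) = h (src.red b)

/-- A deformation over `R` of a homomorphism of `k`-algebras `g : k[[x, y]] → B` with fixed source:
a homomorphism of `R`-algebras from `R[[x, y]]` to a deformation of `B` whose reduction is `g`. -/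
structure PlaneDef (g : PS k →ₐ[k] B) (R : ArtAlg k) where
  tgt : Deformation B R
  hom : PS R →ₐ[R] tgt
  red_hom : ∀ p, tgt.red (hom p) = g (MvPowerSeries.map (R.aug : R →+* k) p)

/-- A deformation over `R` of a diagram `k[[x, y]] → B → C`, i.e. an object of the fibre product
over the deformations of `B` of the deformations of `k[[x, y]] → B` and those of `B → C`:
a deformation `R[[x, y]] → B_R` of `g`, a deformation `B'_R → C_R` of `h` and an isomorphism
`B_R ≅ B'_R` of deformations of `B`. Isomorphism classes are taken of such triples: the isomorphism
is part of the data, and the composition `R[[x, y]] → B_R ≅ B'_R → C_R` depends on it. -/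
structure FibreDef (g : PS k →ₐ[k] B) (h : B →ₐ[k] C) (R : ArtAlg k) where
  plane : PlaneDef g R
  arrow : ArrowDef h R
  glue : Deformation.Iso plane.tgt arrow.src

variable {h : B →ₐ[k] C} {g : PS k →ₐ[k] B} {R R' R'' : ArtAlg k}

namespace ArrowDef

/-- Isomorphic deformations of `h : B → C`. -/
def Isomorphic (D E : ArrowDef h R) : Prop :=
  ∃ (α : Deformation.Iso D.src E.src) (β : Deformation.Iso D.tgt E.tgt),
    ∀ b, E.hom (α.equiv b) = β.equiv (D.hom b)

instance setoid (h : B →ₐ[k] C) (R : ArtAlg k) : Setoid (ArrowDef h R) where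
  r := Isomorphic
  iseqv :=
    { refl := fun D => ⟨.refl _, .refl _, fun _ => rfl⟩
      symm := fun {D E} ⟨α, β, H⟩ => ⟨α.symm, β.symm, fun b => by
        change D.hom (α.equiv.symm b) = β.equiv.symm (E.hom b)
        rw [AlgEquiv.eq_symm_apply, ← H, AlgEquiv.apply_symm_apply]⟩
      trans := fun {D E F} ⟨α, β, H⟩ ⟨α', β', H'⟩ => ⟨α.trans α', β.trans β', fun b => by
        change F.hom (α'.equiv (α.equiv b)) = β'.equiv (β.equiv (D.hom b))
        rw [H', H]⟩ }

/-- Base change. -/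
noncomputable def bc (v : R →ₐ[k] R') (D : ArrowDef h R) : ArrowDef h R' where
  src := D.src.bc v
  tgt := D.tgt.bc v
  hom := Deformation.bcMap v D.hom
  red_hom := Deformation.red_eq h _ fun x => by
    rw [Deformation.bcMap_toBC, Deformation.red_toBC, D.red_hom]

theorem bc_isomorphic (v : R →ₐ[k] R') {D E : ArrowDef h R} (H : Isomorphic D E) :
    Isomorphic (D.bc v) (E.bc v) := by
  obtain ⟨α, β, H⟩ := H
  exact ⟨α.bc v, β.bc v, Deformation.bcMap_square v D.hom E.hom α β H⟩

theorem bc_id (D : ArrowDef h R) : Isomorphic (D.bc (AlgHom.id k R)) D :=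
  ⟨D.src.idIso, D.tgt.idIso, Deformation.bcMap_id D.hom⟩

theorem bc_comp (v : R →ₐ[k] R') (v' : R' →ₐ[k] R'') (D : ArrowDef h R) :
    Isomorphic (D.bc (v'.comp v)) ((D.bc v).bc v') :=
  ⟨D.src.compIso v v', D.tgt.compIso v v', Deformation.bcMap_comp v v' D.hom⟩

end ArrowDef

namespace PlaneDef

/-- Isomorphic deformations of `g : k[[x, y]] → B` (with the identity on `R[[x, y]]`). -/
def Isomorphic (D E : PlaneDef g R) : Prop :=
  ∃ β : Deformation.Iso D.tgt E.tgt, ∀ p, E.hom p = β.equiv (D.hom p)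

instance setoid (g : PS k →ₐ[k] B) (R : ArtAlg k) : Setoid (PlaneDef g R) where
  r := Isomorphic
  iseqv :=
    { refl := fun D => ⟨.refl _, fun _ => rfl⟩
      symm := fun {D E} ⟨β, H⟩ => ⟨β.symm, fun b => by
        change D.hom b = β.equiv.symm (E.hom b)
        rw [AlgEquiv.eq_symm_apply, ← H]⟩
      trans := fun {D E F} ⟨β, H⟩ ⟨β', H'⟩ => ⟨β.trans β', fun b => by
        change F.hom b = β'.equiv (β.equiv (D.hom b))
        rw [H', H]⟩ }

/-- The base change `R'[[x, y]] = R' ⊗_R R[[x, y]] → R' ⊗_R B_R` of `R[[x, y]] → B_R`, i.e. the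
homomorphism of `R'`-algebras which agrees on `k[[x, y]]` with `k[[x, y]] → R[[x, y]] → B_R`. -/
noncomputable def bcHom (v : R →ₐ[k] R') (D : PlaneDef g R) : PS R' →ₐ[R'] D.tgt.bc v :=
  psLift (k := k) ((D.tgt.toBC v).comp ((D.hom : PS R →+* D.tgt).comp (psIncl R))) fun c => by
    rw [RingHom.comp_apply, RingHom.comp_apply, MvPowerSeries.algebraMap_apply,
      Algebra.algebraMap_self_apply, MvPowerSeries.map_C, ← v.commutes,
      ← Deformation.toBC_algebraMap, ← D.hom.commutes, MvPowerSeries.algebraMap_apply]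
    rfl

theorem bcHom_incl (v : R →ₐ[k] R') (D : PlaneDef g R) (p : PS k) :
    D.bcHom v (psIncl R' p) = D.tgt.toBC v (D.hom (psIncl R p)) :=
  psLift_incl _ _ p

theorem aug_incl (R : ArtAlg k) (p : PS k) :
    MvPowerSeries.map (R.aug : R →+* k) (psIncl R p) = p := by
  ext n
  simp

theorem aug_algebraMap (R : ArtAlg k) (r : R) :
    MvPowerSeries.map (R.aug : R →+* k) (algebraMap R (PS R) r) =
      algebraMap k (PS k) (R.aug r) := by
  simp [MvPowerSeries.algebraMap_apply]

/-- Base change. -/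
noncomputable def bc (v : R →ₐ[k] R') (D : PlaneDef g R) : PlaneDef g R' where
  tgt := D.tgt.bc v
  hom := D.bcHom v
  red_hom := ps_ringHom_ext (k := k) (f := (D.tgt.bc v).red.comp (D.bcHom v : _ →+* _))
    (g := (g : PS k →+* B).comp (MvPowerSeries.map (R'.aug : R' →+* k)))
    (fun r => by
      change (D.tgt.bc v).red (D.bcHom v _) = g (MvPowerSeries.map (R'.aug : R' →+* k) _)
      rw [AlgHom.commutes, Deformation.red_algebraMap, aug_algebraMap, g.commutes])
    (fun p => by
      change (D.tgt.bc v).red (D.bcHom v _) = g (MvPowerSeries.map (R'.aug : R' →+* k) _)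
      rw [bcHom_incl, Deformation.red_toBC, D.red_hom, aug_incl, aug_incl])

theorem hom_ext {D E : PlaneDef g R} (β : Deformation.Iso D.tgt E.tgt)
    (H : ∀ p : PS k, E.hom (psIncl R p) = β.equiv (D.hom (psIncl R p))) (p : PS R) :
    E.hom p = β.equiv (D.hom p) :=
  ps_ringHom_ext (k := k) (f := (E.hom : PS R →+* E.tgt))
    (g := (β.equiv : D.tgt →+* E.tgt).comp (D.hom : PS R →+* D.tgt))
    (fun r => (E.hom.commutes r).trans ((β.equiv.toAlgHom.comp D.hom).commutes r).symm) H p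

theorem bc_square (v : R →ₐ[k] R') {D E : PlaneDef g R} (β : Deformation.Iso D.tgt E.tgt)
    (H : ∀ p, E.hom p = β.equiv (D.hom p)) (p : PS R') :
    (E.bc v).hom p = (β.bc v).equiv ((D.bc v).hom p) := by
  refine hom_ext (D := D.bc v) (E := E.bc v) (β.bc v) (fun p => ?_) p
  change E.bcHom v _ = (β.bc v).equiv (D.bcHom v _)
  rw [bcHom_incl, bcHom_incl, Deformation.Iso.bc_toBC, H]

theorem bc_isomorphic (v : R →ₐ[k] R') {D E : PlaneDef g R} (H : Isomorphic D E) :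
    Isomorphic (D.bc v) (E.bc v) := by
  obtain ⟨β, H⟩ := H
  exact ⟨β.bc v, bc_square v β H⟩

theorem bc_id_hom (D : PlaneDef g R) (p : PS R) :
    D.hom p = D.tgt.idIso.equiv ((D.bc (AlgHom.id k R)).hom p) := by
  refine hom_ext (D := D.bc (AlgHom.id k R)) (E := D) D.tgt.idIso (fun p => ?_) p
  change D.hom _ = D.tgt.idIso.equiv (D.bcHom _ _)
  rw [bcHom_incl, Deformation.idIso_toBC]

theorem bc_id (D : PlaneDef g R) : Isomorphic (D.bc (AlgHom.id k R)) D :=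
  ⟨D.tgt.idIso, D.bc_id_hom⟩

theorem bc_comp_hom (v : R →ₐ[k] R') (v' : R' →ₐ[k] R'') (D : PlaneDef g R) (p : PS R'') :
    ((D.bc v).bc v').hom p = (D.tgt.compIso v v').equiv ((D.bc (v'.comp v)).hom p) := by
  refine hom_ext (D := D.bc (v'.comp v)) (E := (D.bc v).bc v') (D.tgt.compIso v v')
    (fun p => ?_) p
  change (D.bc v).bcHom v' _ = (D.tgt.compIso v v').equiv (D.bcHom _ _)
  rw [bcHom_incl, bcHom_incl, Deformation.compIso_toBC]
  change (D.bc v).tgt.toBC v' (D.bcHom v _) = _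
  rw [bcHom_incl]
  rfl

theorem bc_comp (v : R →ₐ[k] R') (v' : R' →ₐ[k] R'') (D : PlaneDef g R) :
    Isomorphic (D.bc (v'.comp v)) ((D.bc v).bc v') :=
  ⟨D.tgt.compIso v v', D.bc_comp_hom v v'⟩

end PlaneDef

namespace FibreDef

/-- Isomorphic deformations of the diagram `k[[x, y]] → B → C` (with the identity on
`R[[x, y]]`). -/
def Isomorphic (D E : FibreDef g h R) : Prop :=
  ∃ (γ : Deformation.Iso D.plane.tgt E.plane.tgt) (α : Deformation.Iso D.arrow.src E.arrow.src)
    (β : Deformation.Iso D.arrow.tgt E.arrow.tgt),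
    (∀ p, E.plane.hom p = γ.equiv (D.plane.hom p)) ∧
    (∀ b, E.arrow.hom (α.equiv b) = β.equiv (D.arrow.hom b)) ∧
    ∀ b, E.glue.equiv (γ.equiv b) = α.equiv (D.glue.equiv b)

instance setoid (g : PS k →ₐ[k] B) (h : B →ₐ[k] C) (R : ArtAlg k) :
    Setoid (FibreDef g h R) where
  r := Isomorphic
  iseqv :=
    { refl := fun D => ⟨.refl _, .refl _, .refl _, fun _ => rfl, fun _ => rfl, fun _ => rfl⟩
      symm := fun {D E} ⟨γ, α, β, H₁, H₂, H₃⟩ => ⟨γ.symm, α.symm, β.symm,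
        fun p => by
          change D.plane.hom p = γ.equiv.symm (E.plane.hom p)
          rw [AlgEquiv.eq_symm_apply, ← H₁],
        fun b => by
          change D.arrow.hom (α.equiv.symm b) = β.equiv.symm (E.arrow.hom b)
          rw [AlgEquiv.eq_symm_apply, ← H₂, AlgEquiv.apply_symm_apply],
        fun b => by
          change D.glue.equiv (γ.equiv.symm b) = α.equiv.symm (E.glue.equiv b)
          rw [AlgEquiv.eq_symm_apply, ← H₃, AlgEquiv.apply_symm_apply]⟩
      trans := fun {D E F} ⟨γ, α, β, H₁, H₂, H₃⟩ ⟨γ', α', β', H₁', H₂', H₃'⟩ =>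
        ⟨γ.trans γ', α.trans α', β.trans β',
        fun p => by
          change F.plane.hom p = γ'.equiv (γ.equiv (D.plane.hom p))
          rw [H₁', H₁],
        fun b => by
          change F.arrow.hom (α'.equiv (α.equiv b)) = β'.equiv (β.equiv (D.arrow.hom b))
          rw [H₂', H₂],
        fun b => by
          change F.glue.equiv (γ'.equiv (γ.equiv b)) = α'.equiv (α.equiv (D.glue.equiv b))
          rw [H₃', H₃]⟩ }

/-- Base change. -/
noncomputable def bc (v : R →ₐ[k] R') (D : FibreDef g h R) : FibreDef g h R' where
  plane := D.plane.bc v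
  arrow := D.arrow.bc v
  glue := D.glue.bc v

theorem bc_isomorphic (v : R →ₐ[k] R') {D E : FibreDef g h R} (H : Isomorphic D E) :
    Isomorphic (D.bc v) (E.bc v) := by
  obtain ⟨γ, α, β, H₁, H₂, H₃⟩ := H
  exact ⟨γ.bc v, α.bc v, β.bc v, PlaneDef.bc_square v γ H₁,
    Deformation.bcMap_square v D.arrow.hom E.arrow.hom α β H₂,
    Deformation.bcMap_square v D.glue.equiv.toAlgHom E.glue.equiv.toAlgHom γ α H₃⟩

theorem bc_id (D : FibreDef g h R) : Isomorphic (D.bc (AlgHom.id k R)) D :=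
  ⟨D.plane.tgt.idIso, D.arrow.src.idIso, D.arrow.tgt.idIso, D.plane.bc_id_hom,
    Deformation.bcMap_id D.arrow.hom, Deformation.bcMap_id D.glue.equiv.toAlgHom⟩

theorem bc_comp (v : R →ₐ[k] R') (v' : R' →ₐ[k] R'') (D : FibreDef g h R) :
    Isomorphic (D.bc (v'.comp v)) ((D.bc v).bc v') :=
  ⟨D.plane.tgt.compIso v v', D.arrow.src.compIso v v', D.arrow.tgt.compIso v v',
    D.plane.bc_comp_hom v v', Deformation.bcMap_comp v v' D.arrow.hom,
    Deformation.bcMap_comp v v' D.glue.equiv.toAlgHom⟩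

/-- The composition `R[[x, y]] → B_R ≅ B'_R → C_R`. -/
noncomputable def comp (D : FibreDef g h R) : PlaneDef (h.comp g) R where
  tgt := D.arrow.tgt
  hom := D.arrow.hom.comp (D.glue.equiv.toAlgHom.comp D.plane.hom)
  red_hom p := by
    change D.arrow.tgt.red (D.arrow.hom (D.glue.equiv (D.plane.hom p))) = h (g _)
    rw [D.arrow.red_hom, D.glue.red_equiv, D.plane.red_hom]

theorem comp_isomorphic {D E : FibreDef g h R} (H : Isomorphic D E) :
    PlaneDef.Isomorphic D.comp E.comp := by
  obtain ⟨γ, α, β, H₁, H₂, H₃⟩ := H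
  refine ⟨β, fun p => ?_⟩
  change E.arrow.hom (E.glue.equiv (E.plane.hom p)) =
    β.equiv (D.arrow.hom (D.glue.equiv (D.plane.hom p)))
  rw [H₁, H₃, H₂]

theorem comp_bc (v : R →ₐ[k] R') (D : FibreDef g h R) :
    PlaneDef.Isomorphic (D.bc v).comp (D.comp.bc v) := by
  refine ⟨.refl _, PlaneDef.hom_ext (D := (D.bc v).comp) (E := D.comp.bc v) _ fun p => ?_⟩
  change D.comp.bcHom v (psIncl R' p) =
    Deformation.bcMap v D.arrow.hom ((D.glue.bc v).equiv (D.plane.bcHom v (psIncl R' p)))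
  rw [PlaneDef.bcHom_incl, PlaneDef.bcHom_incl, Deformation.Iso.bc_toBC, Deformation.bcMap_toBC]
  rfl

end FibreDef

/-! ### The deformation functors -/

/-- The functor `Def_{B → C} : Art_k → Ens`. -/
noncomputable def DefArrow (h : B →ₐ[k] C) : ArtAlg k ⥤ Type (u + 1) where
  obj R := Quotient (ArrowDef.setoid h R)
  map v := ↾(Quotient.map (ArrowDef.bc v) fun _ _ H => ArrowDef.bc_isomorphic v H)
  map_id R := by
    ext x
    induction x using Quotient.ind with
    | _ D => exact Quotient.sound D.bc_id
  map_comp v v' := by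
    ext x
    induction x using Quotient.ind with
    | _ D => exact Quotient.sound (D.bc_comp v v')

/-- The functor `Def_{k[[x, y]] → B} : Art_k → Ens`. -/
noncomputable def DefPlane (g : PS k →ₐ[k] B) : ArtAlg k ⥤ Type (u + 1) where
  obj R := Quotient (PlaneDef.setoid g R)
  map v := ↾(Quotient.map (PlaneDef.bc v) fun _ _ H => PlaneDef.bc_isomorphic v H)
  map_id R := by
    ext x
    induction x using Quotient.ind with
    | _ D => exact Quotient.sound D.bc_id
  map_comp v v' := by
    ext x
    induction x using Quotient.ind with
    | _ D => exact Quotient.sound (D.bc_comp v v')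

/-- The functor `Def_{k[[x, y]] → B → C} : Art_k → Ens`. -/
noncomputable def DefFibre (g : PS k →ₐ[k] B) (h : B →ₐ[k] C) : ArtAlg k ⥤ Type (u + 1) where
  obj R := Quotient (FibreDef.setoid g h R)
  map v := ↾(Quotient.map (FibreDef.bc v) fun _ _ H => FibreDef.bc_isomorphic v H)
  map_id R := by
    ext x
    induction x using Quotient.ind with
    | _ D => exact Quotient.sound D.bc_id
  map_comp v v' := by
    ext x
    induction x using Quotient.ind with
    | _ D => exact Quotient.sound (D.bc_comp v v')

/-- The composition morphism `Def_{k[[x, y]] → B → C} → Def_{k[[x, y]] → C}`. -/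
noncomputable def compMorphism (g : PS k →ₐ[k] B) (h : B →ₐ[k] C) :
    DefFibre g h ⟶ DefPlane (h.comp g) where
  app R := ↾(Quotient.map FibreDef.comp fun _ _ H => FibreDef.comp_isomorphic H)
  naturality R R' v := by
    ext x
    induction x using Quotient.ind with
    | _ D => exact Quotient.sound (D.comp_bc v)

/-- A functor on `Art_k` is formally smooth if its elements lift along all surjections. -/
def FormallySmooth (F : ArtAlg k ⥤ Type (u + 1)) : Prop :=
  ∀ (R R' : ArtAlg k) (v : R →ₐ[k] R'), Function.Surjective v →
    Function.Surjective (F.map (X := R) (Y := R') v)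

/-- `0 → S^n --F--> S^n --q--> M → 0` is exact, where `M` is a ring, viewed as an `S`-module
through `φ : S → M`, and `q` sends the basis vector `e_i` to `m i`. -/
structure IsResolution {S M : Type u} [CommRing S] [CommRing M] (φ : S →+* M) {n : ℕ}
    (F : Matrix (Fin n) (Fin n) S) (m : Fin n → M) : Prop where
  injective : Function.Injective F.mulVec
  exact : ∀ w : Fin n → S, ∑ i, φ (w i) * m i = 0 ↔ ∃ w' : Fin n → S, F.mulVec w' = w
  surjective : ∀ b : M, ∃ w : Fin n → S, ∑ i, φ (w i) * m i = b

end Deformations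

/-! ### Plane curve singularities -/

section Curves

variable {k : Type u} [Field k] (f : PS k)

/-- `A = k[[x, y]]/(f)`. -/
abbrev CurveRing : Type u := PS k ⧸ Ideal.span {f}

/-- The normalization `Ã` of `A` in its total ring of fractions. -/
abbrev Normalization : Type u := integralClosure (CurveRing f) (FractionRing (CurveRing f))

/-- The projection `k[[x, y]] → A`. -/
noncomputable abbrev proj : PS k →ₐ[k] CurveRing f := Ideal.Quotient.mkₐ k (Ideal.span {f})

/-- The inclusion `A → Ã`. -/
noncomputable abbrev normMap : CurveRing f →ₐ[k] Normalization f :=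
  IsScalarTower.toAlgHom k (CurveRing f) (Normalization f)

/-- `f` is the equation of an isolated plane curve singularity: `f ∈ (x, y)` and
`k[[x, y]]/(f, ∂f/∂x, ∂f/∂y)` is finite-dimensional over `k`. -/
def IsIsolatedSingularity : Prop :=
  f ∈ Ideal.span {(MvPowerSeries.X 0 : PS k), MvPowerSeries.X 1} ∧
    Module.Finite k (PS k ⧸
      Ideal.span {f, MvPowerSeries.pderiv k 0 f, MvPowerSeries.pderiv k 1 f})

end Curves

end PlaneCurveDef

open PlaneCurveDef

/-!
Write `S = k[[x, y]]`, `C` for the normalization of `A = S/(f)` and `S_R`, `A_R`, `C_R` for the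
objects over `R ∈ Art_k`.

*Composition is an isomorphism.* Since `A → C` is injective, so is every deformation `A_R → C_R` of
it, as `C_R` is flat (`injective_of_injective_mod`); and `S_R → A_R` is surjective by Nakayama's
lemma. So `A_R` is the image of `S_R` in `C_R`, and the chain `S_R → A_R → C_R` is determined by the
composite (`FibreDef.isomorphic_of_comp`). Conversely, given `S_R → C_R`, a square resolution of `C`
over `S` lifts to `C_R` by flatness (`exists_lift_resolution`). The determinant of any square
presentation of `C_R` annihilates `C_R` and reduces to a generator of the Fitting ideal `(f)` of `C`
(`IsPresentation.det_dvd_det`), and `S_R/(det F_R)` is a flat deformation of `A` (`flat_quotient`).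
So `S_R → C_R` factors through `A_R = S_R/(det F_R)` (`exists_fibreDef`).

*Existence of the resolution.* As `f` is nonzero, some line `u = x - l y` does not divide it. Then
`A` and `C` are finite free over `V = k[[s]]`, where `s` acts as `u`. If `Y` is the matrix of the
multiplication by `y` on `C`, then `y - Y` presents `C` over `S` (`isPresentation_charMatrix`), and
likewise for `A`. The two determinants coincide, because `A` and `C` agree after inverting the
nonzero elements of `V` (`det_charMatrix_eq`), and for `A` the determinant is `f` up to a unit,
because `A` is also presented by the one by one matrix `(f)`.

*The normalization.* The hypothesis on the derivatives makes `f` square-free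
(`IsIsolatedSingularity.squarefree`), so `A` is reduced and its total ring of fractions is a finite
product of finite field extensions of `Frac V`. The ring `C` is the product of the integral closures
of `V` in them, without any separability assumption since `V` is complete
(`IsCompleteAt.module_finite`). Each factor is a semilocal Dedekind domain, hence a principal ideal
domain, so the radical of `u C` is generated by a single element `t`, and `C/(t)` is a finite
product of copies of `k` (`normalization_of_finite`).

*Smoothness.* A section of `C → C/(t)` identifies `C` with the power series ring over `C/(t)` in
`t`. Deformations of `C` are complete for every lift of `u` (`Deformation.isParameter`), so the
section and `t` can be lifted to any deformation, which is therefore trivial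
(`hasSections_of_radical_eq`). Hence a deformation of `S → C` amounts to lifts of the images of `x`
and `y`, and these lift along surjections; this gives the smoothness for `S → C`, thus for
`S → A → C`. Finally, every deformation of `A → C` extends to one of `S → A → C`, by lifting the
images of `x` and `y` to `A_R`, so the smoothness descends to deformations of `A → C`
(`defArrow_formallySmooth`).
-/

namespace PlaneCurveDef

/-! ### Modules over Artinian local rings -/

section ArtinianModules

variable {k : Type u} [Field k] {R : ArtAlg k}

/-- Nakayama's lemma for a nilpotent ideal, without finiteness assumption. -/
theorem eq_top_of_sup_smul_eq_top {R : Type*} [CommRing R] {I : Ideal R} (hI : IsNilpotent I)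
    {M : Type*} [AddCommGroup M] [Module R M] {N : Submodule R M}
    (h : ∀ x : M, ∃ y ∈ N, x - y ∈ I • (⊤ : Submodule R M)) : N = ⊤ := by
  have h1 : ∀ n : ℕ, N ⊔ I ^ n • (⊤ : Submodule R M) = ⊤ := by
    intro n
    induction n with
    | zero => simp
    | succ n ih =>
      suffices hle : I ^ n • (⊤ : Submodule R M) ≤ N ⊔ I ^ (n + 1) • (⊤ : Submodule R M) from
        top_le_iff.mp (ih.symm.le.trans (sup_le le_sup_left hle))
      rw [Submodule.smul_le]
      intro r hr x _
      obtain ⟨y, hy, hxy⟩ := h x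
      have : r • x = r • y + r • (x - y) := by rw [smul_sub]; abel
      rw [this]
      refine add_mem (Submodule.mem_sup_left (N.smul_mem r hy)) (Submodule.mem_sup_right ?_)
      rw [pow_succ, mul_smul]
      exact Submodule.smul_mem_smul hr hxy
  obtain ⟨n, hn⟩ := hI
  simpa [hn] using h1 n

theorem ArtAlg.isNilpotent_maximalIdeal (R : ArtAlg k) :
    IsNilpotent (IsLocalRing.maximalIdeal R) :=
  (isArtinianRing_iff_isNilpotent_maximalIdeal R).mp inferInstance

theorem surjective_of_surjective_mod {M N : Type*} [AddCommGroup M] [Module R M]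
    [AddCommGroup N] [Module R N] (φ : M →ₗ[R] N)
    (h : ∀ y : N, ∃ x, y - φ x ∈ IsLocalRing.maximalIdeal R • (⊤ : Submodule R N)) :
    Function.Surjective φ := by
  rw [← LinearMap.range_eq_top]
  refine eq_top_of_sup_smul_eq_top R.isNilpotent_maximalIdeal fun y => ?_
  obtain ⟨x, hx⟩ := h y
  exact ⟨φ x, ⟨x, rfl⟩, hx⟩

/-- A linear map to a flat module over an Artinian local ring is injective as soon as it is
injective modulo the maximal ideal: lifts of a basis of `M / 𝔪 M` generate `M` because `𝔪` is
nilpotent, and their images are linearly independent because `N` is flat. -/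
theorem injective_of_injective_mod {M N : Type u} [AddCommGroup M] [Module R M]
    [AddCommGroup N] [Module R N] [Module.Flat R N] (φ : M →ₗ[R] N)
    (h : ∀ x, φ x ∈ IsLocalRing.maximalIdeal R • (⊤ : Submodule R N) →
      x ∈ IsLocalRing.maximalIdeal R • (⊤ : Submodule R M)) :
    Function.Injective φ := by
  let κ := IsLocalRing.ResidueField R
  have hk : Function.Surjective (algebraMap R κ) := IsLocalRing.residue_surjective
  have hsM : Function.Surjective (TensorProduct.mk R κ M 1) := TensorProduct.mk_surjective R M κ hk
  let w := Module.Basis.ofVectorSpace κ (κ ⊗[R] M)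
  choose b hb using fun i => hsM (w i)
  have hkM : LinearMap.ker (TensorProduct.mk R κ M 1) =
      IsLocalRing.maximalIdeal R • (⊤ : Submodule R M) :=
    LinearMap.ker_tensorProductMk _
  have hkN : LinearMap.ker (TensorProduct.mk R κ N 1) =
      IsLocalRing.maximalIdeal R • (⊤ : Submodule R N) :=
    LinearMap.ker_tensorProductMk _
  have hspan : Submodule.span R (Set.range b) = ⊤ := by
    refine eq_top_of_sup_smul_eq_top R.isNilpotent_maximalIdeal fun x => ?_
    set y := TensorProduct.mk R κ M 1 x with hy
    have hx := w.linearCombination_repr y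
    choose c hc using fun i => hk (w.repr y i)
    refine ⟨∑ i ∈ (w.repr y).support, c i • b i,
      Submodule.sum_mem _ fun i _ => Submodule.smul_mem _ _ (Submodule.subset_span ⟨i, rfl⟩), ?_⟩
    rw [← hkM, LinearMap.mem_ker, map_sub, sub_eq_zero, ← hy, map_sum]
    refine hx.symm.trans (Finset.sum_congr rfl fun i _ => ?_)
    rw [map_smul, hb]
    change w.repr y i • w i = c i • w i
    rw [← hc]
    exact algebraMap_smul κ (c i) (w i)
  have hli : LinearIndependent R (φ ∘ b) := by
    refine Module.IsLocalRing.linearIndependent_of_flat _ ?_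
    have h1 : (TensorProduct.mk R κ N 1) ∘ (φ ∘ b) = (φ.baseChange κ) ∘ w := by
      funext i
      simp only [Function.comp_apply, ← hb]
      rfl
    rw [h1]
    refine w.linearIndependent.map' _ ?_
    rw [LinearMap.ker_eq_bot']
    intro z hz
    obtain ⟨x, rfl⟩ := hsM z
    have hx : φ x ∈ LinearMap.ker (TensorProduct.mk R κ N 1) := hz
    rw [hkN] at hx
    have := h x hx
    rwa [← hkM] at this
  rw [← LinearMap.ker_eq_bot, LinearMap.ker_eq_bot']
  intro x hx
  have hxs : x ∈ Submodule.span R (Set.range b) := hspan ▸ Submodule.mem_top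
  obtain ⟨c, rfl⟩ := (Finsupp.mem_span_range_iff_exists_finsupp).mp hxs
  have : Finsupp.linearCombination R (φ ∘ b) c = 0 := by
    rw [← hx, Finsupp.linearCombination_apply, map_finsuppSum]
    simp
  rw [linearIndependent_iff.mp hli c this]
  simp

end ArtinianModules

/-! ### Homomorphisms of deformations -/

section DeformationModules

variable {k : Type u} [Field k] {R : ArtAlg k} {B : Type u} [CommRing B] [Algebra k B]

theorem Deformation.red_eq_zero_iff (X : Deformation B R) (x : X) :
    X.red x = 0 ↔ x ∈ IsLocalRing.maximalIdeal R • (⊤ : Submodule R X) := by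
  rw [Ideal.smul_top_eq_map, ← RingHom.mem_ker, X.ker_red]
  rfl

theorem Deformation.isNilpotent_ker_red (X : Deformation B R) :
    IsNilpotent (RingHom.ker X.red) := by
  obtain ⟨n, hn⟩ := R.isNilpotent_maximalIdeal
  exact ⟨n, by rw [X.ker_red, ← Ideal.map_pow, hn]; simp⟩

/-- A homomorphism of deformations of `B` which induces the identity of `B` is bijective. -/
theorem Deformation.bijective_of_red {X Y : Deformation B R} (φ : X →ₐ[R] Y)
    (h : ∀ x, Y.red (φ x) = X.red x) : Function.Bijective φ := by
  have := Y.flat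
  constructor
  · refine injective_of_injective_mod φ.toLinearMap fun x hx => ?_
    rw [← Deformation.red_eq_zero_iff] at hx ⊢
    rwa [← h]
  · refine surjective_of_surjective_mod φ.toLinearMap fun y => ?_
    obtain ⟨x, hx⟩ := X.red_surjective (Y.red y)
    refine ⟨x, ?_⟩
    rw [← Deformation.red_eq_zero_iff, map_sub, AlgHom.toLinearMap_apply, h, hx, sub_self]

/-- The isomorphism of deformations given by a homomorphism which induces the identity. -/
noncomputable def Deformation.isoOfRed {X Y : Deformation B R} (φ : X →ₐ[R] Y)
    (h : ∀ x, Y.red (φ x) = X.red x) : Deformation.Iso X Y :=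
  ⟨AlgEquiv.ofBijective φ (bijective_of_red φ h), h⟩

/-- A homomorphism between deformations is injective if its reduction is. -/
theorem Deformation.injective_of_red {C : Type u} [CommRing C] [Algebra k C] {h : B →ₐ[k] C}
    (hh : Function.Injective h) {X : Deformation B R} {Y : Deformation C R} (φ : X →ₐ[R] Y)
    (H : ∀ x, Y.red (φ x) = h (X.red x)) : Function.Injective φ := by
  have := Y.flat
  refine injective_of_injective_mod φ.toLinearMap fun x hx => ?_
  rw [← Deformation.red_eq_zero_iff] at hx ⊢
  rw [AlgHom.toLinearMap_apply, H] at hx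
  exact hh (hx.trans (map_zero h).symm)

end DeformationModules

/-! ### Power series over Artinian local rings -/

section PowerSeriesOverArtinian

variable {k : Type u} [Field k] (R : ArtAlg k)

/-- The reduction `R[[x, y]] → k[[x, y]]`. -/
noncomputable abbrev psRed : PS R →+* PS k := MvPowerSeries.map (R.aug : R →+* k)

theorem psRed_surjective : Function.Surjective (psRed R) := fun p =>
  ⟨psIncl R p, PlaneDef.aug_incl R p⟩

instance : Module.Flat R (PS R) :=
  Module.Flat.of_linearEquiv (psEquiv (k := k) R).symm.toLinearEquiv

theorem psRed_eq_zero_iff (p : PS R) :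
    psRed R p = 0 ↔ p ∈ IsLocalRing.maximalIdeal R • (⊤ : Submodule R (PS R)) := by
  constructor
  · intro hp
    obtain ⟨n, r, hr⟩ := Submodule.fg_iff_exists_fin_generating_family.mp
      (IsNoetherian.noetherian (IsLocalRing.maximalIdeal R))
    have h1 : ∀ d, ∃ c : Fin n → R, ∑ i, c i * r i = MvPowerSeries.coeff d p := by
      intro d
      have : MvPowerSeries.coeff d p ∈ IsLocalRing.maximalIdeal R := by
        rw [← ArtAlg.ker_aug, RingHom.mem_ker]
        have := congrArg (MvPowerSeries.coeff d) hp
        simpa using this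
      rw [← hr] at this
      simpa using (Submodule.mem_span_range_iff_exists_fun R).mp this
    choose c hc using h1
    have : p = ∑ i, r i • (show PS R from fun d => c d i) := by
      ext d
      rw [← hc d, map_sum]
      refine Finset.sum_congr rfl fun i _ => ?_
      rw [mul_comm]
      rfl
    rw [this]
    refine Submodule.sum_mem _ fun i _ => Submodule.smul_mem_smul ?_ trivial
    rw [← hr]
    exact Submodule.subset_span ⟨i, rfl⟩
  · intro hp
    refine Submodule.smul_induction_on hp ?_ ?_
    · intro r hr p _
      rw [← ArtAlg.ker_aug, RingHom.mem_ker] at hr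
      rw [Algebra.smul_def, map_mul, PlaneDef.aug_algebraMap, hr, map_zero, zero_mul]
    · intro a b ha hb
      rw [map_add, ha, hb, add_zero]

theorem psRed_pi_eq_zero_iff {n : ℕ} (w : Fin n → PS R) :
    (∀ i, psRed R (w i) = 0) ↔
      w ∈ IsLocalRing.maximalIdeal R • (⊤ : Submodule R (Fin n → PS R)) := by
  constructor
  · intro h
    rw [← Finset.univ_sum_single w]
    refine Submodule.sum_mem _ fun i _ => ?_
    have := Submodule.mem_map_of_mem (f := LinearMap.single R (fun _ : Fin n => PS R) i)
      ((psRed_eq_zero_iff R _).mp (h i))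
    rw [Submodule.map_smul''] at this
    exact Submodule.smul_mono le_rfl le_top this
  · intro h i
    rw [psRed_eq_zero_iff]
    have := Submodule.mem_map_of_mem (f := LinearMap.proj (R := R) (φ := fun _ : Fin n => PS R) i) h
    rw [Submodule.map_smul''] at this
    exact Submodule.smul_mono le_rfl le_top this

end PowerSeriesOverArtinian

/-! ### Square presentations and Fitting ideals -/

section Presentations

variable {S M : Type*} [CommRing S] [CommRing M] {φ : S →+* M}

/-- `S^ι --F--> S^ι --q--> M → 0` is exact, where the ring `M` is an `S`-module through `φ` and `q`
sends the basis vector `e_i` to `m i`. -/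
structure IsPresentation {ι : Type*} [Fintype ι] (φ : S →+* M) (F : Matrix ι ι S)
    (m : ι → M) : Prop where
  exact : ∀ w : ι → S, ∑ i, φ (w i) * m i = 0 ↔ ∃ w' : ι → S, F.mulVec w' = w
  surjective : ∀ b : M, ∃ w : ι → S, ∑ i, φ (w i) * m i = b

variable {ι κ : Type*} [Fintype ι]

theorem IsResolution.isPresentation {S M : Type u} [CommRing S] [CommRing M] {φ : S →+* M} {n : ℕ}
    {F : Matrix (Fin n) (Fin n) S} {m : Fin n → M} (h : IsResolution φ F m) :
    IsPresentation φ F m :=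
  ⟨h.exact, h.surjective⟩

theorem IsPresentation.exists_mul_eq {F : Matrix ι ι S} {m : ι → M} (h : IsPresentation φ F m)
    (W : Matrix ι κ S) (hW : ∀ j, ∑ i, φ (W i j) * m i = 0) : ∃ P : Matrix ι κ S, F * P = W := by
  choose P hP using fun j => (h.exact fun i => W i j).mp (hW j)
  refine ⟨Matrix.of fun i j => P j i, ?_⟩
  ext i j
  exact congrFun (hP j) i

theorem IsPresentation.sum_mul_eq_zero {F : Matrix ι ι S} {m : ι → M} (h : IsPresentation φ F m)
    (P : Matrix ι κ S) (j : κ) : ∑ i, φ ((F * P) i j) * m i = 0 :=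
  (h.exact fun i => (F * P) i j).mpr ⟨fun i => P i j, rfl⟩

theorem IsPresentation.exists_matrix {F : Matrix ι ι S} {m : ι → M} (h : IsPresentation φ F m)
    (m' : κ → M) : ∃ A : Matrix ι κ S, ∀ j, ∑ i, φ (A i j) * m i = m' j := by
  choose A hA using fun j => h.surjective (m' j)
  exact ⟨Matrix.of fun i j => A j i, hA⟩

/-- The determinants of two square presentations of the same module divide each other, as both
generate its zeroth Fitting ideal. With `m' = A m` and `m = B m'`, the relations between all the
generators are spanned by the columns of `(F, -A; 0, 1)` and by those of `(1, 0; -B, G)`. -/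
theorem IsPresentation.det_dvd_det [Fintype κ] [DecidableEq ι] [DecidableEq κ]
    {F : Matrix ι ι S} {m : ι → M} {G : Matrix κ κ S} {m' : κ → M} (hF : IsPresentation φ F m) (hG : IsPresentation φ G m') :
    F.det ∣ G.det := by
  obtain ⟨A, hA⟩ := hF.exists_matrix m'
  obtain ⟨B, hB⟩ := hG.exists_matrix m
  have hmul : ∀ c : κ → S, ∑ i, φ (∑ l, A i l * c l) * m i = ∑ l, φ (c l) * m' l := by
    intro c
    simp only [map_sum, map_mul, Finset.sum_mul, ← hA, Finset.mul_sum]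
    rw [Finset.sum_comm]
    exact Finset.sum_congr rfl fun _ _ => Finset.sum_congr rfl fun _ _ => by ring
  obtain ⟨P₁, hP₁⟩ := hF.exists_mul_eq (1 - A * B) fun j => by
    simp only [Matrix.sub_apply, map_sub, sub_mul, Finset.sum_sub_distrib, Matrix.mul_apply]
    rw [hmul, hB, sub_eq_zero, Finset.sum_eq_single j]
    · simp
    · intro i _ hi
      simp [Matrix.one_apply_ne hi]
    · simp
  obtain ⟨P₂, hP₂⟩ := hF.exists_mul_eq (A * G) fun j => by
    simp only [Matrix.mul_apply]
    rw [hmul]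
    simpa using hG.sum_mul_eq_zero (1 : Matrix κ κ S) j
  have key : Matrix.fromBlocks F (-A) 0 1 * Matrix.fromBlocks P₁ P₂ (-B) G =
      Matrix.fromBlocks 1 0 (-B) G := by
    rw [Matrix.fromBlocks_multiply, hP₁, hP₂]
    simp
  have := congrArg Matrix.det key
  rw [Matrix.det_mul, Matrix.det_fromBlocks_zero₂₁, Matrix.det_fromBlocks_zero₁₂] at this
  simp only [Matrix.det_one, mul_one, one_mul] at this
  exact ⟨_, this.symm⟩

/-- The determinant annihilates the presented module. -/
theorem IsPresentation.map_det [DecidableEq ι] {F : Matrix ι ι S} {m : ι → M}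
    (h : IsPresentation φ F m) : φ F.det = 0 := by
  have h1 : ∀ j, φ F.det * m j = 0 := by
    intro j
    have := h.sum_mul_eq_zero F.adjugate j
    rw [Matrix.mul_adjugate, Finset.sum_eq_single j] at this
    · simpa using this
    · intro i _ hi
      simp [Matrix.one_apply_ne hi]
    · simp
  obtain ⟨w, hw⟩ := h.surjective 1
  calc φ F.det = φ F.det * ∑ i, φ (w i) * m i := by rw [hw, mul_one]
    _ = ∑ i, φ (w i) * (φ F.det * m i) := by
      rw [Finset.mul_sum]
      exact Finset.sum_congr rfl fun _ _ => by ring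
    _ = 0 := by simp [h1]

end Presentations

/-! ### Lifting resolutions to deformations -/

section LiftingResolutions

instance {R M ι : Type*} [CommRing R] [AddCommGroup M] [Module R M] [Module.Flat R M] [Finite ι] :
    Module.Flat R (ι → M) := by
  classical
  cases nonempty_fintype ι
  exact Module.Flat.of_linearEquiv (DirectSum.linearEquivFunOnFintype R ι fun _ => M).symm

instance {k : Type u} [Field k] : IsDomain (PS k) := NoZeroDivisors.to_isDomain _

variable {k : Type u} [Field k] {R : ArtAlg k} {B : Type u} [CommRing B] [Algebra k B]
  {g : PS k →ₐ[k] B}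

/-- The homomorphism `R[[x, y]]^n → B_R` given by `n` elements of `B_R`. -/
noncomputable def PlaneDef.generators (D : PlaneDef g R) {n : ℕ} (m : Fin n → D.tgt) :
    (Fin n → PS R) →ₗ[R] D.tgt where
  toFun w := ∑ i, D.hom (w i) * m i
  map_add' w w' := by simp [add_mul, Finset.sum_add_distrib]
  map_smul' r w := by simp [Finset.smul_sum]

theorem PlaneDef.generators_apply (D : PlaneDef g R) {n : ℕ} (m : Fin n → D.tgt)
    (w : Fin n → PS R) : D.generators m w = ∑ i, D.hom (w i) * m i := rfl

theorem PlaneDef.red_generators (D : PlaneDef g R) {n : ℕ} (m : Fin n → D.tgt)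
    (w : Fin n → PS R) :
    D.tgt.red (D.generators m w) = ∑ i, g (psRed R (w i)) * D.tgt.red (m i) := by
  rw [generators_apply, map_sum]
  exact Finset.sum_congr rfl fun i _ => by rw [map_mul, D.red_hom]

theorem exists_psRed_eq {n : ℕ} (w : Fin n → PS k) :
    ∃ w' : Fin n → PS R, ∀ i, psRed R (w' i) = w i := by
  choose w' hw' using fun i => psRed_surjective R (w i)
  exact ⟨w', hw'⟩

/-- If the `m i` generate `B_R`, then every element of `𝔪_R B_R` is a combination of them with
coefficients in `𝔪_R R[[x, y]]`. -/
theorem PlaneDef.exists_generators_eq (D : PlaneDef g R) {n : ℕ} {m : Fin n → D.tgt}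
    (h : Function.Surjective (D.generators m)) {b : D.tgt} (hb : D.tgt.red b = 0) :
    ∃ w, D.generators m w = b ∧ ∀ i, psRed R (w i) = 0 := by
  rw [Deformation.red_eq_zero_iff, ← LinearMap.range_eq_top.mpr h, LinearMap.range_eq_map,
    ← Submodule.map_smul''] at hb
  obtain ⟨w, hw, rfl⟩ := hb
  exact ⟨w, rfl, (psRed_pi_eq_zero_iff R w).mpr hw⟩

theorem PlaneDef.generators_surjective (D : PlaneDef g R) {n : ℕ} (m : Fin n → D.tgt)
    (h : ∀ b : B, ∃ w : Fin n → PS k, ∑ i, g (w i) * D.tgt.red (m i) = b) :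
    Function.Surjective (D.generators m) := by
  refine surjective_of_surjective_mod _ fun y => ?_
  obtain ⟨w, hw⟩ := h (D.tgt.red y)
  obtain ⟨w', hw'⟩ := exists_psRed_eq (R := R) w
  refine ⟨w', ?_⟩
  rw [← Deformation.red_eq_zero_iff, map_sub, D.red_generators, sub_eq_zero, ← hw]
  simp [hw']

theorem psRed_mulVec {n : ℕ} (F : Matrix (Fin n) (Fin n) (PS R)) (w : Fin n → PS R) (i : Fin n) :
    psRed R (F.mulVec w i) = (F.map (psRed R)).mulVec (fun j => psRed R (w j)) i := by
  simp [Matrix.mulVec, dotProduct]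

theorem PlaneDef.generators_mulVec (D : PlaneDef g R) {n : ℕ} {m : Fin n → D.tgt}
    {F : Matrix (Fin n) (Fin n) (PS R)} (hF : ∀ j, D.generators m (fun i => F i j) = 0)
    (w : Fin n → PS R) : D.generators m (F.mulVec w) = 0 := by
  calc D.generators m (F.mulVec w) = ∑ j, D.hom (w j) * D.generators m (fun i => F i j) := by
        simp only [generators_apply, Matrix.mulVec, dotProduct, map_sum, map_mul, Finset.sum_mul,
          Finset.mul_sum]
        rw [Finset.sum_comm]
        exact Finset.sum_congr rfl fun _ _ => Finset.sum_congr rfl fun _ _ => by ring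
    _ = 0 := by simp [hF]

/-- Every resolution of `B` by square matrices lifts along a deformation: generators and relations
lift arbitrarily, and the flatness of `B_R` makes the lifted sequence exact. -/
theorem exists_lift_resolution (D : PlaneDef g R) {n : ℕ} {F : Matrix (Fin n) (Fin n) (PS k)}
    {m : Fin n → B} (h : IsResolution (g : PS k →+* B) F m) :
    ∃ (FR : Matrix (Fin n) (Fin n) (PS R)) (mR : Fin n → D.tgt),
      IsResolution (D.hom : PS R →+* D.tgt) FR mR ∧
      FR.map (psRed R) = F ∧ ∀ i, D.tgt.red (mR i) = m i := by
  choose mR hmR using fun i => D.tgt.red_surjective (m i)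
  have hsurj : Function.Surjective (D.generators mR) :=
    D.generators_surjective mR fun b => by simpa [hmR] using h.surjective b
  have hcol : ∀ j, ∃ c : Fin n → PS R, D.generators mR c = 0 ∧ ∀ i, psRed R (c i) = F i j := by
    intro j
    obtain ⟨c, hc⟩ := exists_psRed_eq (R := R) fun i => F i j
    have h0 : D.tgt.red (D.generators mR c) = 0 := by
      rw [D.red_generators]
      simp only [hc, hmR]
      exact (h.exact fun i => F i j).mpr ⟨Pi.single j 1, by ext i; simp⟩
    obtain ⟨w, hw, hw'⟩ := D.exists_generators_eq hsurj h0
    exact ⟨c - w, by rw [map_sub, hw, sub_self], fun i => by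
      rw [Pi.sub_apply, map_sub, hc, hw', sub_zero]⟩
  choose c hc hcF using hcol
  let FR : Matrix (Fin n) (Fin n) (PS R) := Matrix.of fun i j => c j i
  have hFR : FR.map (psRed R) = F := by
    ext i j : 1
    exact hcF j i
  have hFR0 := D.generators_mulVec (m := mR) (F := FR) hc
  refine ⟨FR, mR, ⟨?_, ?_, hsurj⟩, hFR, hmR⟩
  · have hinj := injective_of_injective_mod (FR.mulVecLin.restrictScalars R) (by
      intro w hw
      rw [← psRed_pi_eq_zero_iff] at hw ⊢
      have h1 : F.mulVec (fun j => psRed R (w j)) = F.mulVec 0 := by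
        funext i
        rw [Matrix.mulVec_zero, ← hFR, ← psRed_mulVec]
        exact hw i
      exact congrFun (h.injective h1))
    exact hinj
  · intro w
    -- the cokernel of `FR` maps injectively to the flat module `B_R`, as it does modulo `𝔪_R`
    let N := LinearMap.range (FR.mulVecLin.restrictScalars R)
    have hN : N ≤ LinearMap.ker (D.generators mR) := by
      rintro _ ⟨w, rfl⟩
      exact hFR0 w
    have := D.tgt.flat
    have hinj := injective_of_injective_mod (N.liftQ (D.generators mR) hN) (by
      intro z hz
      obtain ⟨w, rfl⟩ := N.mkQ_surjective z
      rw [← Deformation.red_eq_zero_iff] at hz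
      change D.tgt.red (D.generators mR w) = 0 at hz
      rw [D.red_generators] at hz
      simp only [hmR] at hz
      obtain ⟨w', hw'⟩ := (h.exact _).mp hz
      obtain ⟨v, hv⟩ := exists_psRed_eq (R := R) w'
      have h1 : w - FR.mulVec v ∈
          IsLocalRing.maximalIdeal R • (⊤ : Submodule R (Fin n → PS R)) := by
        rw [← psRed_pi_eq_zero_iff]
        intro i
        rw [Pi.sub_apply, map_sub, psRed_mulVec, hFR]
        simp only [hv, hw', sub_self]
      have h2 : N.mkQ w = N.mkQ (w - FR.mulVec v) := by
        rw [map_sub, eq_comm, sub_eq_self]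
        exact (Submodule.Quotient.mk_eq_zero N).mpr ⟨v, rfl⟩
      rw [h2]
      have h3 := Submodule.mem_map_of_mem (f := N.mkQ) h1
      rw [Submodule.map_smul''] at h3
      exact Submodule.smul_mono le_rfl le_top h3)
    constructor
    · intro hw
      have h4 : N.liftQ (D.generators mR) hN (N.mkQ w) = 0 := hw
      have h5 := hinj (h4.trans (map_zero _).symm)
      exact (Submodule.Quotient.mk_eq_zero N).mp h5
    · rintro ⟨w', rfl⟩
      exact hFR0 w'

/-- The reduction of a presentation of `B_R` is a presentation of `B`. -/
theorem isPresentation_red (D : PlaneDef g R) {n : ℕ} {F : Matrix (Fin n) (Fin n) (PS R)}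
    {m : Fin n → D.tgt} (h : IsPresentation (D.hom : PS R →+* D.tgt) F m) :
    IsPresentation (g : PS k →+* B) (F.map (psRed R)) fun i => D.tgt.red (m i) := by
  have hsurj : Function.Surjective (D.generators m) := h.surjective
  refine ⟨fun w => ⟨fun hw => ?_, ?_⟩, fun b => ?_⟩
  · obtain ⟨v, hv⟩ := exists_psRed_eq (R := R) w
    have h0 : D.tgt.red (D.generators m v) = 0 := by
      rw [D.red_generators]
      simpa [hv] using hw
    obtain ⟨v', hv', hv0⟩ := D.exists_generators_eq hsurj h0
    obtain ⟨w', hw'⟩ := (h.exact (v - v')).mp (by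
      have : D.generators m (v - v') = 0 := by rw [map_sub, hv', sub_self]
      exact this)
    refine ⟨fun j => psRed R (w' j), funext fun i => ?_⟩
    rw [← psRed_mulVec, hw', Pi.sub_apply, map_sub, hv, hv0, sub_zero]
  · rintro ⟨w', rfl⟩
    obtain ⟨v, hv⟩ := exists_psRed_eq (R := R) w'
    have h1 : D.generators m (F.mulVec v) = 0 := (h.exact _).mpr ⟨v, rfl⟩
    have h2 := D.red_generators m (F.mulVec v)
    rw [h1, map_zero] at h2
    refine Eq.trans ?_ h2.symm
    refine Finset.sum_congr rfl fun i _ => ?_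
    rw [psRed_mulVec]
    simp only [hv]
    rfl
  · obtain ⟨b', rfl⟩ := D.tgt.red_surjective b
    obtain ⟨w, rfl⟩ := hsurj b'
    exact ⟨fun i => psRed R (w i), (D.red_generators m w).symm⟩

end LiftingResolutions

/-! ### Deformations of hypersurfaces -/

section Hypersurfaces

variable {k : Type u} [Field k] {R : ArtAlg k} {f : PS k}

/-- `R[[x, y]]/(G)` is flat over `R` if the reduction of `G` is a generator of `(f)`, `f ≠ 0`: lifts
of a `k`-basis of `k[[x, y]]/(f)` are an `R`-basis. -/
theorem flat_quotient (hf : f ≠ 0) {G : PS R} (hG : Ideal.span {psRed R G} = Ideal.span {f}) :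
    Module.Flat R (PS R ⧸ Ideal.span {G}) := by
  obtain ⟨ι, ⟨w⟩⟩ : ∃ ι : Type u, Nonempty (Module.Basis ι k (CurveRing f)) :=
    ⟨_, ⟨Module.Basis.ofVectorSpace k _⟩⟩
  have hG0 : psRed R G ≠ 0 := by
    intro h
    rw [h, Ideal.span_singleton_eq_span_singleton] at hG
    exact hf (zero_dvd_iff.mp hG.dvd)
  have hmem : ∀ z, z ∈ Ideal.span {f} ↔ z ∈ Ideal.span {psRed R G} := fun z => by rw [hG]
  choose p hp using fun i => Ideal.Quotient.mk_surjective (w i)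
  choose c hc using fun i => psRed_surjective R (p i)
  have hred : ∀ a, Ideal.Quotient.mk (Ideal.span {f})
      (psRed R (Finsupp.linearCombination R c a)) = a.sum fun i r => R.aug r • w i := by
    intro a
    rw [Finsupp.linearCombination_apply, Finsupp.sum, map_sum, map_sum]
    refine Finset.sum_congr rfl fun i _ => ?_
    rw [Algebra.smul_def, map_mul, PlaneDef.aug_algebraMap, map_mul, hc, hp]
    exact (Algebra.smul_def (R := k) (A := CurveRing f) _ _).symm
  -- `ψ (q, a) = G q + ∑ aᵢ cᵢ` is injective since it is so modulo the maximal ideal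
  let ψ : PS R × (ι →₀ R) →ₗ[R] PS R :=
    (LinearMap.mulLeft R G).coprod (Finsupp.linearCombination R c)
  have hψ : Function.Injective ψ := by
    refine injective_of_injective_mod ψ ?_
    rintro ⟨q, a⟩ hx
    rw [← psRed_eq_zero_iff, LinearMap.coprod_apply, map_add, LinearMap.mulLeft_apply,
      map_mul] at hx
    have h1 : (a.sum fun i r => R.aug r • w i) = 0 := by
      rw [← hred, ← map_zero (Ideal.Quotient.mk (Ideal.span {f})), ← hx, map_add, eq_comm,
        add_eq_right, Ideal.Quotient.eq_zero_iff_mem, hmem]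
      exact Ideal.mul_mem_right _ _ (Ideal.mem_span_singleton_self _)
    have h2 : ∀ i, R.aug (a i) = 0 := by
      intro i
      by_cases hi : i ∈ a.support
      · exact linearIndependent_iff'.mp w.linearIndependent a.support (fun i => R.aug (a i)) h1 i hi
      · rw [Finsupp.notMem_support_iff.mp hi, map_zero]
    have h3 : psRed R (Finsupp.linearCombination R c a) = 0 := by
      rw [Finsupp.linearCombination_apply, Finsupp.sum, map_sum]
      refine Finset.sum_eq_zero fun i _ => ?_
      rw [Algebra.smul_def, map_mul, PlaneDef.aug_algebraMap, h2, map_zero, zero_mul]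
    have h4 : psRed R q = 0 := by
      rw [h3, add_zero] at hx
      exact (mul_eq_zero.mp hx).resolve_left hG0
    have h5 := Submodule.mem_map_of_mem (f := LinearMap.inl R (PS R) (ι →₀ R))
      ((psRed_eq_zero_iff R q).mp h4)
    rw [Submodule.map_smul''] at h5
    have h6 : (0, a) ∈ IsLocalRing.maximalIdeal R • (⊤ : Submodule R (PS R × (ι →₀ R))) := by
      have : ((0, a) : PS R × (ι →₀ R)) =
          ∑ i ∈ a.support, a i • ((0, Finsupp.single i 1) : PS R × (ι →₀ R)) := by
        ext1
        · simp [Prod.fst_sum]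
        · rw [Prod.snd_sum]
          conv_lhs => rw [← Finsupp.sum_single a]
          simp [Finsupp.sum]
      rw [this]
      refine Submodule.sum_mem _ fun i _ => Submodule.smul_mem_smul ?_ trivial
      rw [← ArtAlg.ker_aug]
      exact h2 i
    have h7 := add_mem (Submodule.smul_mono le_rfl le_top h5) h6
    simpa using h7
  let θ : (ι →₀ R) →ₗ[R] PS R ⧸ Ideal.span {G} :=
    (Ideal.Quotient.mkₐ R (Ideal.span {G})).toLinearMap.comp (Finsupp.linearCombination R c)
  have hθ : Function.Bijective θ := by
    constructor
    · rw [injective_iff_map_eq_zero]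
      intro a ha
      obtain ⟨q, hq⟩ := Ideal.mem_span_singleton'.mp (Ideal.Quotient.eq_zero_iff_mem.mp ha)
      have : ψ (-q, a) = ψ 0 := by
        rw [LinearMap.coprod_apply, LinearMap.mulLeft_apply, ← hq, map_zero]
        ring
      exact (Prod.ext_iff.mp (hψ this)).2
    · refine surjective_of_surjective_mod θ fun y => ?_
      obtain ⟨y, rfl⟩ := Ideal.Quotient.mk_surjective y
      have hz := w.linearCombination_repr (Ideal.Quotient.mk _ (psRed R y))
      set z := w.repr (Ideal.Quotient.mk _ (psRed R y))
      refine ⟨z.mapRange (algebraMap k R) (map_zero _), ?_⟩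
      have h1 : Ideal.Quotient.mk (Ideal.span {f}) (psRed R (y -
          Finsupp.linearCombination R c (z.mapRange (algebraMap k R) (map_zero _)))) = 0 := by
        rw [map_sub, map_sub, hred, Finsupp.sum_mapRange_index (by simp), sub_eq_zero, ← hz,
          Finsupp.linearCombination_apply]
        simp
      rw [Ideal.Quotient.eq_zero_iff_mem, hmem] at h1
      obtain ⟨q, hq⟩ := Ideal.mem_span_singleton'.mp h1
      obtain ⟨q', rfl⟩ := psRed_surjective R q
      have h2 : y - Finsupp.linearCombination R c (z.mapRange (algebraMap k R) (map_zero _)) -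
          q' * G ∈ IsLocalRing.maximalIdeal R • (⊤ : Submodule R (PS R)) := by
        rw [← psRed_eq_zero_iff, map_sub, ← hq, map_mul, sub_self]
      have h3 := Submodule.mem_map_of_mem
        (f := (Ideal.Quotient.mkₐ R (Ideal.span {G})).toLinearMap) h2
      rw [Submodule.map_smul''] at h3
      have h4 := Submodule.smul_mono le_rfl le_top h3
      have h5 : Ideal.Quotient.mk (Ideal.span {G}) (q' * G) = 0 :=
        Ideal.Quotient.eq_zero_iff_mem.mpr
          (Ideal.mul_mem_left _ _ (Ideal.mem_span_singleton_self _))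
      rw [map_sub, map_sub, AlgHom.toLinearMap_apply, AlgHom.toLinearMap_apply,
        AlgHom.toLinearMap_apply, Ideal.Quotient.mkₐ_eq_mk, h5, sub_zero] at h4
      exact h4
  exact Module.Flat.of_linearEquiv (LinearEquiv.ofBijective θ hθ).symm

variable (f) in
/-- The deformation `R[[x, y]]/(G)` of `k[[x, y]]/(f)`, where `G` reduces to a generator of `(f)`. -/
noncomputable def hypersurface (hf : f ≠ 0) (G : PS R)
    (hG : Ideal.span {psRed R G} = Ideal.span {f}) : Deformation (CurveRing f) R where
  carrier := PS R ⧸ Ideal.span {G}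
  flat := flat_quotient hf hG
  red := Ideal.quotientMap (Ideal.span {f}) (psRed R) (by
    rw [Ideal.span_le, Set.singleton_subset_iff, ← hG]
    exact Ideal.mem_span_singleton_self _)
  red_algebraMap r := by
    change Ideal.quotientMap _ _ _ (Ideal.Quotient.mk _ (algebraMap R (PS R) r)) = _
    rw [Ideal.quotientMap_mk, PlaneDef.aug_algebraMap]
    rfl
  red_surjective := Ideal.quotientMap_surjective (psRed_surjective R)
  ker_red := by
    ext z
    obtain ⟨p, rfl⟩ := Ideal.Quotient.mk_surjective z
    rw [RingHom.mem_ker, Ideal.quotientMap_mk, Ideal.Quotient.eq_zero_iff_mem, ← hG]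
    have hm : (IsLocalRing.maximalIdeal R).map (algebraMap R (PS R ⧸ Ideal.span {G})) =
        ((IsLocalRing.maximalIdeal R).map (algebraMap R (PS R))).map
          (Ideal.Quotient.mk (Ideal.span {G})) := by
      rw [Ideal.map_map]
      rfl
    have hk : ∀ q : PS R, q ∈ (IsLocalRing.maximalIdeal R).map (algebraMap R (PS R)) ↔
        psRed R q = 0 := by
      intro q
      rw [psRed_eq_zero_iff, Ideal.smul_top_eq_map]
      rfl
    rw [hm]
    constructor
    · intro hp
      obtain ⟨q, hq⟩ := Ideal.mem_span_singleton'.mp hp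
      obtain ⟨q', rfl⟩ := psRed_surjective R q
      have h1 : Ideal.Quotient.mk (Ideal.span {G}) p =
          Ideal.Quotient.mk (Ideal.span {G}) (p - q' * G) := by
        rw [Ideal.Quotient.eq, sub_sub_cancel]
        exact Ideal.mul_mem_left _ _ (Ideal.mem_span_singleton_self _)
      rw [h1]
      refine Ideal.mem_map_of_mem _ ((hk _).mpr ?_)
      rw [map_sub, map_mul, hq, sub_self]
    · intro hp
      obtain ⟨q, hq, h1⟩ := (Ideal.mem_map_iff_of_surjective _ Ideal.Quotient.mk_surjective).mp hp
      rw [Ideal.Quotient.eq] at h1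
      obtain ⟨s, hs⟩ := Ideal.mem_span_singleton'.mp h1
      have : p = q - s * G := by rw [hs]; ring
      rw [this, map_sub, (hk q).mp hq, map_mul, zero_sub]
      exact neg_mem (Ideal.mul_mem_left _ _ (Ideal.mem_span_singleton_self _))

end Hypersurfaces

/-! ### The composition morphism -/

section Composition

variable {k : Type u} [Field k] {R : ArtAlg k} {f : PS k} {C : Type u} [CommRing C] [Algebra k C]
  {h : CurveRing f →ₐ[k] C}

/-- If `G` reduces to a generator of `(f)` and is mapped to `0` in `C_R`, then `R[[x, y]] → C_R`
factors through the deformation `R[[x, y]]/(G)` of `k[[x, y]]/(f)`. -/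
noncomputable def factorHypersurface (D : PlaneDef (h.comp (proj f)) R) (hf : f ≠ 0) (G : PS R)
    (hG : Ideal.span {psRed R G} = Ideal.span {f}) (h0 : D.hom G = 0) :
    FibreDef (proj f) h R where
  plane :=
    { tgt := hypersurface f hf G hG
      hom := Ideal.Quotient.mkₐ R (Ideal.span {G})
      red_hom := fun _ => rfl }
  arrow :=
    { src := hypersurface f hf G hG
      tgt := D.tgt
      hom := Ideal.Quotient.liftₐ (Ideal.span {G}) D.hom fun a ha => by
        obtain ⟨q, rfl⟩ := Ideal.mem_span_singleton'.mp ha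
        rw [map_mul, h0, mul_zero]
      red_hom := fun b => by
        obtain ⟨p, rfl⟩ := Ideal.Quotient.mk_surjective b
        exact D.red_hom p }
  glue := .refl (hypersurface f hf G hG)

theorem factorHypersurface_comp (D : PlaneDef (h.comp (proj f)) R) (hf : f ≠ 0) (G : PS R)
    (hG : Ideal.span {psRed R G} = Ideal.span {f}) (h0 : D.hom G = 0) :
    PlaneDef.Isomorphic (factorHypersurface D hf G hG h0).comp D :=
  ⟨.refl _, fun _ => rfl⟩

/-- The `Div` construction: `det F_R` reduces to a generator of `(f)`, because the Fitting ideals of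
`C` can be computed from any resolution, and it annihilates `C_R`. -/
theorem exists_fibreDef (hf : f ≠ 0) {n : ℕ} {F : Matrix (Fin n) (Fin n) (PS k)} {m : Fin n → C}
    (hF : IsResolution (h.comp (proj f) : PS k →+* C) F m) (hdet : F.det = f)
    (D : PlaneDef (h.comp (proj f)) R) {n' : ℕ} {FR : Matrix (Fin n') (Fin n') (PS R)}
    {mR : Fin n' → D.tgt} (hFR : IsResolution (D.hom : PS R →+* D.tgt) FR mR) :
    ∃ E : FibreDef (proj f) h R, PlaneDef.Isomorphic E.comp D ∧
      Function.Surjective E.plane.hom ∧ RingHom.ker E.plane.hom = Ideal.span {FR.det} := by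
  have h1 := isPresentation_red D hFR.isPresentation
  have hG : Ideal.span {psRed R FR.det} = Ideal.span {f} := by
    rw [Ideal.span_singleton_eq_span_singleton, ← hdet, RingHom.map_det]
    exact associated_of_dvd_dvd (h1.det_dvd_det hF.isPresentation)
      (hF.isPresentation.det_dvd_det h1)
  refine ⟨factorHypersurface D hf FR.det hG hFR.isPresentation.map_det,
    factorHypersurface_comp _ _ _ _ _, Ideal.Quotient.mk_surjective, ?_⟩
  exact Ideal.mk_ker

theorem PlaneDef.hom_surjective (D : PlaneDef (proj f) R) : Function.Surjective D.hom := by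
  refine surjective_of_surjective_mod D.hom.toLinearMap fun y => ?_
  obtain ⟨p, hp⟩ := Ideal.Quotient.mk_surjective (D.tgt.red y)
  obtain ⟨q, rfl⟩ := psRed_surjective R p
  refine ⟨q, ?_⟩
  rw [← Deformation.red_eq_zero_iff, map_sub, AlgHom.toLinearMap_apply, D.red_hom, ← hp]
  exact sub_self _

theorem FibreDef.hom_eq_zero_iff (hh : Function.Injective h) (D : FibreDef (proj f) h R)
    (p : PS R) : D.plane.hom p = 0 ↔ D.comp.hom p = 0 := by
  change _ ↔ D.arrow.hom (D.glue.equiv (D.plane.hom p)) = 0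
  rw [map_eq_zero_iff _ (Deformation.injective_of_red hh D.arrow.hom D.arrow.red_hom),
    map_eq_zero_iff _ D.glue.equiv.injective]

/-- A deformation of `k[[x, y]] → A → C` with `A → C` injective is determined by the composition
`R[[x, y]] → C_R`: its middle term is the image of `R[[x, y]]` in `C_R`. -/
theorem FibreDef.isomorphic_of_comp (hh : Function.Injective h) {D E : FibreDef (proj f) h R}
    (H : PlaneDef.Isomorphic D.comp E.comp) : FibreDef.Isomorphic D E := by
  obtain ⟨β, hβ⟩ := H
  have hle : ∀ p, D.plane.hom p = 0 → E.plane.hom p = 0 := by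
    intro p hp
    rw [hom_eq_zero_iff hh] at hp ⊢
    rw [hβ, hp, map_zero]
  let φ : D.plane.tgt →ₐ[R] E.plane.tgt :=
    (Ideal.Quotient.liftₐ (RingHom.ker D.plane.hom) E.plane.hom hle).comp
      (Ideal.quotientKerAlgEquivOfSurjective D.plane.hom_surjective).symm.toAlgHom
  have hφ : ∀ p, φ (D.plane.hom p) = E.plane.hom p := by
    intro p
    have : (Ideal.quotientKerAlgEquivOfSurjective D.plane.hom_surjective).symm (D.plane.hom p) =
        Ideal.Quotient.mk _ p := by
      rw [AlgEquiv.symm_apply_eq]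
      rfl
    change Ideal.Quotient.liftₐ _ _ hle ((Ideal.quotientKerAlgEquivOfSurjective
      D.plane.hom_surjective).symm (D.plane.hom p)) = _
    rw [this]
    rfl
  have hred : ∀ x, E.plane.tgt.red (φ x) = D.plane.tgt.red x := by
    intro x
    obtain ⟨p, rfl⟩ := D.plane.hom_surjective x
    rw [hφ, E.plane.red_hom, D.plane.red_hom]
  let γ := Deformation.isoOfRed φ hred
  have hγ : ∀ p, E.plane.hom p = γ.equiv (D.plane.hom p) := fun p => (hφ p).symm
  refine ⟨γ, (D.glue.symm.trans γ).trans E.glue, β, hγ, fun b => ?_, fun b => ?_⟩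
  · obtain ⟨x, rfl⟩ := D.glue.equiv.surjective b
    obtain ⟨p, rfl⟩ := D.plane.hom_surjective x
    change E.arrow.hom (E.glue.equiv (γ.equiv (D.glue.equiv.symm (D.glue.equiv (D.plane.hom p))))) =
      β.equiv (D.comp.hom p)
    rw [AlgEquiv.symm_apply_apply, ← hγ, ← hβ]
    rfl
  · change _ = E.glue.equiv (γ.equiv (D.glue.equiv.symm (D.glue.equiv b)))
    rw [AlgEquiv.symm_apply_apply]

theorem compMorphism_bijective (hh : Function.Injective h) (hf : f ≠ 0) {n : ℕ}
    {F : Matrix (Fin n) (Fin n) (PS k)} {m : Fin n → C}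
    (hF : IsResolution (h.comp (proj f) : PS k →+* C) F m) (hdet : F.det = f) (R : ArtAlg k) :
    Function.Bijective ((compMorphism (proj f) h).app R) := by
  constructor
  · intro x y hxy
    induction x using Quotient.ind with | _ D =>
    induction y using Quotient.ind with | _ E =>
    exact Quotient.sound (FibreDef.isomorphic_of_comp hh (Quotient.exact hxy))
  · intro x
    induction x using Quotient.ind with | _ D =>
    obtain ⟨FR, mR, hFR, -, -⟩ := exists_lift_resolution D hF
    obtain ⟨E, hE, -, -⟩ := exists_fibreDef hf hF hdet D hFR
    exact ⟨Quotient.mk _ E, Quotient.sound hE⟩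

theorem isIso_compMorphism (hh : Function.Injective h) (hf : f ≠ 0) {n : ℕ}
    {F : Matrix (Fin n) (Fin n) (PS k)} {m : Fin n → C}
    (hF : IsResolution (h.comp (proj f) : PS k →+* C) F m) (hdet : F.det = f) :
    IsIso (compMorphism (proj f) h) := by
  rw [NatTrans.isIso_iff_isIso_app]
  intro R
  rw [isIso_iff_bijective]
  exact compMorphism_bijective hh hf hF hdet R

theorem FormallySmooth.of_bijective {F G : ArtAlg k ⥤ Type (u + 1)} (α : F ⟶ G)
    (hα : ∀ R, Function.Bijective (α.app R)) (hG : FormallySmooth G) : FormallySmooth F := by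
  intro R R' v hv x
  obtain ⟨z, hz⟩ := hG R R' v hv (α.app R' x)
  obtain ⟨w, rfl⟩ := (hα R).2 z
  refine ⟨w, (hα R').1 ?_⟩
  rw [← hz]
  exact NatTrans.naturality_apply α (X := R) (Y := R') v w

theorem defPlane_formallySmooth {B : Type u} [CommRing B] [Algebra k B] {g : PS k →ₐ[k] B}
    (H : ∀ (R R' : ArtAlg k) (v : R →ₐ[k] R'), Function.Surjective v → ∀ D : PlaneDef g R',
      ∃ E : PlaneDef g R, PlaneDef.Isomorphic (E.bc v) D) : FormallySmooth (DefPlane g) := by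
  intro R R' v hv x
  induction x using Quotient.ind with | _ D =>
  obtain ⟨E, hE⟩ := H R R' v hv D
  exact ⟨Quotient.mk _ E, Quotient.sound hE⟩

/-- If every deformation of `B → C` extends to one of `k[[x, y]] → B → C`, the smoothness of the
deformations of the latter implies that of the former. -/
theorem defArrow_formallySmooth {B C : Type u} [CommRing B] [Algebra k B] [CommRing C]
    [Algebra k C] {g : PS k →ₐ[k] B} {h : B →ₐ[k] C} (hs : FormallySmooth (DefFibre g h))
    (H : ∀ (R : ArtAlg k) (D : ArrowDef h R), ∃ E : FibreDef g h R, E.arrow = D) :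
    FormallySmooth (DefArrow h) := by
  intro R R' v hv x
  induction x using Quotient.ind with | _ D =>
  obtain ⟨E, rfl⟩ := H R' D
  obtain ⟨y, hy⟩ := hs R R' v hv (Quotient.mk _ E)
  induction y using Quotient.ind with | _ E' =>
  obtain ⟨γ, α, β, -, h₂, -⟩ := Quotient.exact hy
  exact ⟨Quotient.mk _ E'.arrow, Quotient.sound ⟨α, β, h₂⟩⟩

end Composition

/-! ### Complete modules over a principal ideal -/

section Completeness

/-- The module `M` is complete and separated for the `t`-adic topology: every `t`-divisible element
vanishes and every series `∑ t ^ i • a i` has a sum. -/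
structure IsCompleteAt {T : Type*} [CommRing T] (t : T) (M : Type*) [AddCommGroup M]
    [Module T M] : Prop where
  eq_zero : ∀ x : M, (∀ n : ℕ, ∃ y, x = t ^ n • y) → x = 0
  exists_sum : ∀ a : ℕ → M, ∃ L, ∀ n : ℕ, ∃ y,
    L = ∑ i ∈ Finset.range n, t ^ i • a i + t ^ n • y

variable {T : Type*} [CommRing T] {t : T}

theorem isCompleteAt_of_isAdicComplete [IsAdicComplete (Ideal.span {t}) T] :
    IsCompleteAt t T where
  eq_zero x hx := by
    refine IsHausdorff.haus (I := Ideal.span {t}) inferInstance x fun n => ?_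
    obtain ⟨y, rfl⟩ := hx n
    rw [SModEq.zero, smul_eq_mul, Ideal.mul_top, Ideal.span_singleton_pow,
      Ideal.mem_span_singleton]
    exact ⟨y, rfl⟩
  exists_sum a := by
    obtain ⟨L, hL⟩ := IsPrecomplete.prec (I := Ideal.span {t}) (M := T) inferInstance
      (f := fun n => ∑ i ∈ Finset.range n, t ^ i • a i) fun {m n} hmn => by
        rw [SModEq.sub_mem, smul_eq_mul, Ideal.mul_top, Ideal.span_singleton_pow,
          Ideal.mem_span_singleton, ← dvd_neg, neg_sub, ← Finset.sum_range_add_sum_Ico _ hmn,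
          add_sub_cancel_left]
        exact Finset.dvd_sum fun i hi =>
          (pow_dvd_pow t (Finset.mem_Ico.mp hi).1).trans ⟨a i, rfl⟩
    refine ⟨L, fun n => ?_⟩
    have := hL n
    rw [SModEq.sub_mem, smul_eq_mul, Ideal.mul_top, Ideal.span_singleton_pow,
      Ideal.mem_span_singleton] at this
    obtain ⟨y, hy⟩ := this
    exact ⟨-y, by rw [smul_neg, smul_eq_mul, ← hy]; ring⟩

theorem IsCompleteAt.isAdicComplete (h : IsCompleteAt t T) :
    IsAdicComplete (Ideal.span {t}) T where
  haus' x hx := h.eq_zero x fun n => by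
    have := hx n
    rw [SModEq.zero, smul_eq_mul, Ideal.mul_top, Ideal.span_singleton_pow,
      Ideal.mem_span_singleton] at this
    exact this
  prec' f hf := by
    have h1 : ∀ n, ∃ y, f (n + 1) = f n + t ^ n * y := by
      intro n
      have := (hf (Nat.le_succ n)).symm
      rw [SModEq.sub_mem, smul_eq_mul, Ideal.mul_top, Ideal.span_singleton_pow,
        Ideal.mem_span_singleton] at this
      obtain ⟨y, hy⟩ := this
      exact ⟨y, by rw [← hy]; ring⟩
    choose a ha using h1
    obtain ⟨L, hL⟩ := h.exists_sum a
    have h2 : ∀ n, f n = f 0 + ∑ i ∈ Finset.range n, t ^ i • a i := by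
      intro n
      induction n with
      | zero => simp
      | succ n ih => rw [ha, ih, Finset.sum_range_succ, smul_eq_mul, add_assoc]
    refine ⟨f 0 + L, fun n => ?_⟩
    obtain ⟨y, hy⟩ := hL n
    rw [SModEq.sub_mem, smul_eq_mul, Ideal.mul_top, Ideal.span_singleton_pow,
      Ideal.mem_span_singleton, hy, h2]
    exact ⟨-y, by simp only [smul_eq_mul]; ring⟩

/-- Completeness only depends on the multiplication by `t` on `M`. -/
theorem IsCompleteAt.of_addEquiv {T' M M' : Type*} [CommRing T'] {t' : T'} [AddCommGroup M]
    [Module T M] [AddCommGroup M'] [Module T' M'] (h : IsCompleteAt t M) (e : M ≃+ M')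
    (he : ∀ x, e (t • x) = t' • e x) : IsCompleteAt t' M' := by
  have he' : ∀ (n : ℕ) x, e (t ^ n • x) = t' ^ n • e x := by
    intro n
    induction n with
    | zero => simp
    | succ n ih => intro x; rw [pow_succ, mul_smul, ih, he, ← mul_smul, ← pow_succ]
  constructor
  · intro x hx
    rw [← e.apply_symm_apply x, h.eq_zero (e.symm x) fun n => ?_, map_zero]
    obtain ⟨y, rfl⟩ := hx n
    exact ⟨e.symm y, by rw [AddEquiv.symm_apply_eq, he', AddEquiv.apply_symm_apply]⟩
  · intro a
    obtain ⟨L, hL⟩ := h.exists_sum fun i => e.symm (a i)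
    refine ⟨e L, fun n => ?_⟩
    obtain ⟨y, rfl⟩ := hL n
    exact ⟨e y, by simp [he']⟩

/-- Extensions of complete modules are complete if the quotient is `t`-torsion free. -/
theorem IsCompleteAt.of_exact {M' M M'' : Type*} [AddCommGroup M'] [Module T M']
    [AddCommGroup M] [Module T M] [AddCommGroup M''] [Module T M''] {f : M' →ₗ[T] M}
    {g : M →ₗ[T] M''} (hf : Function.Injective f) (hg : Function.Surjective g)
    (hfg : Function.Exact f g) (h' : IsCompleteAt t M') (h'' : IsCompleteAt t M'')
    (ht : ∀ x : M'', t • x = 0 → x = 0) : IsCompleteAt t M := by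
  have ht' : ∀ (n : ℕ) (x : M''), t ^ n • x = 0 → x = 0 := by
    intro n
    induction n with
    | zero => intro x hx; simpa using hx
    | succ n ih => intro x hx; rw [pow_succ, mul_smul] at hx; exact ht x (ih _ hx)
  constructor
  · intro x hx
    have h1 : g x = 0 := h''.eq_zero _ fun n => by
      obtain ⟨y, rfl⟩ := hx n
      exact ⟨g y, map_smul g _ _⟩
    obtain ⟨z, rfl⟩ := (hfg x).mp h1
    rw [h'.eq_zero z fun n => ?_, map_zero]
    obtain ⟨y, hy⟩ := hx n
    have h2 : g y = 0 := ht' n _ (by rw [← map_smul, ← hy, h1])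
    obtain ⟨w, rfl⟩ := (hfg y).mp h2
    exact ⟨w, hf (by rw [hy, map_smul])⟩
  · intro a
    obtain ⟨L'', hL''⟩ := h''.exists_sum fun i => g (a i)
    obtain ⟨L, rfl⟩ := hg L''
    have h1 : ∀ n, ∃ (y : M) (z : M'),
        L = ∑ i ∈ Finset.range n, t ^ i • a i + t ^ n • y + f z := by
      intro n
      obtain ⟨y'', hy''⟩ := hL'' n
      obtain ⟨y, rfl⟩ := hg y''
      obtain ⟨z, hz⟩ := (hfg (L - (∑ i ∈ Finset.range n, t ^ i • a i + t ^ n • y))).mp (by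
        rw [map_sub, hy'', map_add, map_sum, sub_eq_zero]
        simp)
      exact ⟨y, z, by rw [hz]; abel⟩
    choose y z hyz using h1
    -- the corrections `z n` form a Cauchy sequence, as the quotient is torsion free
    have h2 : ∀ n, ∃ w, z n = z (n + 1) + t ^ n • w := by
      intro n
      have h3 : f (z n - z (n + 1)) = t ^ n • (a n + t • y (n + 1) - y n) := by
        have h4 := (hyz n).symm.trans (hyz (n + 1))
        rw [Finset.sum_range_succ, pow_succ, mul_smul] at h4
        rw [map_sub, smul_sub, smul_add]
        have h5 := congrArg (fun x => x - f (z (n + 1)) -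
          ∑ i ∈ Finset.range n, t ^ i • a i - t ^ n • y n) h4
        refine Eq.trans ?_ (h5.trans ?_) <;> abel
      have h4 : g (a n + t • y (n + 1) - y n) = 0 := ht' n _ (by
        rw [← map_smul, ← h3]
        exact (hfg _).mpr ⟨_, rfl⟩)
      obtain ⟨w, hw⟩ := (hfg _).mp h4
      refine ⟨w, hf ?_⟩
      rw [map_add, map_smul, hw, ← h3, map_sub]
      abel
    choose w hw using h2
    obtain ⟨L', hL'⟩ := h'.exists_sum w
    have h3 : ∀ n, z 0 = ∑ i ∈ Finset.range n, t ^ i • w i + z n := by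
      intro n
      induction n with
      | zero => simp
      | succ n ih => rw [Finset.sum_range_succ, ih, hw n]; abel
    refine ⟨L - f (z 0 - L'), fun n => ?_⟩
    obtain ⟨v, hv⟩ := hL' n
    refine ⟨y n + f v, ?_⟩
    have h4 : z 0 - L' = z n - t ^ n • v := by rw [hv, h3 n]; abel
    rw [h4, map_sub, map_smul, smul_add]
    nth_rewrite 1 [hyz n]
    abel

/-- Over a `t`-adically complete ring, a `t`-adically separated module generated modulo `t` by
finitely many elements is generated by them. -/
theorem IsCompleteAt.span_eq_top (h : IsCompleteAt t T) {M : Type*} [AddCommGroup M] [Module T M]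
    (hM : ∀ x : M, (∀ n : ℕ, ∃ y, x = t ^ n • y) → x = 0) {ι : Type*} [Finite ι] (e : ι → M)
    (he : ∀ x, ∃ y, x - t • y ∈ Submodule.span T (Set.range e)) :
    Submodule.span T (Set.range e) = ⊤ := by
  cases nonempty_fintype ι
  rw [eq_top_iff]
  rintro x -
  choose y hy using he
  choose c hc using fun x => (Submodule.mem_span_range_iff_exists_fun T).mp (hy x)
  let z : ℕ → M := fun n => y^[n] x
  have hz : ∀ n, x = ∑ i ∈ Finset.range n, t ^ i • ∑ j, c (z i) j • e j + t ^ n • z n := by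
    intro n
    induction n with
    | zero => simp [z]
    | succ n ih =>
      rw [Finset.sum_range_succ, hc, smul_sub, pow_succ, mul_smul]
      have : z (n + 1) = y (z n) := Function.iterate_succ_apply' y n x
      rw [this]
      nth_rewrite 1 [ih]
      abel
  choose L hL using fun j => h.exists_sum fun i => c (z i) j
  have : x - ∑ j, L j • e j = 0 := hM _ fun n => by
    choose w hw using fun j => hL j n
    refine ⟨z n - ∑ j, w j • e j, ?_⟩
    have h1 : ∑ j, L j • e j = ∑ i ∈ Finset.range n, t ^ i • ∑ j, c (z i) j • e j +
        t ^ n • ∑ j, w j • e j := by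
      simp only [Finset.smul_sum]
      rw [Finset.sum_comm, ← Finset.sum_add_distrib]
      refine Finset.sum_congr rfl fun j _ => ?_
      rw [hw j, add_smul, Finset.sum_smul]
      simp [mul_smul]
    rw [h1]
    nth_rewrite 1 [hz n]
    rw [smul_sub]
    abel
  rw [sub_eq_zero.mp this]
  exact Submodule.sum_mem _ fun j _ => Submodule.smul_mem _ _ (Submodule.subset_span ⟨j, rfl⟩)

theorem IsCompleteAt.of_finite (h : IsCompleteAt t T) {M : Type*} [AddCommGroup M] [Module T M]
    (hM : ∀ x : M, (∀ n : ℕ, ∃ y, x = t ^ n • y) → x = 0) [Module.Finite T M] :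
    IsCompleteAt t M where
  eq_zero := hM
  exists_sum a := by
    obtain ⟨n, e, he⟩ := Module.Finite.exists_fin (R := T) (M := M)
    choose c hc using fun i => (Submodule.mem_span_range_iff_exists_fun T).mp
      (he ▸ Submodule.mem_top : a i ∈ Submodule.span T (Set.range e))
    choose L hL using fun j => h.exists_sum fun i => c i j
    refine ⟨∑ j, L j • e j, fun n => ?_⟩
    choose w hw using fun j => hL j n
    refine ⟨∑ j, w j • e j, ?_⟩
    simp only [← hc, Finset.smul_sum]
    rw [Finset.sum_comm, ← Finset.sum_add_distrib]
    refine Finset.sum_congr rfl fun j _ => ?_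
    rw [hw j, add_smul, Finset.sum_smul]
    simp [mul_smul]

end Completeness

/-! ### Evaluation of power series -/

section Evaluation

open MvPowerSeries in
/-- Power series can be evaluated at elements of the radical of an ideal for which the ring is
complete. -/
theorem exists_mvPowerSeries_algHom {σ A B : Type*} [Finite σ] [CommRing A] [CommRing B]
    [Algebra A B] (I : Ideal B) [hI : IsAdicComplete I B] (b : σ → B) (hb : ∀ i, b i ∈ I.radical) :
    ∃ φ : MvPowerSeries σ A →ₐ[A] B, ∀ i, φ (X i) = b i := by
  let _ : UniformSpace A := ⊥
  have : DiscreteUniformity A := ⟨rfl⟩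
  let _ : WithIdeal B := ⟨I⟩
  have hadic : IsAdic I := rfl
  obtain ⟨_, _⟩ := hadic.isAdicComplete_iff.mp hI
  have : ContinuousSMul A B := ⟨by
    rw [continuous_prod_of_discrete_left]
    intro a
    simp only [Algebra.smul_def]
    exact continuous_const.mul continuous_id⟩
  have hev : HasEval b := by
    refine ⟨fun i => ?_, by simp [Filter.cofinite_eq_bot]⟩
    obtain ⟨n, hn⟩ := hb i
    refine hadic.hasBasis_nhds_zero.tendsto_right_iff.mpr fun m _ => ?_
    filter_upwards [Filter.eventually_ge_atTop (n * m)] with l hl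
    refine Ideal.pow_le_pow_right (I := Ideal.span {b i}) hl |>.trans ?_
      (Ideal.pow_mem_pow (Ideal.mem_span_singleton_self _) l)
    rw [Ideal.span_singleton_pow, Ideal.span_singleton_le_iff_mem, pow_mul]
    exact Ideal.pow_mem_pow hn m
  refine ⟨aeval hev, fun i => ?_⟩
  rw [← MvPolynomial.coe_X, aeval_coe, MvPolynomial.aeval_X]

/-- Homomorphisms on power series to a separated ring are determined by the images of the
variables. -/
theorem mvPowerSeries_algHom_ext {σ A B : Type*} [Fintype σ] [CommRing A] [CommRing B]
    [Algebra A B] (I : Ideal B) [IsHausdorff I B]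
    (hσ : ∀ p : MvPowerSeries σ A, ∃ (c : A) (q : σ → MvPowerSeries σ A),
      p = algebraMap A _ c + ∑ i, MvPowerSeries.X i * q i)
    {φ ψ : MvPowerSeries σ A →ₐ[A] B} (hφ : ∀ i, φ (MvPowerSeries.X i) ∈ I.radical)
    (h : ∀ i, φ (MvPowerSeries.X i) = ψ (MvPowerSeries.X i)) : φ = ψ := by
  let J := Ideal.span (Set.range fun i => φ (MvPowerSeries.X i))
  have hJ : ∀ (n : ℕ) (p : MvPowerSeries σ A), φ p - ψ p ∈ J ^ n := by
    intro n
    induction n with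
    | zero => simp
    | succ n ih =>
      intro p
      obtain ⟨c, q, rfl⟩ := hσ p
      rw [map_add, map_add, AlgHom.commutes, AlgHom.commutes, add_sub_add_left_eq_sub, map_sum,
        map_sum, ← Finset.sum_sub_distrib]
      refine Ideal.sum_mem _ fun i _ => ?_
      rw [map_mul, map_mul, ← h, ← mul_sub, pow_succ']
      exact Ideal.mul_mem_mul (Ideal.subset_span ⟨i, rfl⟩) (ih _)
  obtain ⟨N, hN⟩ := Ideal.exists_pow_le_of_le_radical_of_fg (I := J) (J := I)
    (Ideal.span_le.mpr (by rintro _ ⟨i, rfl⟩; exact hφ i))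
    (Submodule.fg_span (Set.finite_range _))
  ext p
  rw [← sub_eq_zero]
  refine IsHausdorff.haus (I := I) inferInstance _ fun n => ?_
  rw [SModEq.zero, smul_eq_mul, Ideal.mul_top]
  have := hJ (N * n) p
  rw [pow_mul] at this
  exact Ideal.pow_right_mono hN n this

theorem ps_exists_eq_add {A : Type u} [CommRing A] (p : PS A) :
    ∃ (c : A) (q : Fin 2 → PS A), p = algebraMap A _ c + ∑ i, MvPowerSeries.X i * q i := by
  classical
  let p₁ : PS A := fun d => if d 0 = 0 then MvPowerSeries.coeff d p else 0
  have hp₁ : ∀ d, MvPowerSeries.coeff d p₁ = if d 0 = 0 then MvPowerSeries.coeff d p else 0 :=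
    fun d => rfl
  obtain ⟨q₀, hq₀⟩ := (MvPowerSeries.X_dvd_iff (s := (0 : Fin 2)) (φ := p - p₁)).mpr fun d hd => by
    rw [map_sub, hp₁, if_pos hd, sub_self]
  set c := MvPowerSeries.constantCoeff p
  obtain ⟨q₁, hq₁⟩ := (MvPowerSeries.X_dvd_iff (s := (1 : Fin 2))
      (φ := p₁ - MvPowerSeries.C c)).mpr fun d hd => by
    rw [map_sub, hp₁, MvPowerSeries.coeff_C]
    by_cases h0 : d 0 = 0
    · have : d = 0 := by ext i; fin_cases i <;> assumption
      subst this
      simp [c]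
    · rw [if_neg h0, if_neg (by rintro rfl; exact h0 rfl), sub_self]
  refine ⟨c, ![q₀, q₁], ?_⟩
  rw [Fin.sum_univ_two, MvPowerSeries.algebraMap_apply, Algebra.algebraMap_self_apply]
  simp only [Matrix.cons_val_zero, Matrix.cons_val_one]
  rw [← hq₀, ← hq₁]
  abel

theorem powerSeries_exists_eq_add {A : Type*} [CommRing A] (p : MvPowerSeries Unit A) :
    ∃ (c : A) (q : Unit → MvPowerSeries Unit A),
      p = algebraMap A _ c + ∑ i, MvPowerSeries.X i * q i := by
  obtain ⟨q, hq⟩ := (PowerSeries.X_dvd_iff (φ := (p : PowerSeries A) -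
    PowerSeries.C (PowerSeries.constantCoeff (p : PowerSeries A)))).mpr (by simp)
  refine ⟨PowerSeries.constantCoeff (p : PowerSeries A), fun _ => q, ?_⟩
  rw [Fintype.sum_unique]
  exact eq_add_of_sub_eq' hq

end Evaluation

/-! ### Completeness of deformations -/

section CompleteDeformations

variable {k : Type u} [Field k] {R : ArtAlg k} {B : Type u} [CommRing B] [Algebra k B]

/-- The properties of the pair `(B, t)` which are used to lift homomorphisms from power series rings
to deformations of `B`: `t` is a nonzerodivisor and `B` is `t`-adically complete. -/
structure IsParameter (t : B) : Prop where
  eq_zero_of_mul : ∀ b : B, t * b = 0 → b = 0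
  isCompleteAt : IsCompleteAt t B

/-- If `S` is a simple `R`-module then `X ⊗ S = B` for a deformation `X` of `B` over `R`. -/
theorem Deformation.exists_tensor_simple (X : Deformation B R) {s : X} {t : B}
    (hs : X.red s = t) (M : Type u) [AddCommGroup M] [Module R M] [IsSimpleModule R M] :
    ∃ e : X ⊗[R] M ≃+ B, ∀ z, e (s • z) = t • e z := by
  obtain ⟨I, hI, ⟨e⟩⟩ := isSimpleModule_iff_quot_maximal.mp ‹IsSimpleModule R M›
  obtain rfl := IsLocalRing.eq_maximalIdeal hI
  set I := IsLocalRing.maximalIdeal R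
  let _ : Module R B := Module.compHom B ((algebraMap k B).comp (R.aug : R →+* k))
  let ρ : X →ₗ[R] B :=
    { toFun := X.red
      map_add' := map_add _
      map_smul' := fun r x => by
        rw [Algebra.smul_def, map_mul, X.red_algebraMap]
        rfl }
  have hρ : ∀ x, ρ x = 0 ↔ x ∈ I • (⊤ : Submodule R X) := X.red_eq_zero_iff
  let ρ' : (X ⧸ I • (⊤ : Submodule R X)) →ₗ[R] B := Submodule.liftQ _ ρ fun x hx => (hρ x).mpr hx
  have hρ' : Function.Bijective ρ' := by
    constructor
    · rw [injective_iff_map_eq_zero]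
      intro z hz
      obtain ⟨x, rfl⟩ := Submodule.Quotient.mk_surjective _ z
      exact (Submodule.Quotient.mk_eq_zero _).mpr ((hρ x).mp hz)
    · intro b
      obtain ⟨x, rfl⟩ := X.red_surjective b
      exact ⟨Submodule.Quotient.mk x, rfl⟩
  let E : X ⊗[R] M ≃ₗ[R] B := (TensorProduct.congr (LinearEquiv.refl R X) e) ≪≫ₗ
    TensorProduct.tensorQuotEquivQuotSMul X I ≪≫ₗ LinearEquiv.ofBijective ρ' hρ'
  refine ⟨E.toAddEquiv, fun z => ?_⟩
  change E (s • z) = t • E z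
  induction z using TensorProduct.induction_on with
  | zero => simp
  | add a b ha hb => rw [smul_add, map_add, map_add, ha, hb, smul_add]
  | tmul x m =>
    obtain ⟨r, hr⟩ := Ideal.Quotient.mk_surjective (e m)
    have hE : ∀ x, E (x ⊗ₜ m) = r • X.red x := by
      intro x
      simp only [E, LinearEquiv.trans_apply, TensorProduct.congr_tmul, ← hr]
      rw [TensorProduct.tensorQuotEquivQuotSMul_tmul_mk, LinearEquiv.ofBijective_apply]
      exact map_smul ρ r x
    rw [TensorProduct.smul_tmul', hE, hE, smul_eq_mul, smul_eq_mul, map_mul, hs]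
    exact mul_left_comm _ _ _

/-- A deformation of a `t`-adically complete algebra is complete for every lift of the
nonzerodivisor `t`: for every `R`-module `M` of finite length, `X ⊗ M` is an iterated extension of
copies of `B`. -/
theorem Deformation.isCompleteAt_tensor (X : Deformation B R) {s : X} {t : B}
    (hs : X.red s = t) (ht : IsParameter t) (M : Type u) [AddCommGroup M] [Module R M]
    (hM : IsFiniteLength R M) :
    IsCompleteAt s (X ⊗[R] M) ∧ ∀ z : X ⊗[R] M, s • z = 0 → z = 0 := by
  have := X.flat
  induction hM with
  | @of_subsingleton M _ _ _ =>
    have : Subsingleton (X ⊗[R] M) := by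
      refine subsingleton_of_forall_eq 0 fun z => ?_
      induction z using TensorProduct.induction_on with
      | zero => rfl
      | add a b ha hb => rw [ha, hb, add_zero]
      | tmul x m => rw [Subsingleton.elim m 0, TensorProduct.tmul_zero]
    exact ⟨⟨fun _ _ => Subsingleton.elim _ _, fun _ => ⟨0, fun _ => ⟨0, Subsingleton.elim _ _⟩⟩⟩,
      fun _ _ => Subsingleton.elim _ _⟩
  | @of_simple_quotient M _ _ N hsimp hN ih =>
    obtain ⟨e, he⟩ := X.exists_tensor_simple hs (M ⧸ N)
    have hc : IsCompleteAt s (X ⊗[R] (M ⧸ N)) := ht.isCompleteAt.of_addEquiv e.symm fun b => by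
      rw [AddEquiv.symm_apply_eq, he, AddEquiv.apply_symm_apply]
    have hz : ∀ z : X ⊗[R] (M ⧸ N), s • z = 0 → z = 0 := fun z h => by
      have := he z
      rw [h, map_zero, smul_eq_mul] at this
      exact (map_eq_zero_iff e e.injective).mp (ht.eq_zero_of_mul _ this.symm)
    have hinj : Function.Injective (N.subtype.baseChange X) :=
      Module.Flat.lTensor_preserves_injective_linearMap _ N.injective_subtype
    have hsur : Function.Surjective (N.mkQ.baseChange X) :=
      LinearMap.lTensor_surjective _ N.mkQ_surjective
    have hex : Function.Exact (N.subtype.baseChange X) (N.mkQ.baseChange X) :=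
      lTensor_exact X (LinearMap.exact_subtype_mkQ N) N.mkQ_surjective
    refine ⟨ih.1.of_exact hinj hsur hex hc hz, fun z h => ?_⟩
    have h1 : N.mkQ.baseChange X z = 0 := hz _ (by rw [← map_smul, h, map_zero])
    obtain ⟨w, rfl⟩ := (hex z).mp h1
    rw [ih.2 w (hinj (by rw [map_smul, h, map_zero])), map_zero]

/-- A lift of a parameter to a deformation is a parameter. -/
theorem Deformation.isParameter (X : Deformation B R) {s : X} {t : B}
    (hs : X.red s = t) (ht : IsParameter t) : IsParameter s := by
  obtain ⟨h1, h2⟩ := X.isCompleteAt_tensor hs ht R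
    (isFiniteLength_iff_isNoetherian_isArtinian.mpr ⟨inferInstance, inferInstance⟩)
  have he : ∀ z, TensorProduct.rid R X (s • z) = s • TensorProduct.rid R X z := by
    intro z
    induction z using TensorProduct.induction_on with
    | zero => simp
    | add a b ha hb => rw [smul_add, map_add, map_add, ha, hb, smul_add]
    | tmul x r => simp [TensorProduct.smul_tmul']
  refine ⟨fun b hb => ?_, h1.of_addEquiv (TensorProduct.rid R X).toAddEquiv he⟩
  obtain ⟨z, rfl⟩ := (TensorProduct.rid R X).surjective b
  rw [h2 z ((TensorProduct.rid R X).injective ?_), map_zero]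
  rw [he, smul_eq_mul, hb, map_zero]

theorem Deformation.mem_radical (X : Deformation B R) {s b : X}
    (hb : X.red b ∈ (Ideal.span {X.red s}).radical) : b ∈ (Ideal.span {s}).radical := by
  obtain ⟨n, hn⟩ := hb
  obtain ⟨c, hc⟩ := Ideal.mem_span_singleton'.mp hn
  obtain ⟨c, rfl⟩ := X.red_surjective c
  obtain ⟨N, hN⟩ := X.isNilpotent_ker_red
  have h1 : b ^ n - c * s ∈ (Ideal.span {s}).radical := by
    refine ⟨N, ?_⟩
    have : (b ^ n - c * s) ^ N ∈ RingHom.ker X.red ^ N := Ideal.pow_mem_pow (by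
      rw [RingHom.mem_ker, map_sub, map_mul, map_pow, hc, sub_self]) N
    rw [hN, Ideal.zero_eq_bot, Ideal.mem_bot] at this
    rw [this]
    exact zero_mem _
  have h2 := add_mem h1 (Ideal.le_radical
    (Ideal.mul_mem_left _ c (Ideal.mem_span_singleton_self s)))
  rw [sub_add_cancel] at h2
  exact (Ideal.radical_isRadical _) ⟨n, h2⟩

/-- Power series over `A` can be evaluated at elements with a power divisible by a parameter; `A` acts
through a homomorphism `α` without any topology on `A`. -/
theorem IsParameter.exists_eval {t : B} (ht : IsParameter t) {σ A : Type*} [Finite σ] [CommRing A]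
    (α : A →+* B) (b : σ → B) (hb : ∀ i, b i ∈ (Ideal.span {t}).radical) :
    ∃ φ : MvPowerSeries σ A →+* B, (∀ a, φ (algebraMap A _ a) = α a) ∧
      ∀ i, φ (MvPowerSeries.X i) = b i := by
  have := ht.isCompleteAt.isAdicComplete
  let _ : Algebra A B := α.toAlgebra
  obtain ⟨φ, hφ⟩ := exists_mvPowerSeries_algHom (A := A) (Ideal.span {t}) b hb
  exact ⟨φ, φ.commutes, hφ⟩

theorem IsParameter.hom_ext {t : B} (ht : IsParameter t) {σ A : Type*} [Fintype σ] [CommRing A]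
    (hσ : ∀ p : MvPowerSeries σ A, ∃ (c : A) (q : σ → MvPowerSeries σ A),
      p = algebraMap A _ c + ∑ i, MvPowerSeries.X i * q i)
    {φ ψ : MvPowerSeries σ A →+* B} (h₁ : ∀ a, φ (algebraMap A _ a) = ψ (algebraMap A _ a))
    (hφ : ∀ i, φ (MvPowerSeries.X i) ∈ (Ideal.span {t}).radical)
    (h₂ : ∀ i, φ (MvPowerSeries.X i) = ψ (MvPowerSeries.X i)) (p : MvPowerSeries σ A) :
    φ p = ψ p := by
  have := ht.isCompleteAt.isAdicComplete
  let _ : Algebra A B := (φ.comp (algebraMap A _)).toAlgebra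
  exact DFunLike.congr_fun (mvPowerSeries_algHom_ext (A := A) (Ideal.span {t}) hσ
    (φ := ⟨φ, fun _ => rfl⟩) (ψ := ⟨ψ, fun a => (h₁ a).symm⟩) hφ h₂) p

/-- Every homomorphism `k[[x, y]] → B` lifts to a deformation of `B`, with arbitrary lifts of the
images of `x` and `y`. -/
theorem Deformation.exists_ps_hom (X : Deformation B R) {t : B} (ht : IsParameter t)
    (g : PS k →ₐ[k] B) (hg : ∀ i, g (MvPowerSeries.X i) ∈ (Ideal.span {t}).radical)
    (b : Fin 2 → X) (hb : ∀ i, X.red (b i) = g (MvPowerSeries.X i)) :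
    ∃ φ : PS R →ₐ[R] X, (∀ p, X.red (φ p) = g (psRed R p)) ∧
      ∀ i, φ (MvPowerSeries.X i) = b i := by
  obtain ⟨s, hs⟩ := X.red_surjective t
  have hs' := X.isParameter hs ht
  obtain ⟨φ, hφ₁, hφ₂⟩ := hs'.exists_eval ((algebraMap R X).comp (algebraMap k R)) b fun i =>
    X.mem_radical (by rw [hb, hs]; exact hg i)
  have hred : ∀ p, X.red (φ p) = g p := ht.hom_ext (φ := X.red.comp φ) (ψ := (g : PS k →+* B))
    ps_exists_eq_add (fun a => by
      rw [RingHom.comp_apply, hφ₁, RingHom.comp_apply, X.red_algebraMap, RingHom.coe_coe,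
        g.commutes]
      simp) (fun i => by
      rw [RingHom.comp_apply, hφ₂, hb]; exact hg i) (fun i => by
      rw [RingHom.comp_apply, hφ₂, hb]; rfl)
  let Φ : PS R →ₐ[R] X := psLift (k := k) φ fun c => hφ₁ c
  have hΦ : ∀ p, Φ (psIncl R p) = φ p := psLift_incl φ fun c => hφ₁ c
  refine ⟨Φ, ?_, fun i => ?_⟩
  · refine ps_ringHom_ext (k := k) (f := X.red.comp (Φ : PS R →+* X))
      (g := (g : PS k →+* B).comp (psRed R)) (fun r => ?_) fun p => ?_
    · rw [RingHom.comp_apply, RingHom.coe_coe, AlgHom.commutes, X.red_algebraMap,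
        RingHom.comp_apply, PlaneDef.aug_algebraMap, RingHom.coe_coe, g.commutes]
    · rw [RingHom.comp_apply, RingHom.coe_coe, hΦ, hred, RingHom.comp_apply, PlaneDef.aug_incl]
      rfl
  · rw [← MvPowerSeries.map_X (algebraMap k R) i, hΦ, hφ₂]

/-- Two deformations of `k[[x, y]] → B` whose targets are identified are isomorphic if the images of
`x` and `y` coincide. -/
theorem PlaneDef.isomorphic_of_X {t : B} (ht : IsParameter t) {g : PS k →ₐ[k] B}
    (hg : ∀ i, g (MvPowerSeries.X i) ∈ (Ideal.span {t}).radical) {D E : PlaneDef g R}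
    (β : Deformation.Iso D.tgt E.tgt)
    (h : ∀ i, E.hom (MvPowerSeries.X i) = β.equiv (D.hom (MvPowerSeries.X i))) :
    PlaneDef.Isomorphic D E := by
  refine ⟨β, PlaneDef.hom_ext β ?_⟩
  obtain ⟨s, hs⟩ := E.tgt.red_surjective t
  have hX : ∀ i, psIncl R (MvPowerSeries.X i : PS k) = MvPowerSeries.X i :=
    fun i => MvPowerSeries.map_X _ i
  refine (E.tgt.isParameter hs ht).hom_ext (σ := Fin 2) (A := k)
    (φ := (E.hom : PS R →+* E.tgt).comp (psIncl R))
    (ψ := (β.equiv : D.tgt →+* E.tgt).comp ((D.hom : PS R →+* D.tgt).comp (psIncl R)))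
    ps_exists_eq_add (fun a => ?_) (fun i => ?_) fun i => ?_
  · have : psIncl R (algebraMap k (PS k) a) = algebraMap R (PS R) (algebraMap k R a) := by
      simp [MvPowerSeries.algebraMap_apply]
    simp only [RingHom.comp_apply, this]
    exact (E.hom.commutes _).trans ((β.equiv.toAlgHom.comp D.hom).commutes _).symm
  · refine E.tgt.mem_radical ?_
    rw [RingHom.comp_apply, hX, RingHom.coe_coe, E.red_hom, hs, MvPowerSeries.map_X]
    exact hg i
  · simp only [RingHom.comp_apply, hX]
    exact h i

end CompleteDeformations

/-! ### Algebras whose deformations are trivial -/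

section TrivialDeformations

variable (k : Type u) [Field k]

/-- The field `k` as an object of `Art_k`. -/
def ArtAlg.base : ArtAlg k where
  carrier := k
  residue_surjective := IsLocalRing.residue_surjective

variable {k} (B : Type u) [CommRing B] [Algebra k B]

/-- The algebra `B` as a deformation of itself over `k`. -/
def Deformation.base : Deformation B (ArtAlg.base k) where
  carrier := B
  commRing := inferInstance
  algebra := inferInstanceAs (Algebra k B)
  flat := inferInstanceAs (Module.Flat k B)
  red := RingHom.id B
  red_algebraMap r := congrArg (algebraMap k B) ((ArtAlg.base k).aug.commutes r).symm
  red_surjective := Function.surjective_id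
  ker_red := by
    have h : IsLocalRing.maximalIdeal (ArtAlg.base k) = ⊥ :=
      IsLocalRing.isField_iff_maximalIdeal_eq.mp (Field.toIsField k)
    rw [h, Ideal.map_bot]
    exact (RingHom.injective_iff_ker_eq_bot _).mp Function.injective_id

/-- Every deformation of `B` has a section over `k`, i.e. it is isomorphic to the trivial one. -/
def HasSections : Prop :=
  ∀ (R : ArtAlg k) (X : Deformation B R), ∃ τ : B →+* X, (∀ b, X.red (τ b) = b) ∧
    ∀ c : k, τ (algebraMap k B c) = algebraMap R X (algebraMap k R c)

variable {B} {R R' : ArtAlg k}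

theorem HasSections.nonempty_iso (hB : HasSections (k := k) B) (w : ArtAlg.base k →ₐ[k] R)
    (X : Deformation B R) : Nonempty (((Deformation.base B).bc w).Iso X) := by
  obtain ⟨τ, h₁, h₂⟩ := hB R X
  let τ : Deformation.base (k := k) B →+* X := τ
  have hw : ∀ r : ArtAlg.base k, τ (algebraMap (ArtAlg.base k) (Deformation.base B) r) =
      algebraMap R X (w r) := fun r => (h₂ r).trans (congrArg (algebraMap R X) (w.commutes r).symm)
  let φ : (Deformation.base B).bc w →ₐ[R] X := BC.lift (w : ArtAlg.base k →+* R) τ hw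
  have hφ : ∀ b, φ ((Deformation.base B).toBC w b) = τ b :=
    fun b => BC.lift_incl (w : ArtAlg.base k →+* R) τ hw b
  exact ⟨Deformation.isoOfRed φ (Deformation.red_eq (AlgHom.id k B) φ fun b => by
    rw [hφ]; exact h₁ b)⟩

/-- Deformations lift along all homomorphisms, as they are trivial. -/
theorem HasSections.exists_lift (hB : HasSections (k := k) B) (v : R →ₐ[k] R')
    (Y : Deformation B R') : ∃ X : Deformation B R, Nonempty ((X.bc v).Iso Y) := by
  let w : ArtAlg.base k →ₐ[k] R := Algebra.ofId k R
  obtain ⟨e⟩ := hB.nonempty_iso (v.comp w) Y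
  exact ⟨(Deformation.base B).bc w, ⟨((Deformation.base B).compIso w v).symm.trans e⟩⟩

theorem Deformation.toBC_surjective (X : Deformation B R) (v : R →ₐ[k] R')
    (hv : Function.Surjective v) : Function.Surjective (X.toBC v) := by
  intro z
  refine BC.induction_on (v : R →+* R') (p := fun z => ∃ x, X.toBC v x = z) z
    ⟨0, map_zero _⟩ ?_ ?_
  · intro r x
    obtain ⟨r, rfl⟩ := hv r
    exact ⟨algebraMap R X r * x, by rw [map_mul, X.toBC_algebraMap]; rfl⟩
  · rintro _ _ ⟨a, rfl⟩ ⟨b, rfl⟩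
    exact ⟨a + b, map_add _ _ _⟩

/-- If the deformations of `B` are trivial, a deformation of `k[[x, y]] → B` is given by lifts of the
images of `x` and `y`, which lift further along surjections. -/
theorem HasSections.formallySmooth_defPlane (hB : HasSections (k := k) B) {t : B}
    (ht : IsParameter t) {g : PS k →ₐ[k] B}
    (hg : ∀ i, g (MvPowerSeries.X i) ∈ (Ideal.span {t}).radical) :
    FormallySmooth (DefPlane g) := by
  refine defPlane_formallySmooth fun R R' v hv D => ?_
  obtain ⟨X, ⟨e⟩⟩ := hB.exists_lift v D.tgt
  choose b hb using fun i : Fin 2 =>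
    X.toBC_surjective v hv (e.symm.equiv (D.hom (MvPowerSeries.X i)))
  obtain ⟨φ, h₁, h₂⟩ := X.exists_ps_hom ht g hg b fun i => by
    rw [← X.red_toBC v, hb, e.symm.red_equiv, D.red_hom, MvPowerSeries.map_X]
  refine ⟨⟨X, φ, h₁⟩, PlaneDef.isomorphic_of_X ht hg e fun i => ?_⟩
  change _ = e.equiv (PlaneDef.bcHom v ⟨X, φ, h₁⟩ _)
  have := PlaneDef.bcHom_incl v ⟨X, φ, h₁⟩ (MvPowerSeries.X i)
  rw [MvPowerSeries.map_X, MvPowerSeries.map_X] at this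
  rw [this]
  change _ = e.equiv (X.toBC v (φ _))
  rw [h₂, hb]
  exact (e.equiv.apply_symm_apply _).symm

/-- Every deformation of `B → C` extends to one of `k[[x, y]] → B → C`. -/
theorem ArrowDef.exists_fibreDef {C : Type u} [CommRing C] [Algebra k C] {h : B →ₐ[k] C} {t : B}
    (ht : IsParameter t) {g : PS k →ₐ[k] B}
    (hg : ∀ i, g (MvPowerSeries.X i) ∈ (Ideal.span {t}).radical) (D : ArrowDef h R) :
    ∃ E : FibreDef g h R, E.arrow = D := by
  choose b hb using fun i : Fin 2 => D.src.red_surjective (g (MvPowerSeries.X i))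
  obtain ⟨φ, h₁, -⟩ := D.src.exists_ps_hom ht g hg b hb
  exact ⟨⟨⟨D.src, φ, h₁⟩, D, .refl _⟩, rfl⟩

end TrivialDeformations

/-! ### Power series rings over smooth algebras have trivial deformations -/

section Sections

variable {k : Type u} [Field k] {B : Type u} [CommRing B] [Algebra k B]

/-- Let `B` be complete for a parameter `t₀`. If `t` generates the radical of `(t₀)` and `B/(t)` is
formally smooth over `k`, then `B` is a power series ring over `B/(t)`, so homomorphisms on `B`
lift along nilpotent thickenings. -/
theorem hasSections_of_radical_eq {t₀ t : B} (ht₀ : IsParameter t₀)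
    (ht : (Ideal.span {t₀}).radical = Ideal.span {t})
    [Algebra.FormallySmooth k (B ⧸ Ideal.span {t})] : HasSections (k := k) B := by
  have htr : t ∈ (Ideal.span {t₀}).radical := ht ▸ Ideal.mem_span_singleton_self t
  have hdvd : t ∣ t₀ := Ideal.mem_span_singleton.mp
    (ht ▸ Ideal.le_radical (Ideal.mem_span_singleton_self t₀))
  obtain ⟨N, hN⟩ := htr
  rw [Ideal.mem_span_singleton] at hN
  have hcan : ∀ b, t * b = 0 → b = 0 := fun b hb => by
    obtain ⟨c, hc⟩ := hdvd
    exact ht₀.eq_zero_of_mul b (by rw [hc, mul_right_comm, hb, zero_mul])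
  have htop : ∀ x : B, (∀ n : ℕ, t ^ n ∣ x) → x = 0 := fun x hx =>
    ht₀.isCompleteAt.eq_zero x fun n => by
      obtain ⟨y, hy⟩ := (pow_dvd_pow_of_dvd hN n).trans (pow_mul t N n ▸ hx (N * n))
      exact ⟨y, hy⟩
  let k' := B ⧸ Ideal.span {t}
  -- a section of `B → B/(t)`: lift along `B/(t₀) → B/(t)` and then along `B → B/(t₀)`
  have hle : Ideal.span {t₀} ≤ Ideal.span {t} := ht ▸ Ideal.le_radical
  obtain ⟨σ, hσ⟩ : ∃ σ : k' →ₐ[k] B, ∀ c, Ideal.Quotient.mk (Ideal.span {t}) (σ c) = c := by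
    let π : (B ⧸ Ideal.span {t₀}) →ₐ[k] k' := Ideal.Quotient.factorₐ k hle
    have hπ : Function.Surjective π := Ideal.Quotient.factor_surjective hle
    have hnil : IsNilpotent (RingHom.ker (π : (B ⧸ Ideal.span {t₀}) →+* k')) := by
      refine ⟨N, ?_⟩
      have : RingHom.ker (π : (B ⧸ Ideal.span {t₀}) →+* k') =
          Ideal.span {Ideal.Quotient.mk (Ideal.span {t₀}) t} := by
        refine (Ideal.Quotient.factor_ker hle).trans ?_
        rw [Ideal.map_span, Set.image_singleton]
      rw [this, Ideal.span_singleton_pow, ← map_pow, Ideal.zero_eq_bot,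
        Ideal.span_singleton_eq_bot, Ideal.Quotient.eq_zero_iff_mem, Ideal.mem_span_singleton]
      exact hN
    let σ₁ : k' →ₐ[k] (B ⧸ Ideal.span {t₀}) :=
      Algebra.FormallySmooth.liftOfSurjective (AlgHom.id k k') π hπ hnil
    have hσ₁ : ∀ c, π (σ₁ c) = c :=
      Algebra.FormallySmooth.liftOfSurjective_apply (AlgHom.id k k') π hπ hnil
    have := ht₀.isCompleteAt.isAdicComplete
    obtain ⟨σ, hσ⟩ := Algebra.FormallySmooth.exists_mkₐ_comp_eq_of_isAdicComplete
      (I := Ideal.span {t₀}) σ₁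
    refine ⟨σ, fun c => ?_⟩
    have h1 := DFunLike.congr_fun hσ c
    conv_rhs => rw [← hσ₁ c, ← h1]
    rfl
  have hdec : ∀ b : B, ∃ c, b = σ (Ideal.Quotient.mk _ b) + t * c := fun b => by
    have : b - σ (Ideal.Quotient.mk _ b) ∈ Ideal.span {t} := by
      rw [← Ideal.Quotient.eq_zero_iff_mem, map_sub, hσ, sub_self]
    obtain ⟨c, hc⟩ := Ideal.mem_span_singleton'.mp this
    exact ⟨c, by rw [mul_comm, hc]; abel⟩
  obtain ⟨φ, hφ₁, hφ₂⟩ := ht₀.exists_eval (σ : k' →+* B) (fun _ : Unit => t) fun _ => ⟨N, by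
    rw [Ideal.mem_span_singleton]; exact hN⟩
  -- the power series ring over `B/(t)` maps isomorphically to `B`
  have hinj : Function.Injective φ := by
    rw [injective_iff_map_eq_zero]
    have step : ∀ p, φ p = 0 → ∃ q, p = MvPowerSeries.X () * q ∧ φ q = 0 := by
      intro p hp
      obtain ⟨c, q, rfl⟩ := powerSeries_exists_eq_add p
      rw [Fintype.sum_unique] at hp ⊢
      rw [map_add, map_mul, hφ₁, hφ₂] at hp
      have hc : c = 0 := by
        rw [← hσ c, Ideal.Quotient.eq_zero_iff_mem, Ideal.mem_span_singleton]
        exact ⟨-φ (q default), by rw [mul_neg]; exact eq_neg_of_add_eq_zero_left hp⟩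
      subst hc
      rw [map_zero, zero_add] at hp
      exact ⟨q default, by rw [map_zero, zero_add], hcan _ hp⟩
    intro p hp
    have hall : ∀ n : ℕ, ∃ q, p = (PowerSeries.X : PowerSeries k') ^ n * q ∧ φ q = 0 := by
      intro n
      induction n with
      | zero => exact ⟨p, by rw [pow_zero, one_mul], hp⟩
      | succ n ih =>
        obtain ⟨q, rfl, hq⟩ := ih
        obtain ⟨q', rfl, hq'⟩ := step q hq
        exact ⟨q', by rw [pow_succ, mul_assoc]; rfl, hq'⟩
    refine PowerSeries.ext fun n => ?_
    obtain ⟨q, hq, -⟩ := hall (n + 1)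
    rw [map_zero]
    exact PowerSeries.X_pow_dvd_iff.mp ⟨q, hq⟩ n (Nat.lt_succ_self _)
  have hsurj : Function.Surjective φ := by
    let _ : Module (PowerSeries k') B := Module.compHom B φ
    have hs : ∀ (p : PowerSeries k') (b : B), p • b = φ p * b := fun _ _ => rfl
    have hX : ∀ n : ℕ, φ ((PowerSeries.X : PowerSeries k') ^ n) = t ^ n := fun n => by
      rw [map_pow]; exact congrArg (· ^ n) (hφ₂ ())
    have hc : IsCompleteAt (PowerSeries.X : PowerSeries k') (PowerSeries k') :=
      isCompleteAt_of_isAdicComplete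
    have := hc.span_eq_top (M := B) (fun x hx => htop x fun n => by
      obtain ⟨y, hy⟩ := hx n
      rw [hs, hX] at hy
      exact ⟨y, hy⟩) (fun _ : Unit => (1 : B)) fun x => by
        obtain ⟨c, hc⟩ := hdec x
        refine ⟨c, Submodule.mem_span_singleton.mpr ?_ |> fun h => by simpa using h⟩
        refine ⟨algebraMap k' (MvPowerSeries Unit k') (Ideal.Quotient.mk _ x), ?_⟩
        rw [hs, mul_one, hφ₁, hs]
        nth_rewrite 2 [hc]
        have := hX 1
        rw [pow_one, pow_one] at this
        rw [this, add_sub_cancel_right]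
        rfl
    intro b
    have hb : b ∈ Submodule.span (PowerSeries k') (Set.range fun _ : Unit => (1 : B)) :=
      this ▸ Submodule.mem_top
    rw [Set.range_const, Submodule.mem_span_singleton] at hb
    obtain ⟨p, hp⟩ := hb
    exact ⟨p, by rw [← hp, hs, mul_one]⟩
  let e : MvPowerSeries Unit k' ≃+* B := RingEquiv.ofBijective φ ⟨hinj, hsurj⟩
  -- over a deformation, lift the coefficients and the variable separately
  intro R X
  let _ : Algebra k X := ((algebraMap R X).comp (algebraMap k R)).toAlgebra
  let red : X →ₐ[k] B := ⟨X.red, fun c => by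
    change X.red (algebraMap R X (algebraMap k R c)) = _
    rw [X.red_algebraMap]
    simp⟩
  have hnil : IsNilpotent (RingHom.ker (red : X →+* B)) := X.isNilpotent_ker_red
  let σX : k' →ₐ[k] X := Algebra.FormallySmooth.liftOfSurjective σ red X.red_surjective hnil
  have hσX : ∀ c, X.red (σX c) = σ c :=
    Algebra.FormallySmooth.liftOfSurjective_apply σ red X.red_surjective hnil
  obtain ⟨s₀, hs₀⟩ := X.red_surjective t₀
  obtain ⟨s, hs⟩ := X.red_surjective t
  have htr : t ∈ (Ideal.span {t₀}).radical := ht ▸ Ideal.mem_span_singleton_self t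
  obtain ⟨ψ, hψ₁, hψ₂⟩ := (X.isParameter hs₀ ht₀).exists_eval (σX : k' →+* X)
    (fun _ : Unit => s) fun _ => X.mem_radical (by rw [hs, hs₀]; exact htr)
  have hψ : ∀ p, X.red (ψ p) = φ p := ht₀.hom_ext (φ := X.red.comp ψ) (ψ := φ)
    powerSeries_exists_eq_add
    (fun c => by rw [RingHom.comp_apply, hψ₁, hφ₁]; exact hσX c)
    (fun i => by rw [RingHom.comp_apply, hψ₂, hs]; exact htr)
    fun i => by rw [RingHom.comp_apply, hψ₂, hs, hφ₂]
  refine ⟨ψ.comp (e.symm : B →+* MvPowerSeries Unit k'), fun b => ?_, fun c => ?_⟩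
  · exact (hψ _).trans (e.apply_symm_apply b)
  · have : e.symm (algebraMap k B c) =
        algebraMap k' (MvPowerSeries Unit k') (algebraMap k k' c) := by
      rw [RingEquiv.symm_apply_eq]
      exact ((hφ₁ _).trans (σ.commutes c)).symm
    rw [RingHom.comp_apply, RingHom.coe_coe, this, hψ₁]
    exact σX.commutes c

end Sections

/-! ### Power series in two variables over a field -/

section PlanePowerSeries

variable {k : Type u} [Field k]

/-- `k[[x, y]]` is factorial, as a power series ring over a principal ideal domain. -/
theorem uniqueFactorizationMonoid_ps : UniqueFactorizationMonoid (PS k) := by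
  let e₁ : MvPowerSeries (Fin 1) k ≃ₐ[k] PowerSeries k := MvPowerSeries.renameEquiv k finOneEquiv
  have : IsPrincipalIdealRing (MvPowerSeries (Fin 1) k) :=
    IsPrincipalIdealRing.of_surjective e₁.symm e₁.symm.surjective
  have : IsDomain (MvPowerSeries (Fin 1) k) := e₁.toMulEquiv.isDomain _
  exact (MvPowerSeries.finSuccEquiv k 1).symm.toMulEquiv.uniqueFactorizationMonoid inferInstance

/-- Krull's intersection theorem for a principal ideal. -/
theorem eq_zero_of_forall_pow_smul {T : Type*} [CommRing T] [IsNoetherianRing T] [IsLocalRing T]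
    {M : Type*} [AddCommGroup M] [Module T M] [Module.Finite T M] {w : T} (hw : ¬ IsUnit w)
    (x : M) (hx : ∀ n : ℕ, ∃ y, x = w ^ n • y) : x = 0 := by
  have h : Ideal.span {w} ≠ ⊤ := by rwa [Ne, Ideal.span_singleton_eq_top]
  have h2 : x ∈ ⨅ n, Ideal.span {w} ^ n • (⊤ : Submodule T M) := by
    rw [Submodule.mem_iInf]
    intro n
    obtain ⟨y, rfl⟩ := hx n
    exact Submodule.smul_mem_smul (Ideal.pow_mem_pow (Ideal.mem_span_singleton_self w) n)
      Submodule.mem_top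
  rwa [Ideal.iInf_pow_smul_eq_bot_of_isLocalRing _ h] at h2

theorem ps_eq_zero_of_forall_pow {M : Type*} [AddCommGroup M] [Module (PS k) M]
    [Module.Finite (PS k) M] {w : PS k} (hw : MvPowerSeries.constantCoeff w = 0) (x : M)
    (hx : ∀ n : ℕ, ∃ y, x = w ^ n • y) : x = 0 :=
  eq_zero_of_forall_pow_smul
    (by rw [MvPowerSeries.isUnit_iff_constantCoeff, hw]; exact not_isUnit_zero) x hx

theorem ps_exists_powerSeries_hom {w : PS k} (hw : MvPowerSeries.constantCoeff w = 0) :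
    ∃ φ : PowerSeries k →ₐ[k] PS k, φ PowerSeries.X = w := by
  have hmem : w ∈ Ideal.span (Set.range (MvPowerSeries.X : Fin 2 → PS k)) := by
    obtain ⟨c, q, rfl⟩ := ps_exists_eq_add w
    have hc : c = 0 := by simpa [MvPowerSeries.algebraMap_apply] using hw
    rw [hc, map_zero, zero_add]
    exact Ideal.sum_mem _ fun i _ => Ideal.mul_mem_right _ _ (Ideal.subset_span ⟨i, rfl⟩)
  obtain ⟨φ, hφ⟩ := exists_mvPowerSeries_algHom (A := k) (Ideal.span (Set.range
    (MvPowerSeries.X : Fin 2 → PS k))) (fun _ : Unit => w) fun _ => Ideal.le_radical hmem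
  exact ⟨φ, hφ ()⟩

/-- The restriction of power series to the line `x = l t`, `y = t`. -/
theorem exists_restriction (l : k) : ∃ ε : PS k →ₐ[k] PowerSeries k,
    ε (MvPowerSeries.X 0) = algebraMap k _ l * PowerSeries.X ∧
      ε (MvPowerSeries.X 1) = PowerSeries.X := by
  obtain ⟨φ, hφ⟩ := exists_mvPowerSeries_algHom (A := k)
    (Ideal.span {(PowerSeries.X : PowerSeries k)})
    ![algebraMap k _ l * PowerSeries.X, PowerSeries.X] fun i => Ideal.le_radical (by
      fin_cases i
      · exact Ideal.mul_mem_left _ _ (Ideal.mem_span_singleton_self _)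
      · exact Ideal.mem_span_singleton_self _)
  exact ⟨φ, hφ 0, hφ 1⟩

/-- The equation `x - l y` of a line. -/
noncomputable def line (l : k) : PS k := MvPowerSeries.X 0 - algebraMap k _ l * MvPowerSeries.X 1

theorem constantCoeff_line (l : k) : MvPowerSeries.constantCoeff (line l) = 0 := by
  simp [line]

theorem constantCoeff_X (i : Fin 2) : MvPowerSeries.constantCoeff (MvPowerSeries.X i : PS k) = 0 :=
  MvPowerSeries.constantCoeff_X i

theorem exists_eq_line_add (l : k) (p : PS k) : ∃ (c : k) (q r : PS k),
    p = algebraMap k _ c + line l * q + MvPowerSeries.X 1 * r := by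
  obtain ⟨c, q, rfl⟩ := ps_exists_eq_add p
  refine ⟨c, q 0, algebraMap k _ l * q 0 + q 1, ?_⟩
  rw [Fin.sum_univ_two, line]
  ring

/-- Let `V = k[[s]]` act on `k[[x, y]]`-modules through `s ↦ x - l y`, and let `M` be generated by
elements `e j` over `k[[x, y]]`. If `y ^ N M ⊆ (x - l y) M`, then the elements `y ^ i e j` with
`i < N` generate `M` over `V`. -/
theorem span_pow_smul_eq_top {l : k} {ι : PowerSeries k →ₐ[k] PS k}
    (hι : ι PowerSeries.X = line l) {M : Type*} [AddCommGroup M] [Module (PS k) M]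
    [Module (PowerSeries k) M] (hV : ∀ (c : PowerSeries k) (m : M), c • m = ι c • m)
    {J : Type*} [Finite J] (e : J → M) (he : Submodule.span (PS k) (Set.range e) = ⊤) {N : ℕ}
    (hN : ∀ m : M, ∃ m', (MvPowerSeries.X 1 : PS k) ^ N • m = line l • m') :
    Submodule.span (PowerSeries k)
      (Set.range fun ij : Fin N × J => (MvPowerSeries.X 1 : PS k) ^ (ij.1 : ℕ) • e ij.2) = ⊤ := by
  have : Module.Finite (PS k) M := ⟨he ▸ Submodule.fg_span (Set.finite_range e)⟩
  have hc : IsCompleteAt (PowerSeries.X : PowerSeries k) (PowerSeries k) :=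
    isCompleteAt_of_isAdicComplete
  refine hc.span_eq_top (fun x hx => ps_eq_zero_of_forall_pow (constantCoeff_line l) x fun n => by
    obtain ⟨y, hy⟩ := hx n
    exact ⟨y, by rw [hy, hV, map_pow, hι]⟩) _ fun x => ?_
  set P := Submodule.span (PowerSeries k)
    (Set.range fun ij : Fin N × J => (MvPowerSeries.X 1 : PS k) ^ (ij.1 : ℕ) • e ij.2)
  have key : ∀ (n i : ℕ), i + n = N → ∀ (j : J) (p : PS k),
      ∃ y, ((MvPowerSeries.X 1 : PS k) ^ i * p) • e j - line l • y ∈ P := by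
    intro n
    induction n with
    | zero =>
      rintro i rfl j p
      obtain ⟨y, hy⟩ := hN (p • e j)
      exact ⟨y, by rw [mul_smul]; erw [hy]; rw [sub_self]; exact zero_mem _⟩
    | succ n ih =>
      intro i hi j p
      obtain ⟨c, q, r, rfl⟩ := exists_eq_line_add l p
      obtain ⟨y, hy⟩ := ih (i + 1) (by omega) j r
      refine ⟨(MvPowerSeries.X 1 ^ i * q) • e j + y, ?_⟩
      have h1 : (MvPowerSeries.X 1 : PS k) ^ i • e j ∈ P :=
        Submodule.subset_span ⟨(⟨i, by omega⟩, j), rfl⟩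
      have h2 := add_mem (P.smul_mem (algebraMap k _ c) h1) hy
      rw [hV, ι.commutes] at h2
      convert h2 using 1
      rw [smul_add, ← mul_smul, ← mul_smul, sub_add_eq_sub_sub, add_sub_assoc', ← add_smul,
        ← sub_smul]
      congr 2
      ring
  obtain ⟨p, rfl⟩ : ∃ p : J →₀ PS k, p.sum (fun j c => c • e j) = x :=
    Finsupp.mem_span_range_iff_exists_finsupp.mp (he ▸ Submodule.mem_top)
  choose y hy using fun j => key N 0 (zero_add N) j (p j)
  refine ⟨∑ j ∈ p.support, y j, ?_⟩
  rw [hV, hι, Finset.smul_sum, Finsupp.sum, ← Finset.sum_sub_distrib]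
  refine Submodule.sum_mem _ fun j _ => ?_
  have := hy j
  rwa [pow_zero, one_mul] at this

theorem exists_restriction_section {ε : PS k →ₐ[k] PowerSeries k}
    (h₁ : ε (MvPowerSeries.X 1) = PowerSeries.X) :
    ∃ ι : PowerSeries k →ₐ[k] PS k, ι PowerSeries.X = MvPowerSeries.X 1 ∧ ∀ c, ε (ι c) = c := by
  obtain ⟨ι, hι⟩ := ps_exists_powerSeries_hom (constantCoeff_X (k := k) 1)
  have hX : ε (ι PowerSeries.X) = PowerSeries.X := by rw [hι, h₁]
  refine ⟨ι, hι, DFunLike.congr_fun (mvPowerSeries_algHom_ext (σ := Unit) (A := k)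
    (Ideal.span {(PowerSeries.X : PowerSeries k)}) powerSeries_exists_eq_add
    (φ := ε.comp ι) (ψ := AlgHom.id k _) (fun i => Ideal.le_radical ?_) fun i => hX)⟩
  change ε (ι PowerSeries.X) ∈ _
  rw [hX]
  exact Ideal.mem_span_singleton_self _

/-- The kernel of the restriction to a line is generated by its equation. -/
theorem line_dvd_iff {l : k} {ε : PS k →ₐ[k] PowerSeries k}
    (h₀ : ε (MvPowerSeries.X 0) = algebraMap k _ l * PowerSeries.X)
    (h₁ : ε (MvPowerSeries.X 1) = PowerSeries.X) (p : PS k) : line l ∣ p ↔ ε p = 0 := by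
  have hu : ε (line l) = 0 := by
    rw [line, map_sub, map_mul, ε.commutes, h₀, h₁, sub_self]
  refine ⟨fun ⟨q, hq⟩ => by rw [hq, map_mul, hu, zero_mul], fun hp => ?_⟩
  obtain ⟨ι, hι, hει⟩ := exists_restriction_section h₁
  -- modulo `x - l y`, every power series is a power series in `y`
  let M := PS k ⧸ Ideal.span {line l}
  let _ : Module (PowerSeries k) M := Module.compHom M (ι : PowerSeries k →+* PS k)
  have hs : ∀ (c : PowerSeries k) (m : M), c • m = Ideal.Quotient.mk _ (ι c) * m :=
    fun _ _ => rfl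
  have hc : IsCompleteAt (PowerSeries.X : PowerSeries k) (PowerSeries k) :=
    isCompleteAt_of_isAdicComplete
  have htop := hc.span_eq_top (M := M) (fun x hx =>
      ps_eq_zero_of_forall_pow (constantCoeff_X (k := k) 1) x fun n => by
        obtain ⟨y, hy⟩ := hx n
        exact ⟨y, by rw [hy, hs, map_pow, hι]; rfl⟩) (fun _ : Unit => (1 : M)) fun x => by
    obtain ⟨p, rfl⟩ := Ideal.Quotient.mk_surjective x
    obtain ⟨c, q, r, rfl⟩ := exists_eq_line_add l p
    refine ⟨Ideal.Quotient.mk _ r, ?_⟩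
    rw [Set.range_const, Submodule.mem_span_singleton]
    refine ⟨algebraMap k _ c, ?_⟩
    rw [hs, hs, ι.commutes, hι, mul_one, map_add, map_add, map_mul _ (MvPowerSeries.X 1),
      add_sub_cancel_right, map_mul, Ideal.Quotient.eq_zero_iff_mem.mpr
      (Ideal.mem_span_singleton_self (line l)), zero_mul, add_zero]
  have hmem : Ideal.Quotient.mk (Ideal.span {line l}) p ∈
      Submodule.span (PowerSeries k) (Set.range fun _ : Unit => (1 : M)) :=
    htop ▸ Submodule.mem_top
  rw [Set.range_const, Submodule.mem_span_singleton] at hmem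
  obtain ⟨c, hc⟩ := hmem
  rw [hs, mul_one, Ideal.Quotient.eq,
    Ideal.mem_span_singleton] at hc
  obtain ⟨q, hq⟩ := hc
  have h2 := congrArg ε hq
  rw [map_sub, map_mul, hu, zero_mul, hει, hp, sub_zero] at h2
  rw [h2, map_zero, zero_sub] at hq
  exact ⟨-q, by rw [mul_neg, ← hq, neg_neg]⟩

theorem line_ne_zero (l : k) : line l ≠ 0 := by
  classical
  intro h
  have := congrArg (MvPowerSeries.coeff (Finsupp.single 0 1)) h
  rw [line, map_sub, MvPowerSeries.algebraMap_apply, Algebra.algebraMap_self_apply,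
    MvPowerSeries.coeff_C_mul, MvPowerSeries.coeff_X, MvPowerSeries.coeff_X, if_pos rfl,
    if_neg (by simp [Finsupp.single_left_inj])] at this
  simp at this

theorem prime_line (l : k) : Prime (line l) := by
  obtain ⟨ε, h₀, h₁⟩ := exists_restriction l
  refine ⟨line_ne_zero l, ?_, fun a b h => ?_⟩
  · rw [MvPowerSeries.isUnit_iff_constantCoeff, constantCoeff_line]
    exact not_isUnit_zero
  · rw [line_dvd_iff h₀ h₁, map_mul, mul_eq_zero] at h
    rwa [line_dvd_iff h₀ h₁, line_dvd_iff h₀ h₁]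

theorem not_line_dvd_X (l : k) : ¬ line l ∣ MvPowerSeries.X 1 := by
  obtain ⟨ε, h₀, h₁⟩ := exists_restriction l
  rw [line_dvd_iff h₀ h₁, h₁]
  exact PowerSeries.X_ne_zero

theorem eq_of_line_dvd_line {l l' : k} (h : line l ∣ line l') : l = l' := by
  by_contra hne
  have h1 : line l ∣ algebraMap k (PS k) (l - l') * MvPowerSeries.X 1 := by
    have := dvd_sub h (dvd_refl (line l))
    convert this using 1
    simp only [line, map_sub]
    ring
  have h2 : IsUnit (algebraMap k (PS k) (l - l')) :=
    (IsUnit.mk0 _ (sub_ne_zero.mpr hne)).map _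
  exact not_line_dvd_X l ((h2.dvd_mul_left).mp h1)

/-- A nonzero power series vanishes on only finitely many lines: it would otherwise be divisible
by products of arbitrarily many primes. -/
theorem exists_not_line_dvd [Infinite k] {f : PS k} (hf : f ≠ 0) : ∃ l, ¬ line l ∣ f := by
  by_contra! h
  let I : Ideal (PS k) := Ideal.span {MvPowerSeries.X 0, MvPowerSeries.X 1}
  have hI : I ≠ ⊤ := by
    intro htop
    have h1 : I ≤ RingHom.ker (MvPowerSeries.constantCoeff : PS k →+* k) := by
      rw [Ideal.span_le]
      rintro x (rfl | rfl)
      · exact constantCoeff_X 0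
      · exact constantCoeff_X 1
    rw [htop] at h1
    exact one_ne_zero ((map_one MvPowerSeries.constantCoeff).symm.trans
      (RingHom.mem_ker.mp (h1 (Submodule.mem_top (x := (1 : PS k))))))
  have hline : ∀ l, line l ∈ I := fun l => sub_mem (Ideal.subset_span (by simp))
    (Ideal.mul_mem_left _ _ (Ideal.subset_span (by simp)))
  let a := Infinite.natEmbedding k
  have hdvd : ∀ n, ∏ i ∈ Finset.range n, line (a i) ∣ f := by
    intro n
    induction n with
    | zero => simp
    | succ n ih =>
      obtain ⟨g, hg⟩ := ih
      have h1 := h (a n)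
      rw [hg] at h1
      rcases (prime_line (a n)).dvd_or_dvd h1 with h2 | h2
      · obtain ⟨i, hi, h3⟩ := (prime_line (a n)).exists_mem_finset_dvd h2
        have := a.injective (eq_of_line_dvd_line h3)
        exact absurd (Finset.mem_range.mp hi) (by omega)
      · rw [Finset.prod_range_succ, hg]
        exact mul_dvd_mul_left _ h2
  have hmem : ∀ n, ∏ i ∈ Finset.range n, line (a i) ∈ I ^ n := by
    intro n
    induction n with
    | zero => simp
    | succ n ih =>
      rw [Finset.prod_range_succ, pow_succ]
      exact Ideal.mul_mem_mul ih (hline _)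
  apply hf
  have h2 : f ∈ ⨅ n, I ^ n • (⊤ : Submodule (PS k) (PS k)) := by
    rw [Submodule.mem_iInf]
    intro n
    rw [smul_eq_mul, Ideal.mul_top]
    exact Ideal.mem_of_dvd _ (hdvd n) (hmem n)
  rwa [Ideal.iInf_pow_smul_eq_bot_of_isLocalRing _ hI] at h2

/-- If `f` does not vanish on the line `x = l y`, then `f` is a power of `y` up to a unit there. -/
theorem exists_pow_mem_of_not_line_dvd {l : k} {f : PS k} (h : ¬ line l ∣ f) :
    ∃ N : ℕ, (MvPowerSeries.X 1 : PS k) ^ N ∈ Ideal.span {line l, f} := by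
  obtain ⟨ε, h₀, h₁⟩ := exists_restriction l
  obtain ⟨ι, hι, hει⟩ := exists_restriction_section h₁
  obtain ⟨n, w, hw⟩ := IsDiscreteValuationRing.eq_unit_mul_pow_irreducible
    (mt (line_dvd_iff h₀ h₁ f).mpr h) PowerSeries.X_irreducible
  set w' : PS k := ι (↑w⁻¹ : PowerSeries k)
  have hw' : ε w' = (↑w⁻¹ : PowerSeries k) := hει _
  have h2 : line l ∣ MvPowerSeries.X 1 ^ n - w' * f := by
    rw [line_dvd_iff h₀ h₁, map_sub, map_pow, h₁, map_mul, hw', hw, ← mul_assoc, w.inv_mul,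
      one_mul, sub_self]
  refine ⟨n, ?_⟩
  obtain ⟨q, hq⟩ := h2
  rw [Ideal.mem_span_pair]
  exact ⟨q, w', by rw [mul_comm q, ← hq]; ring⟩

/-- The equation of an isolated singularity is square-free: if `g ^ 2` divides `f`, then `g`
divides `f` and its derivatives, so `k[[x, y]]/(g)` is finite-dimensional and `g` is a unit. -/
theorem IsIsolatedSingularity.squarefree {f : PS k} (hf : IsIsolatedSingularity f) :
    Squarefree f := by
  rintro g ⟨h, hg⟩
  have hle : Ideal.span {f, MvPowerSeries.pderiv k 0 f, MvPowerSeries.pderiv k 1 f} ≤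
      Ideal.span {g} := by
    have hd : ∀ i, g ∣ MvPowerSeries.pderiv k i f := fun i => by
      rw [hg, Derivation.leibniz, Derivation.leibniz]
      simp only [smul_eq_mul]
      exact ⟨g * MvPowerSeries.pderiv k i h + h * (2 * MvPowerSeries.pderiv k i g), by ring⟩
    rw [Ideal.span_le]
    rintro x (rfl | rfl | rfl)
    · exact Ideal.mem_span_singleton.mpr ⟨g * h, by rw [hg]; ring⟩
    · exact Ideal.mem_span_singleton.mpr (hd 0)
    · exact Ideal.mem_span_singleton.mpr (hd 1)
  have := hf.2
  have : Module.Finite k (PS k ⧸ Ideal.span {g}) :=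
    Module.Finite.of_surjective (Ideal.Quotient.factorₐ k hle).toLinearMap
      (Ideal.Quotient.factor_surjective hle)
  have : IsArtinianRing (PS k ⧸ Ideal.span {g}) := IsArtinianRing.of_finite k _
  obtain ⟨N, hN⟩ := IsArtinianRing.isNilpotent_jacobson_bot (R := PS k ⧸ Ideal.span {g})
  have hpow : ∀ w : PS k, MvPowerSeries.constantCoeff w = 0 → g ∣ w ^ N := by
    intro w hw
    have h1 : Ideal.Quotient.mk (Ideal.span {g}) w ∈
        (⊥ : Ideal (PS k ⧸ Ideal.span {g})).jacobson := by
      rw [Ideal.mem_jacobson_bot]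
      intro y
      obtain ⟨z, rfl⟩ := Ideal.Quotient.mk_surjective y
      rw [← map_mul, ← map_one (Ideal.Quotient.mk (Ideal.span {g})), ← map_add]
      refine IsUnit.map _ (MvPowerSeries.isUnit_iff_constantCoeff.mpr ?_)
      simp [hw]
    have h2 := Ideal.pow_mem_pow h1 N
    rw [← Ideal.mem_span_singleton, ← Ideal.Quotient.eq_zero_iff_mem, map_pow]
    have h3 : (⊥ : Ideal (PS k ⧸ Ideal.span {g})).jacobson ^ N = ⊥ := hN
    rwa [h3, Ideal.mem_bot] at h2
  -- `g` divides powers of the coprime primes `x` and `y`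
  obtain ⟨i, -, hi⟩ := (dvd_prime_pow (prime_line (0 : k)) N).mp (hpow _ (constantCoeff_line 0))
  rcases Nat.eq_zero_or_pos i with rfl | hi0
  · rw [pow_zero] at hi
    exact associated_one_iff_isUnit.mp hi
  · exact absurd ((prime_line (0 : k)).dvd_of_dvd_pow ((dvd_pow_self _ hi0.ne').trans
      (hi.symm.dvd.trans (hpow _ (constantCoeff_X 1))))) (not_line_dvd_X 0)

theorem IsIsolatedSingularity.isReduced {f : PS k} (hf : IsIsolatedSingularity f) :
    IsReduced (CurveRing f) := by
  have := uniqueFactorizationMonoid_ps (k := k)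
  rw [← Ideal.isRadical_iff_quotient_reduced, ← isRadical_iff_span_singleton]
  exact hf.squarefree.isRadical

end PlanePowerSeries

/-! ### The ring of the curve -/

section CurveRing

variable {k : Type u} [Field k] {f : PS k}

theorem curveRing_line_mul_eq_zero {l : k} (h : ¬ line l ∣ f) (a : CurveRing f)
    (ha : proj f (line l : PS k) * a = 0) : a = 0 := by
  obtain ⟨p, rfl⟩ := Ideal.Quotient.mk_surjective a
  obtain ⟨q, hq⟩ : f ∣ line l * p := by
    rw [← Ideal.mem_span_singleton, ← Ideal.Quotient.eq_zero_iff_mem, map_mul]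
    exact ha
  obtain ⟨r, rfl⟩ : line l ∣ q := ((prime_line l).dvd_or_dvd ⟨p, hq.symm⟩).resolve_left h
  rw [Ideal.Quotient.eq_zero_iff_mem, Ideal.mem_span_singleton]
  exact ⟨r, mul_left_cancel₀ (line_ne_zero l) (by rw [hq]; ring)⟩

theorem curveRing_pow_smul {l : k} {N : ℕ}
    (hN : (MvPowerSeries.X 1 : PS k) ^ N ∈ Ideal.span {line l, f}) {M : Type*} [AddCommGroup M]
    [Module (PS k) M] (hf : ∀ m : M, f • m = 0) (m : M) :
    ∃ m', (MvPowerSeries.X 1 : PS k) ^ N • m = line l • m' := by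
  obtain ⟨a, b, hab⟩ := Ideal.mem_span_pair.mp hN
  exact ⟨a • m, by rw [← hab, add_smul, mul_smul b, hf, smul_zero, add_zero, mul_comm, mul_smul]⟩

theorem curveRing_X_mem_radical {l : k} {N : ℕ}
    (hN : (MvPowerSeries.X 1 : PS k) ^ N ∈ Ideal.span {line l, f}) (i : Fin 2) :
    proj f (MvPowerSeries.X i) ∈ (Ideal.span {proj f (line l)}).radical := by
  have h1 : proj f (MvPowerSeries.X 1) ∈ (Ideal.span {proj f (line l)}).radical := by
    refine ⟨N, ?_⟩
    obtain ⟨a, b, hab⟩ := Ideal.mem_span_pair.mp hN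
    rw [← map_pow, ← hab, map_add, map_mul, map_mul _ b]
    have : proj f f = 0 := Ideal.Quotient.eq_zero_iff_mem.mpr (Ideal.mem_span_singleton_self f)
    rw [this, mul_zero, add_zero]
    exact Ideal.mul_mem_left _ _ (Ideal.mem_span_singleton_self _)
  fin_cases i
  · have : (MvPowerSeries.X 0 : PS k) = line l + algebraMap k _ l * MvPowerSeries.X 1 := by
      rw [line]; ring
    change proj f (MvPowerSeries.X 0) ∈ _
    rw [this, map_add, map_mul]
    exact add_mem (Ideal.le_radical (Ideal.mem_span_singleton_self _)) (Ideal.mul_mem_left _ _ h1)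
  · exact h1

end CurveRing

/-! ### Integral closures of complete discrete valuation rings -/

section IntegralClosure

variable {V : Type*} [CommRing V] [IsDomain V] [IsDiscreteValuationRing V] {ϖ : V}

/-- Over a complete discrete valuation ring, a torsion-free separated module of bounded rank is
finite: elements which are independent modulo `ϖ` are independent, so `M/ϖM` has finite
dimension. -/
theorem IsCompleteAt.module_finite (hc : IsCompleteAt ϖ V) (hϖ : Irreducible ϖ) {M : Type*}
    [AddCommGroup M] [Module V M] (hM : ∀ x : M, (∀ n : ℕ, ∃ y, x = ϖ ^ n • y) → x = 0)
    (ht : ∀ x : M, ϖ • x = 0 → x = 0) {d : ℕ}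
    (hd : ∀ (n : ℕ) (e : Fin n → M), LinearIndependent V e → n ≤ d) : Module.Finite V M := by
  -- `P n`: there are `n` elements which are linearly independent modulo `ϖ`
  let P : ℕ → Prop := fun n => ∃ e : Fin n → M, ∀ c : Fin n → V,
    (∃ y, ∑ i, c i • e i = ϖ • y) → ∀ i, ϖ ∣ c i
  have hP : ∀ n, P n → n ≤ d := by
    rintro n ⟨e, he⟩
    refine hd n e (Fintype.linearIndependent_iff.mpr fun c hc0 i => ?_)
    have key : ∀ m : ℕ, ∃ c' : Fin n → V, (∀ i, c i = ϖ ^ m * c' i) ∧ ∑ i, c' i • e i = 0 := by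
      intro m
      induction m with
      | zero => exact ⟨c, fun i => by rw [pow_zero, one_mul], hc0⟩
      | succ m ih =>
        obtain ⟨c', h1, h2⟩ := ih
        choose c'' hc'' using he c' ⟨0, by rw [h2, smul_zero]⟩
        refine ⟨c'', fun i => by rw [h1, hc'' i, pow_succ, mul_assoc], ht _ ?_⟩
        rw [← h2, Finset.smul_sum]
        exact Finset.sum_congr rfl fun i _ => by rw [hc'' i, mul_smul]
    refine hc.eq_zero (c i) fun m => ?_
    obtain ⟨c', h1, -⟩ := key m
    exact ⟨c' i, h1 i⟩
  -- a maximal family of this kind generates `M` modulo `ϖ`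
  obtain ⟨n, ⟨e, he⟩, hn⟩ : ∃ n, P n ∧ ¬ P (n + 1) := by
    by_contra! h
    have hall : ∀ n, P n := fun n => by
      induction n with
      | zero => exact ⟨Fin.elim0, fun _ _ i => i.elim0⟩
      | succ n ih => exact h n ih
    exact absurd (hP _ (hall (d + 1))) (by omega)
  refine ⟨(hc.span_eq_top hM e fun x => ?_) ▸ Submodule.fg_span (Set.finite_range e)⟩
  have h1 : ¬ ∀ c : Fin (n + 1) → V,
      (∃ y, ∑ i, c i • (Fin.cons x e : Fin (n + 1) → M) i = ϖ • y) → ∀ i, ϖ ∣ c i :=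
    fun h => hn ⟨_, h⟩
  push Not at h1
  obtain ⟨c, ⟨y, hy⟩, j, hj⟩ := h1
  rw [Fin.sum_univ_succ] at hy
  simp only [Fin.cons_zero, Fin.cons_succ] at hy
  by_cases h0 : ϖ ∣ c 0
  · obtain ⟨a, ha⟩ := h0
    have h2 := he (fun i => c i.succ) ⟨y - a • x, by
      rw [smul_sub, ← hy, ha, mul_smul, add_sub_cancel_left]⟩
    refine absurd ?_ hj
    rcases Fin.eq_zero_or_eq_succ j with rfl | ⟨i, rfl⟩
    · exact ⟨a, ha⟩
    · exact h2 i
  · have hu : IsUnit (c 0) := by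
      by_contra hu
      exact h0 (Ideal.mem_span_singleton.mp (hϖ.maximalIdeal_eq ▸
        (IsLocalRing.mem_maximalIdeal _).mpr hu))
    obtain ⟨w, hw⟩ := hu
    refine ⟨(↑w⁻¹ : V) • y, ?_⟩
    have h3 : x - ϖ • (↑w⁻¹ : V) • y = -((↑w⁻¹ : V) • ∑ i, c (Fin.succ i) • e i) := by
      rw [smul_comm ϖ, ← hy, smul_add, ← hw, ← mul_smul, w.inv_mul, one_smul]
      abel
    rw [h3]
    exact neg_mem (Submodule.smul_mem _ _ (Submodule.sum_mem _ fun i _ =>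
      Submodule.smul_mem _ _ (Submodule.subset_span ⟨i, rfl⟩)))

/-- The elements of the ring `B` with a power divisible by `p` form a principal ideal. -/
def HasRadicalGenerator {B : Type*} [CommRing B] (p : B) : Prop :=
  ∃ t : B, ∀ b, (∃ n, p ∣ b ^ n) ↔ t ∣ b

section Field

variable (K : Type*) [Field K] [Algebra V K] [IsFractionRing V K] {L : Type*} [Field L]
  [Algebra V L] [Algebra K L] [IsScalarTower V K L] [FiniteDimensional K L]

include K

/-- The integral closure of `V` in a finite extension `L` of its fraction field is separated: if all
`x / ϖ ^ n` are integral, so are all `c / ϖ ^ n` for a nonzero multiple `c ∈ V` of `x`. -/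
theorem eq_zero_of_forall_pow_integralClosure (hc : IsCompleteAt ϖ V) (hϖ : Irreducible ϖ)
    (x : integralClosure V L) (hx : ∀ n : ℕ, ∃ y, x = ϖ ^ n • y) : x = 0 := by
  by_contra h0
  have hx0 : (x : L) ≠ 0 := fun h => h0 (Subtype.ext h)
  have : Algebra.IsAlgebraic V L :=
    (IsFractionRing.comap_isAlgebraic_iff (A := V) (K := K)).mpr inferInstance
  obtain ⟨c, hc0, hci⟩ :=
    (Algebra.IsAlgebraic.isAlgebraic (R := V) ((x : L)⁻¹)).exists_integral_multiple
  refine hc0 (hc.eq_zero c fun n => ?_)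
  obtain ⟨y, hy⟩ := hx n
  have hK : algebraMap V K ϖ ^ n ≠ 0 :=
    pow_ne_zero _ ((map_ne_zero_iff _ (IsFractionRing.injective V K)).mpr hϖ.ne_zero)
  have h1 : algebraMap K L (algebraMap V K c / algebraMap V K ϖ ^ n) = c • (x : L)⁻¹ * y := by
    have hy' : (x : L) = algebraMap K L (algebraMap V K ϖ ^ n) * y := by
      rw [← map_pow, ← IsScalarTower.algebraMap_apply, ← Algebra.smul_def]
      exact congrArg Subtype.val hy
    have hL : algebraMap K L (algebraMap V K ϖ ^ n) ≠ 0 := (map_ne_zero _).mpr hK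
    have hyn : (y : L) ≠ 0 := fun h => hx0 (by rw [hy', h, mul_zero])
    rw [map_div₀, Algebra.smul_def, hy', IsScalarTower.algebraMap_apply V K L]
    field_simp
  have h2 : IsIntegral V (algebraMap V K c / algebraMap V K ϖ ^ n) := by
    rw [← isIntegral_algebraMap_iff (algebraMap K L).injective, h1]
    exact hci.mul y.2
  obtain ⟨a, ha⟩ := IsIntegrallyClosed.isIntegral_iff.mp h2
  refine ⟨a, IsFractionRing.injective V K ?_⟩
  rw [smul_eq_mul, map_mul, map_pow, ha, mul_div_cancel₀ _ hK]

theorem finite_integralClosure (hc : IsCompleteAt ϖ V) (hϖ : Irreducible ϖ) :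
    Module.Finite V (integralClosure V L) := by
  have hinj : Function.Injective (algebraMap V L) := by
    rw [IsScalarTower.algebraMap_eq V K L]
    exact (algebraMap K L).injective.comp (IsFractionRing.injective V K)
  refine hc.module_finite hϖ (eq_zero_of_forall_pow_integralClosure K hc hϖ) (fun x hx => ?_)
    (d := Module.finrank K L) fun n e he => ?_
  · have h1 : algebraMap V L ϖ * (x : L) = 0 := by
      rw [← Algebra.smul_def]; exact congrArg Subtype.val hx
    exact Subtype.ext ((mul_eq_zero.mp h1).resolve_left
      ((map_ne_zero_iff _ hinj).mpr hϖ.ne_zero))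
  · have h1 : LinearIndependent V fun i => (e i : L) :=
      he.map' (integralClosure V L).val.toLinearMap
        (LinearMap.ker_eq_bot.mpr Subtype.val_injective)
    have h2 := ((LinearIndependent.iff_fractionRing V K).mp h1).fintype_card_le_finrank
    rwa [Fintype.card_fin] at h2

/-- The integral closure of a complete discrete valuation ring in a finite field extension is a
semilocal Dedekind domain, hence a principal ideal domain. -/
theorem hasRadicalGenerator_integralClosure (hc : IsCompleteAt ϖ V) (hϖ : Irreducible ϖ) (p : V) :
    HasRadicalGenerator (algebraMap V (integralClosure V L) p) := by
  have := finite_integralClosure K (L := L) hc hϖ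
  have : IsNoetherianRing (integralClosure V L) := isNoetherian_of_tower V inferInstance
  have : IsIntegrallyClosed (integralClosure V L) :=
    integralClosure.isIntegrallyClosedOfFiniteExtension K
  have : IsDedekindDomain (integralClosure V L) := { }
  have hfin : {I : Ideal (integralClosure V L) | I.IsPrime}.Finite := by
    refine ((Algebra.QuasiFinite.finite_primesOver (⊥ : Ideal V)).union
      (Algebra.QuasiFinite.finite_primesOver (IsLocalRing.maximalIdeal V))).subset fun I hI => ?_
    have hI : I.IsPrime := hI
    by_cases h : I.comap (algebraMap V _) = ⊥
    · exact Or.inl ⟨hI, ⟨h.symm⟩⟩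
    · exact Or.inr ⟨hI, ⟨(IsLocalRing.eq_maximalIdeal
        (Ideal.IsPrime.isMaximal (Ideal.comap_isPrime _ _) h)).symm⟩⟩
  have := IsPrincipalIdealRing.of_finite_primes hfin
  obtain ⟨t, ht⟩ := (IsPrincipalIdealRing.principal
    (Ideal.span {algebraMap V (integralClosure V L) p}).radical).principal
  refine ⟨t, fun b => ?_⟩
  rw [← Ideal.mem_span_singleton, ← Ideal.submodule_span_eq (s := {t}), ← ht, Ideal.mem_radical_iff]
  simp only [Ideal.mem_span_singleton]

end Field

end IntegralClosure

theorem HasRadicalGenerator.of_equiv {B B' : Type*} [CommRing B] [CommRing B'] (e : B ≃+* B')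
    {p : B} (h : HasRadicalGenerator (e p)) : HasRadicalGenerator p := by
  obtain ⟨t, ht⟩ := h
  refine ⟨e.symm t, fun b => ?_⟩
  rw [← map_dvd_iff e, e.apply_symm_apply, ← ht]
  simp only [← map_pow, map_dvd_iff]

theorem HasRadicalGenerator.pi {ι : Type*} [Finite ι] {B : ι → Type*} [∀ i, CommRing (B i)]
    {p : ∀ i, B i} (h : ∀ i, HasRadicalGenerator (p i)) : HasRadicalGenerator p := by
  cases nonempty_fintype ι
  choose t ht using h
  refine ⟨t, fun b => ?_⟩
  simp only [pi_dvd_iff, ← ht, Pi.pow_apply]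
  refine ⟨fun ⟨n, hn⟩ i => ⟨n, hn i⟩, fun h => ?_⟩
  choose n hn using h
  exact ⟨∑ i, n i, fun i => (hn i).trans
    (pow_dvd_pow _ (Finset.single_le_sum (fun _ _ => Nat.zero_le _) (Finset.mem_univ i)))⟩

/-! ### Integral closures in reduced Artinian rings -/

section IntegralClosureReduced

variable {V : Type*} [CommRing V] {Q : Type*} [CommRing Q] [Algebra V Q]

/-- In a reduced Artinian ring, which is the product of its residue fields, integrality can be
checked in the residue fields. -/
theorem isIntegral_of_forall_maximalSpectrum [IsArtinianRing Q] [IsReduced Q] (z : Q)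
    (hz : ∀ I : MaximalSpectrum Q, IsIntegral V (Ideal.Quotient.mk I.asIdeal z)) :
    IsIntegral V z := by
  have := Fintype.ofFinite (MaximalSpectrum Q)
  choose p hp hpz using hz
  refine ⟨∏ I, p I, Polynomial.monic_prod_of_monic _ _ fun I _ => hp I,
    (IsArtinianRing.equivPi Q).injective ?_⟩
  rw [map_zero]
  funext I
  have h1 : Ideal.Quotient.mk I.asIdeal (Polynomial.eval₂ (algebraMap V Q) z (∏ I, p I)) =
      Polynomial.eval₂ (algebraMap V (Q ⧸ I.asIdeal)) (Ideal.Quotient.mk I.asIdeal z)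
        (∏ I, p I) := Polynomial.hom_eval₂ _ _ _ _
  change Ideal.Quotient.mk I.asIdeal (Polynomial.eval₂ (algebraMap V Q) z (∏ I, p I)) = 0
  rw [h1, Polynomial.eval₂_finsetProd]
  exact Finset.prod_eq_zero (Finset.mem_univ I) (hpz I)

/-- The integral closure in a reduced Artinian ring is the product of the integral closures in the
residue fields. -/
theorem exists_integralClosure_equiv_pi [IsArtinianRing Q] [IsReduced Q] :
    Nonempty (integralClosure V Q ≃ₐ[V]
      ∀ I : MaximalSpectrum Q, integralClosure V (Q ⧸ I.asIdeal)) := by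
  let Φ : integralClosure V Q →ₐ[V] ∀ I : MaximalSpectrum Q, integralClosure V (Q ⧸ I.asIdeal) :=
    AlgHom.pi fun I => ((Ideal.Quotient.mkₐ V I.asIdeal).comp
      (integralClosure V Q).val).codRestrict _ fun z => z.2.map (Ideal.Quotient.mkₐ V I.asIdeal)
  refine ⟨AlgEquiv.ofBijective Φ ⟨fun a b hab => ?_, fun y => ?_⟩⟩
  · refine Subtype.ext ((IsArtinianRing.equivPi Q).injective ?_)
    funext I
    exact congrArg Subtype.val (congrFun hab I)
  · obtain ⟨z, hz⟩ := (IsArtinianRing.equivPi Q).surjective fun I => (y I : Q ⧸ I.asIdeal)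
    have hz' : ∀ I : MaximalSpectrum Q, Ideal.Quotient.mk I.asIdeal z = y I :=
      fun I => congrFun hz I
    refine ⟨⟨z, isIntegral_of_forall_maximalSpectrum z fun I => ?_⟩, ?_⟩
    · rw [hz']; exact (y I).2
    · funext I
      exact Subtype.ext (hz' I)

end IntegralClosureReduced

/-! ### Normalization of finite algebras -/

section Normalization

variable {V : Type*} [CommRing V] [IsDomain V] [IsDiscreteValuationRing V] {ϖ : V}

theorem finite_integralClosure_of_isReduced (hc : IsCompleteAt ϖ V) (hϖ : Irreducible ϖ)
    (K : Type*) [Field K] [Algebra V K] [IsFractionRing V K] {Q : Type*} [CommRing Q] [IsReduced Q]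
    [Algebra V Q] [Algebra K Q] [IsScalarTower V K Q] [Module.Finite K Q] :
    Module.Finite V (integralClosure V Q) ∧
      ∀ p : V, HasRadicalGenerator (algebraMap V (integralClosure V Q) p) := by
  have : IsArtinianRing Q := IsArtinianRing.of_finite K Q
  obtain ⟨e⟩ := exists_integralClosure_equiv_pi (V := V) (Q := Q)
  have h : ∀ I : MaximalSpectrum Q, Module.Finite V (integralClosure V (Q ⧸ I.asIdeal)) ∧
      ∀ p : V, HasRadicalGenerator (algebraMap V (integralClosure V (Q ⧸ I.asIdeal)) p) := by
    intro I
    let _ := Ideal.Quotient.field I.asIdeal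
    exact ⟨finite_integralClosure K hc hϖ, hasRadicalGenerator_integralClosure K hc hϖ⟩
  have := fun I => (h I).1
  refine ⟨Module.Finite.equiv e.toLinearEquiv.symm, fun p => .of_equiv e.toRingEquiv ?_⟩
  have he : e.toRingEquiv (algebraMap V (integralClosure V Q) p) =
      fun I : MaximalSpectrum Q => algebraMap V (integralClosure V (Q ⧸ I.asIdeal)) p :=
    e.commutes p
  rw [he]
  exact .pi fun I => (h I).2 p

open nonZeroDivisors in
/-- The normalization of a finite reduced torsion-free algebra over a complete discrete valuation
ring is finite, the radicals of its principal ideals coming from the base are principal, and its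
elements have denominators in the base. -/
theorem normalization_of_finite (hc : IsCompleteAt ϖ V) (hϖ : Irreducible ϖ) {A : Type*}
    [CommRing A] [IsReduced A] [Algebra V A] [Module.Finite V A]
    (hA : ∀ c : V, c ≠ 0 → algebraMap V A c ∈ A⁰) :
    Module.Finite V (integralClosure A (FractionRing A)) ∧
      (∀ p : V, HasRadicalGenerator (algebraMap V (integralClosure A (FractionRing A)) p)) ∧
      ∀ b : integralClosure A (FractionRing A), ∃ c : V, c ≠ 0 ∧ ∃ a : A,
        algebraMap V A c • b = algebraMap A (integralClosure A (FractionRing A)) a := by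
  cases subsingleton_or_nontrivial A
  · have : Subsingleton (integralClosure A (FractionRing A)) :=
      Module.subsingleton A _
    refine ⟨inferInstance, fun p => ⟨1, fun b => ?_⟩, fun b => ⟨1, one_ne_zero, 0,
      Subsingleton.elim _ _⟩⟩
    exact ⟨fun _ => ⟨0, Subsingleton.elim _ _⟩, fun _ => ⟨0, 0, Subsingleton.elim _ _⟩⟩
  have hinj : Function.Injective (algebraMap V A) := by
    rw [injective_iff_map_eq_zero]
    intro c h0
    by_contra hne
    exact nonZeroDivisors.ne_zero (hA c hne) h0
  let Q := FractionRing A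
  let K := FractionRing V
  have hdvd : ∀ s ∈ A⁰, ∃ c : V, c ≠ 0 ∧ s ∣ algebraMap V A c := fun s hs => by
    obtain ⟨c, h1, h2⟩ :=
      (Algebra.IsIntegral.isIntegral (R := V) s).isAlgebraic.exists_nonzero_dvd hs
    exact ⟨c, h1, h2⟩
  -- `Q` is also the localization of `A` at the nonzero elements of `V`, hence finite over `K`
  have hloc : IsLocalization (Algebra.algebraMapSubmonoid A V⁰) Q := by
    refine (IsLocalization.iff_of_le_of_exists_dvd _ A⁰ ?_ fun s hs => ?_).mpr inferInstance
    · rintro _ ⟨c, h, rfl⟩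
      exact hA c (nonZeroDivisors.ne_zero h)
    · obtain ⟨c, h1, h2⟩ := hdvd s hs
      exact ⟨_, ⟨c, mem_nonZeroDivisors_of_ne_zero h1, rfl⟩, h2⟩
  have hu : ∀ y : V⁰, IsUnit (algebraMap V Q y) := fun y => by
    rw [IsScalarTower.algebraMap_apply V A Q]
    exact IsLocalization.map_units Q (⟨_, hA y (nonZeroDivisors.ne_zero y.2)⟩ : A⁰)
  let _ : Algebra K Q := (IsLocalization.lift hu : K →+* Q).toAlgebra
  have : IsScalarTower V K Q := IsScalarTower.of_algebraMap_eq fun c =>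
    (IsLocalization.lift_eq hu c).symm
  have : Module.Finite K Q := Module.Finite.of_isLocalization V A V⁰
  have : IsReduced Q := inferInstanceAs (IsReduced (Localization A⁰))
  obtain ⟨h1, h2⟩ := finite_integralClosure_of_isReduced hc hϖ K (Q := Q)
  have heq : integralClosure V Q = (integralClosure A Q).restrictScalars V := by
    ext z
    exact ⟨fun h => IsIntegral.tower_top (A := A) h, fun h => isIntegral_trans (A := A) z h⟩
  let e : integralClosure V Q ≃ₐ[V] (integralClosure A Q).restrictScalars V :=
    Subalgebra.equivOfEq _ _ heq
  refine ⟨Module.Finite.equiv e.toLinearEquiv, fun p => .of_equiv e.symm.toRingEquiv ?_,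
    fun b => ?_⟩
  · have : e.symm.toRingEquiv (algebraMap V (integralClosure A Q) p) =
      algebraMap V (integralClosure V Q) p := e.symm.commutes p
    rw [this]
    exact h2 p
  · obtain ⟨a, s, has⟩ := IsLocalization.exists_mk'_eq A⁰ (b : Q)
    obtain ⟨c, hc0, r, hr⟩ := hdvd s s.2
    refine ⟨c, hc0, r * a, Subtype.ext ?_⟩
    change algebraMap V A c • (b : Q) = algebraMap A Q (r * a)
    rw [Algebra.smul_def, hr, ← has, map_mul, map_mul, mul_comm (algebraMap A Q s), mul_assoc,
      IsLocalization.mk'_spec']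

theorem isParameter_of_finite (hc : IsCompleteAt ϖ V) (hϖ : Irreducible ϖ) {B : Type*} [CommRing B]
    [Algebra V B] [Module.Finite V B] (hB : ∀ b : B, algebraMap V B ϖ * b = 0 → b = 0) :
    IsParameter (algebraMap V B ϖ) where
  eq_zero_of_mul := hB
  isCompleteAt := (hc.of_finite (M := B) fun x hx =>
    eq_zero_of_forall_pow_smul hϖ.not_isUnit x hx).of_addEquiv (AddEquiv.refl B) fun b =>
      Algebra.smul_def ϖ b

end Normalization

/-! ### Deformations of the normalization are trivial -/

section ResidueAlgebra

variable {k : Type u} [Field k] [IsAlgClosed k]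

/-- A finite reduced algebra over an algebraically closed field `k` is a product of copies of `k`. -/
theorem formallySmooth_of_finite_of_isReduced (C : Type u) [CommRing C] [Algebra k C]
    [Module.Finite k C] [IsReduced C] : Algebra.FormallySmooth k C := by
  have : IsArtinianRing C := IsArtinianRing.of_finite k C
  have hI : ∀ I : MaximalSpectrum C, Algebra.FormallySmooth k (C ⧸ I.asIdeal) := fun I =>
    .of_equiv (AlgEquiv.ofBijective (Algebra.ofId k (C ⧸ I.asIdeal))
      IsAlgClosed.algebraMap_bijective_of_isIntegral)
  have := (Algebra.FormallySmooth.pi_iff fun I : MaximalSpectrum C => C ⧸ I.asIdeal).mpr hI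
  exact .of_equiv ((IsArtinianRing.equivPi C).restrictScalars k).symm

variable {V : Type*} [CommRing V] [IsDomain V] [IsDiscreteValuationRing V] {ϖ : V} [Algebra k V]

/-- Let `B` be a finite torsion-free algebra over a complete discrete valuation ring with residue
field `k`. If the radical of `ϖ B` is principal, then all deformations of `B` are trivial. -/
theorem HasRadicalGenerator.hasSections (hc : IsCompleteAt ϖ V) (hϖ : Irreducible ϖ)
    (hk : ∀ c : V, ∃ a : k, ϖ ∣ c - algebraMap k V a) {B : Type u} [CommRing B] [Algebra k B]
    [Algebra V B] [IsScalarTower k V B] [Module.Finite V B]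
    (hB : ∀ b : B, algebraMap V B ϖ * b = 0 → b = 0)
    (h : HasRadicalGenerator (algebraMap V B ϖ)) : HasSections (k := k) B := by
  obtain ⟨t, ht⟩ := h
  have hrad : (Ideal.span {algebraMap V B ϖ}).radical = Ideal.span {t} := by
    ext b
    rw [Ideal.mem_radical_iff, Ideal.mem_span_singleton, ← ht]
    simp only [Ideal.mem_span_singleton]
  have hred : IsReduced (B ⧸ Ideal.span {t}) := by
    rw [← Ideal.isRadical_iff_quotient_reduced, ← hrad]
    exact Ideal.radical_isRadical _
  have htϖ : t ∣ algebraMap V B ϖ := (ht _).mp ⟨1, by rw [pow_one]⟩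
  have hfin : Module.Finite k (B ⧸ Ideal.span {t}) := by
    obtain ⟨n, e, he⟩ := Module.Finite.exists_fin (R := V) (M := B)
    suffices hspan : Submodule.span k (Set.range fun i =>
        Ideal.Quotient.mk (Ideal.span {t}) (e i)) = ⊤ from
      ⟨hspan ▸ Submodule.fg_span (Set.finite_range _)⟩
    rw [eq_top_iff]
    rintro x -
    obtain ⟨b, rfl⟩ := Ideal.Quotient.mk_surjective x
    obtain ⟨c, rfl⟩ := (Submodule.mem_span_range_iff_exists_fun V).mp
      (he ▸ Submodule.mem_top : b ∈ Submodule.span V (Set.range e))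
    choose a ha using fun i => hk (c i)
    rw [Submodule.mem_span_range_iff_exists_fun]
    refine ⟨a, ?_⟩
    rw [map_sum]
    refine Finset.sum_congr rfl fun i _ => ?_
    have h1 : a i • Ideal.Quotient.mk (Ideal.span {t}) (e i) =
        Ideal.Quotient.mk (Ideal.span {t}) (a i • e i) := rfl
    rw [h1, eq_comm, Ideal.Quotient.eq, Ideal.mem_span_singleton]
    obtain ⟨d, hd⟩ := ha i
    have h2 : c i • e i - a i • e i = algebraMap V B ϖ * (d • e i) := by
      rw [← algebraMap_smul V (a i) (e i), ← sub_smul, hd, mul_smul, Algebra.smul_def]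
    rw [h2]
    exact htϖ.mul_right _
  have := formallySmooth_of_finite_of_isReduced (k := k) (B ⧸ Ideal.span {t})
  exact hasSections_of_radical_eq (isParameter_of_finite hc hϖ hB) hrad

end ResidueAlgebra

/-! ### Resolution by the characteristic matrix -/

section CharacteristicMatrix

variable {k : Type u} [Field k]

/-- For a finite free algebra over `V = k[[s]]` with basis `e` and an element `v` of it, the matrix
`y - Y` over `k[[x, y]]`, where `Y` is the matrix of the multiplication by `v`, with coefficients
mapped to `k[[x, y]]` by `ι : V → k[[x, y]]`. -/
noncomputable def charMatrix (ι : PowerSeries k →ₐ[k] PS k) {B : Type*} [CommRing B]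
    [Algebra (PowerSeries k) B] {d : ℕ} (e : Module.Basis (Fin d) (PowerSeries k) B) (v : B) :
    Matrix (Fin d) (Fin d) (PS k) :=
  Matrix.scalar (Fin d) (MvPowerSeries.X 1) -
    (LinearMap.toMatrix e e (LinearMap.mulLeft (PowerSeries k) v)).map ι

variable {l : k} {ι : PowerSeries k →ₐ[k] PS k}

theorem algHom_injective_of_X_eq_line (hι : ι PowerSeries.X = line l) : Function.Injective ι := by
  rw [injective_iff_map_eq_zero]
  intro c hc
  by_contra hne
  obtain ⟨n, w, hw⟩ :=
    IsDiscreteValuationRing.eq_unit_mul_pow_irreducible hne PowerSeries.X_irreducible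
  rw [hw, map_mul, map_pow, hι] at hc
  exact mul_ne_zero (w.isUnit.map ι).ne_zero (pow_ne_zero n (line_ne_zero l)) hc

variable {B : Type*} [CommRing B] [Algebra (PowerSeries k) B] {φ : PS k →+* B} {d : ℕ}

theorem sum_map_charMatrix (hφ : ∀ c, φ (ι c) = algebraMap (PowerSeries k) B c)
    (e : Module.Basis (Fin d) (PowerSeries k) B) (j : Fin d) :
    ∑ i, φ (charMatrix ι e (φ (MvPowerSeries.X 1)) i j) * e i = 0 := by
  simp only [charMatrix, Matrix.sub_apply, Matrix.map_apply, map_sub, sub_mul,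
    Finset.sum_sub_distrib, hφ, ← Algebra.smul_def, LinearMap.toMatrix_apply]
  rw [sub_eq_zero, e.sum_repr, LinearMap.mulLeft_apply, Finset.sum_eq_single j]
  · rw [Matrix.scalar_apply, Matrix.diagonal_apply_eq]
  · intro i _ hi
    rw [Matrix.scalar_apply, Matrix.diagonal_apply_ne _ hi, map_zero, zero_mul]
  · simp

/-- A finite free `V`-algebra over `k[[x, y]]` is presented over `k[[x, y]]` by its characteristic
matrix if some power of `y` is divisible by `x - l y` in it: the elements of the basis then generate
the cokernel of the matrix over `V`. -/
theorem isPresentation_charMatrix (hι : ι PowerSeries.X = line l)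
    (hφ : ∀ c, φ (ι c) = algebraMap (PowerSeries k) B c)
    (e : Module.Basis (Fin d) (PowerSeries k) B) {N : ℕ}
    (hN : φ (line l) ∣ φ (MvPowerSeries.X 1) ^ N) :
    IsPresentation φ (charMatrix ι e (φ (MvPowerSeries.X 1))) e := by
  classical
  set v := φ (MvPowerSeries.X 1) with hv
  set F := charMatrix ι e v with hF
  let C := (Fin d → PS k) ⧸ LinearMap.range F.mulVecLin
  let _ : Module (PowerSeries k) C := Module.compHom C (ι : PowerSeries k →+* PS k)
  have hs : ∀ (c : PowerSeries k) (m : C), c • m = ι c • m := fun _ _ => rfl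
  let E : Fin d → C := fun j => Submodule.Quotient.mk (Pi.single j 1)
  have hE : ∀ w : Fin d → PS k, (Submodule.Quotient.mk w : C) = ∑ j, w j • E j := by
    intro w
    conv_lhs => rw [pi_eq_sum_univ' w]
    exact map_sum (Submodule.mkQ (LinearMap.range F.mulVecLin)) _ _
  -- `θ` is inverse to the map from the cokernel `C` of `F` to `B`; it is `y`-linear by the
  -- definition of `F`, so its image contains the generators `y ^ i E j` of `C`
  let θ : B →ₗ[PowerSeries k] C := e.constr (PowerSeries k) E
  have hθ : ∀ j, θ (e j) = E j := fun j => e.constr_basis (PowerSeries k) E j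
  have hθv : ∀ b, (MvPowerSeries.X 1 : PS k) • θ b = θ (v * b) := by
    let L₁ : B →ₗ[PowerSeries k] C :=
      { toFun := fun b => (MvPowerSeries.X 1 : PS k) • θ b
        map_add' := fun a b => by rw [map_add, smul_add]
        map_smul' := fun c b => by rw [map_smul, hs, smul_comm]; rfl }
    refine DFunLike.congr_fun (f := L₁) (g := θ.comp (LinearMap.mulLeft _ v)) (e.ext fun j => ?_)
    change (MvPowerSeries.X 1 : PS k) • θ (e j) = θ (v * e j)
    have h1 : v * e j =
        ∑ i, LinearMap.toMatrix e e (LinearMap.mulLeft (PowerSeries k) v) i j • e i := by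
      simp only [LinearMap.toMatrix_apply, e.sum_repr, LinearMap.mulLeft_apply]
    rw [h1, map_sum]
    simp only [map_smul, hθ, hs]
    rw [← sub_eq_zero]
    have h2 : (Submodule.Quotient.mk (F.mulVec (Pi.single j 1)) : C) = 0 :=
      (Submodule.Quotient.mk_eq_zero _).mpr ⟨_, rfl⟩
    rw [hE, Matrix.mulVec_single_one] at h2
    simp only [Matrix.col_apply, hF, charMatrix, Matrix.sub_apply, Matrix.map_apply, sub_smul,
      Finset.sum_sub_distrib] at h2
    rw [Finset.sum_eq_single j] at h2
    · rwa [Matrix.scalar_apply, Matrix.diagonal_apply_eq] at h2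
    · intro i _ hi
      rw [Matrix.scalar_apply, Matrix.diagonal_apply_ne _ hi, zero_smul]
    · simp
  have hθpow : ∀ (n : ℕ) (b : B), (MvPowerSeries.X 1 : PS k) ^ n • θ b = θ (v ^ n * b) := by
    intro n
    induction n with
    | zero => intro b; rw [pow_zero, pow_zero, one_smul, one_mul]
    | succ n ih => intro b; rw [pow_succ, mul_smul, hθv, ih, pow_succ, mul_assoc]
  have hspan : Submodule.span (PS k) (Set.range E) = ⊤ := by
    rw [eq_top_iff]
    rintro m -
    obtain ⟨w, rfl⟩ := Submodule.Quotient.mk_surjective _ m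
    exact (hE w).symm ▸ Submodule.sum_mem _ fun j _ =>
      Submodule.smul_mem _ _ (Submodule.subset_span ⟨j, rfl⟩)
  obtain ⟨q, hq⟩ := hN
  have htop := span_pow_smul_eq_top hι hs E hspan (N := N) fun m => by
    obtain ⟨w, rfl⟩ := Submodule.Quotient.mk_surjective _ m
    refine ⟨∑ j, w j • θ (q * e j), ?_⟩
    rw [hE, Finset.smul_sum, Finset.smul_sum]
    refine Finset.sum_congr rfl fun j _ => ?_
    rw [smul_comm, ← hθ, hθpow, hq, smul_comm (line l), ← hι, hφ, mul_assoc, ← Algebra.smul_def,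
      map_smul, hs]
  have hθs : Function.Surjective θ := by
    rw [← LinearMap.range_eq_top, eq_top_iff, ← htop, Submodule.span_le]
    rintro _ ⟨⟨i, j⟩, rfl⟩
    exact ⟨v ^ (i : ℕ) * e j, by rw [← hθpow, hθ]⟩
  have hrel : ∀ w' : Fin d → PS k, ∑ i, φ (F.mulVec w' i) * e i = 0 := by
    intro w'
    simp only [Matrix.mulVec, dotProduct, map_sum, map_mul, Finset.sum_mul]
    rw [Finset.sum_comm]
    refine Finset.sum_eq_zero fun j _ => ?_
    have := sum_map_charMatrix hφ e j
    rw [← hv, ← hF] at this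
    rw [← mul_zero (φ (w' j)), ← this, Finset.mul_sum]
    exact Finset.sum_congr rfl fun i _ => by ring
  refine ⟨fun w => ⟨fun hw => ?_, ?_⟩, fun b => ⟨fun i => ι (e.repr b i), ?_⟩⟩
  · obtain ⟨b, hb⟩ := hθs (Submodule.Quotient.mk w)
    have h1 : θ b = (Submodule.Quotient.mk (fun i => ι (e.repr b i)) : C) := by
      rw [hE]
      conv_lhs => rw [← e.sum_repr b]
      simp only [map_sum, map_smul, hθ, hs]
    rw [h1, eq_comm, Submodule.Quotient.eq] at hb
    obtain ⟨w', hw'⟩ := hb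
    have h2 := hrel w'
    rw [Matrix.mulVecLin_apply] at hw'
    rw [hw'] at h2
    simp only [Pi.sub_apply, map_sub, sub_mul, Finset.sum_sub_distrib, hw, zero_sub, hφ,
      ← Algebra.smul_def, e.sum_repr, neg_eq_zero] at h2
    refine ⟨w', ?_⟩
    rw [hw', h2]
    funext i
    simp
  · rintro ⟨w', rfl⟩
    exact hrel w'
  · simp only [hφ, ← Algebra.smul_def, e.sum_repr]

/-- The determinant of the characteristic matrix does not change under an injective homomorphism
of free algebras of the same rank: its matrix `M` has a nonzero determinant and intertwines the two
multiplication matrices. -/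
theorem det_charMatrix_eq (hι : ι PowerSeries.X = line l) {A : Type*} [CommRing A]
    [Algebra (PowerSeries k) A] (g : A →ₐ[PowerSeries k] B) (hg : Function.Injective g)
    (a : Module.Basis (Fin d) (PowerSeries k) A) (e : Module.Basis (Fin d) (PowerSeries k) B)
    (v : A) : (charMatrix ι e (g v)).det = (charMatrix ι a v).det := by
  set M := LinearMap.toMatrix a e g.toLinearMap with hM
  have hdet : M.det ≠ 0 := by
    rw [Ne, ← Matrix.exists_mulVec_eq_zero_iff]
    rintro ⟨w, hw, h0⟩
    apply hw
    have h1 := LinearMap.toMatrix_mulVec_repr a e g.toLinearMap (a.equivFun.symm w)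
    rw [← hM, ← a.equivFun_apply, LinearEquiv.apply_symm_apply, h0, ← e.equivFun_apply] at h1
    have h2 : g (a.equivFun.symm w) = 0 := e.equivFun.injective (by rw [map_zero]; exact h1.symm)
    exact a.equivFun.symm.injective ((hg (h2.trans (map_zero g).symm)).trans (map_zero _).symm)
  have hcomm : LinearMap.toMatrix e e (LinearMap.mulLeft (PowerSeries k) (g v)) * M =
      M * LinearMap.toMatrix a a (LinearMap.mulLeft (PowerSeries k) v) := by
    rw [hM, ← LinearMap.toMatrix_comp, ← LinearMap.toMatrix_comp]
    congr 1
    ext x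
    simp
  have h3 : charMatrix ι e (g v) * M.map ι = M.map ι * charMatrix ι a v := by
    rw [charMatrix, charMatrix, sub_mul, mul_sub, ← Matrix.map_mul, ← Matrix.map_mul, hcomm,
      (Matrix.scalar_commute _ (fun _ => Commute.all _ _) (M.map ι)).eq]
  have h4 := congrArg Matrix.det h3
  rw [Matrix.det_mul, Matrix.det_mul, mul_comm] at h4
  refine mul_left_cancel₀ ?_ h4
  have : (M.map ι).det = ι M.det := (AlgHom.map_det ι M).symm
  rw [this]
  exact (map_ne_zero_iff ι (algHom_injective_of_X_eq_line hι)).mpr hdet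

/-- A presentation matrix whose determinant is associated to `f`, a nonzero nonunit, can be rescaled
to a resolution with determinant `f`. -/
theorem IsPresentation.exists_isResolution {B : Type u} [CommRing B] {φ : PS k →+* B}
    {F : Matrix (Fin d) (Fin d) (PS k)} {m : Fin d → B} (h : IsPresentation φ F m) {f : PS k}
    (hf0 : f ≠ 0) (hfu : ¬ IsUnit f) (hF : Associated F.det f) :
    ∃ F' : Matrix (Fin d) (Fin d) (PS k), IsResolution φ F' m ∧ F'.det = f := by
  obtain ⟨w, hw⟩ := hF
  have hd : 0 < d := by
    rcases Nat.eq_zero_or_pos d with rfl | h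
    · rw [Matrix.det_fin_zero, one_mul] at hw
      exact absurd (hw ▸ w.isUnit) hfu
    · exact h
  -- multiply the first column by the unit `w`
  let D : Matrix (Fin d) (Fin d) (PS k) :=
    Matrix.diagonal (Function.update 1 ⟨0, hd⟩ (w : PS k))
  have hD : D.det = w := by
    rw [Matrix.det_diagonal, Finset.prod_update_of_mem (Finset.mem_univ _)]
    simp
  have hu : IsUnit D := (Matrix.isUnit_iff_isUnit_det D).mpr (hD ▸ w.isUnit)
  have hdet : (F * D).det = f := by rw [Matrix.det_mul, hD, hw]
  refine ⟨F * D, ⟨fun a b hab => ?_, fun v => ?_, h.surjective⟩, hdet⟩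
  · rw [← sub_eq_zero]
    by_contra hne
    have := Matrix.exists_mulVec_eq_zero_iff.mp
      ⟨a - b, hne, by rw [Matrix.mulVec_sub, sub_eq_zero]; exact hab⟩
    exact hf0 (hdet ▸ this)
  · rw [h.exact]
    refine ⟨?_, ?_⟩
    · rintro ⟨w', rfl⟩
      obtain ⟨D', hD', -⟩ := isUnit_iff_exists.mp hu
      exact ⟨D'.mulVec w', by rw [Matrix.mulVec_mulVec, mul_assoc, hD', mul_one]⟩
    · rintro ⟨w', rfl⟩
      exact ⟨D.mulVec w', Matrix.mulVec_mulVec _ _ _⟩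

end CharacteristicMatrix

/-! ### The curve as a finite algebra -/

section PlaneCurves

open nonZeroDivisors

variable {k : Type u} [Field k] {f : PS k} {l : k} {ι : PowerSeries k →ₐ[k] PS k}

theorem isCompleteAt_powerSeries_X :
    IsCompleteAt (PowerSeries.X : PowerSeries k) (PowerSeries k) :=
  isCompleteAt_of_isAdicComplete

theorem powerSeries_exists_dvd_sub (c : PowerSeries k) :
    ∃ a : k, (PowerSeries.X : PowerSeries k) ∣ c - algebraMap k (PowerSeries k) a :=
  ⟨PowerSeries.constantCoeff c, by
    rw [PowerSeries.X_dvd_iff, map_sub]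
    exact sub_eq_zero.mpr (PowerSeries.constantCoeff_C _).symm⟩

variable [Algebra (PowerSeries k) (CurveRing f)]

/-- `A` is generated over `V` by `1, y, …, y ^ (N - 1)`. -/
theorem finite_curveRing (hι : ι PowerSeries.X = line l)
    (hV : ∀ c, algebraMap (PowerSeries k) (CurveRing f) c = proj f (ι c)) {N : ℕ}
    (hN : (MvPowerSeries.X 1 : PS k) ^ N ∈ Ideal.span {line l, f}) :
    Module.Finite (PowerSeries k) (CurveRing f) := by
  have h := span_pow_smul_eq_top hι (M := CurveRing f)
    (fun c m => by rw [Algebra.smul_def, hV]; rfl) (fun _ : Unit => 1)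
    (by
      rw [Set.range_const, eq_top_iff]
      rintro x -
      obtain ⟨p, rfl⟩ := Ideal.Quotient.mk_surjective x
      exact Submodule.mem_span_singleton.mpr ⟨p, mul_one (Ideal.Quotient.mk (Ideal.span {f}) p)⟩)
    (curveRing_pow_smul hN fun m => by
      change Ideal.Quotient.mk (Ideal.span {f}) f * m = 0
      rw [Ideal.Quotient.eq_zero_iff_mem.mpr (Ideal.mem_span_singleton_self f), zero_mul])
  exact ⟨h ▸ Submodule.fg_span (Set.finite_range _)⟩

theorem algebraMap_curveRing_mem (hι : ι PowerSeries.X = line l)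
    (hV : ∀ c, algebraMap (PowerSeries k) (CurveRing f) c = proj f (ι c)) (hl : ¬ line l ∣ f)
    (c : PowerSeries k) (hc : c ≠ 0) :
    algebraMap (PowerSeries k) (CurveRing f) c ∈ (CurveRing f)⁰ := by
  obtain ⟨n, w, rfl⟩ :=
    IsDiscreteValuationRing.eq_unit_mul_pow_irreducible hc PowerSeries.X_irreducible
  rw [map_mul, map_pow, hV PowerSeries.X, hι]
  refine mul_mem (w.isUnit.map _).mem_nonZeroDivisors (pow_mem ?_ n)
  rw [mem_nonZeroDivisors_iff_right]
  exact fun a ha => curveRing_line_mul_eq_zero hl a (by rw [mul_comm]; exact ha)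

end PlaneCurves

/-! ### Torsion-free algebras over a domain -/

section TorsionFree

variable {V : Type*} [CommRing V] [IsDomain V] {A B : Type*} [CommRing A] [CommRing B] [Algebra V A]
  [Algebra V B]

open nonZeroDivisors

theorem isTorsionFree_of_mem_nonZeroDivisors
    (hA : ∀ c : V, c ≠ 0 → algebraMap V A c ∈ A⁰) : Module.IsTorsionFree V A where
  isSMulRegular r hr := by
    intro a b hab
    have h0 : algebraMap V A r * (a - b) = 0 := by
      rw [mul_sub, ← Algebra.smul_def, ← Algebra.smul_def, sub_eq_zero]
      exact hab
    exact sub_eq_zero.mp ((mem_nonZeroDivisors_iff.mp (hA r hr.ne_zero)).1 _ h0)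

/-- An injective homomorphism with torsion cokernel preserves the rank. -/
theorem finrank_eq_of_exists_smul_mem_range [Module.Finite V A] [Module.Finite V B]
    [Module.IsTorsionFree V B] [Module.Free V B] (g : A →ₐ[V] B) (hg : Function.Injective g)
    (h : ∀ b : B, ∃ c : V, c ≠ 0 ∧ ∃ a, g a = c • b) :
    Module.finrank V A = Module.finrank V B := by
  refine le_antisymm (LinearMap.finrank_le_finrank_of_injective (f := g.toLinearMap) hg) ?_
  let e := Module.finBasis V B
  choose c hc a ha using fun j => h (e j)
  have hli : LinearIndependent V a := by
    rw [Fintype.linearIndependent_iff]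
    intro x hx i
    have h1 := congrArg g hx
    simp only [map_sum, map_smul, ha, map_zero, smul_smul] at h1
    exact (mul_eq_zero.mp
      (Fintype.linearIndependent_iff.mp e.linearIndependent _ h1 i)).resolve_right (hc i)
  simpa using hli.fintype_card_le_finrank

end TorsionFree

/-! ### A resolution with determinant `f` -/

section Resolution

variable {k : Type u} [Field k] {f : PS k} {l : k} {ι : PowerSeries k →ₐ[k] PS k}
  [Algebra (PowerSeries k) (CurveRing f)] [Module.Finite (PowerSeries k) (CurveRing f)]

open nonZeroDivisors

/-- The curve `A` is presented by `f` and by its characteristic matrix, so the determinant of the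
latter, which does not change under the passage to the normalization `B`, is associated to `f`. -/
theorem exists_isResolution_of_curveRing (hι : ι PowerSeries.X = line l)
    (hV : ∀ c, algebraMap (PowerSeries k) (CurveRing f) c = proj f (ι c)) {N : ℕ}
    (hN : proj f (line l) ∣ proj f (MvPowerSeries.X 1) ^ N) (hf0 : f ≠ 0) (hfu : ¬ IsUnit f)
    {B : Type u} [CommRing B] [Algebra k B] [Algebra (PowerSeries k) B]
    [Module.Finite (PowerSeries k) B]
    [Module.IsTorsionFree (PowerSeries k) (CurveRing f)] [Module.IsTorsionFree (PowerSeries k) B]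
    (g : CurveRing f →ₐ[k] B) (hg : Function.Injective g)
    (hgV : ∀ c, g (algebraMap (PowerSeries k) (CurveRing f) c) = algebraMap (PowerSeries k) B c)
    (h : ∀ b : B, ∃ c : PowerSeries k, c ≠ 0 ∧ ∃ a, g a = c • b) :
    ∃ (n : ℕ) (F : Matrix (Fin n) (Fin n) (PS k)) (m : Fin n → B),
      IsResolution (g.comp (proj f) : PS k →+* B) F m ∧ F.det = f := by
  let g' : CurveRing f →ₐ[PowerSeries k] B := ⟨g, hgV⟩
  have hrank : Module.finrank (PowerSeries k) (CurveRing f) = Module.finrank (PowerSeries k) B :=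
    finrank_eq_of_exists_smul_mem_range g' hg h
  let a := Module.finBasis (PowerSeries k) (CurveRing f)
  let e := Module.finBasisOfFinrankEq (PowerSeries k) B hrank.symm
  have hA := isPresentation_charMatrix hι (φ := (proj f : PS k →+* CurveRing f))
    (fun c => (hV c).symm) a hN
  have hB := isPresentation_charMatrix hι (φ := (g.comp (proj f) : PS k →+* B))
    (fun c => (congrArg g (hV c).symm).trans (hgV c)) e (N := N) (by
      have := map_dvd g hN
      rwa [map_pow] at this)
  have hf : IsPresentation (proj f : PS k →+* CurveRing f) !![f] ![1] := by
    refine ⟨fun w => ?_, fun b => ?_⟩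
    · rw [Fin.sum_univ_one, Matrix.cons_val_fin_one, mul_one]
      refine Ideal.Quotient.eq_zero_iff_mem.trans (Ideal.mem_span_singleton.trans ⟨?_, ?_⟩)
      · rintro ⟨q, hq⟩
        refine ⟨fun _ => q, funext fun i => ?_⟩
        fin_cases i
        simp [Matrix.mulVec, dotProduct, hq]
      · rintro ⟨w', rfl⟩
        exact ⟨w' 0, by simp [Matrix.mulVec, dotProduct]⟩
    · obtain ⟨p, rfl⟩ := Ideal.Quotient.mk_surjective b
      exact ⟨fun _ => p, by simp⟩
  have hassoc : Associated (charMatrix ι a (proj f (MvPowerSeries.X 1))).det f := by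
    have h1 := hA.det_dvd_det hf
    have h2 := hf.det_dvd_det hA
    rw [Matrix.det_fin_one_of] at h1 h2
    exact associated_of_dvd_dvd h1 h2
  rw [← det_charMatrix_eq hι g' hg a e] at hassoc
  obtain ⟨F, hF, hdet⟩ := hB.exists_isResolution hf0 hfu hassoc
  exact ⟨_, F, e, hF, hdet⟩

end Resolution

end PlaneCurveDef

theorem mainTheorem11 {k : Type u} [Field k] [IsAlgClosed k] (f : PS k)
    (hf : IsIsolatedSingularity f) :
    CategoryTheory.IsIso (compMorphism (proj f) (normMap f)) ∧
    (∃ (n : ℕ) (F : Matrix (Fin n) (Fin n) (PS k)) (m : Fin n → Normalization f),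
      IsResolution ((normMap f).comp (proj f) : PS k →+* Normalization f) F m ∧ F.det = f) ∧
    (∀ (R : ArtAlg k) (D : PlaneDef ((normMap f).comp (proj f)) R) (n : ℕ)
      (F : Matrix (Fin n) (Fin n) (PS k)) (m : Fin n → Normalization f),
      IsResolution ((normMap f).comp (proj f) : PS k →+* Normalization f) F m →
      ∃ (FR : Matrix (Fin n) (Fin n) (PS R)) (mR : Fin n → D.tgt),
        IsResolution (D.hom : PS R →+* D.tgt) FR mR ∧
        FR.map (MvPowerSeries.map (R.aug : R →+* k)) = F ∧ ∀ i, D.tgt.red (mR i) = m i) ∧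
    (∀ (R : ArtAlg k) (D : PlaneDef ((normMap f).comp (proj f)) R) (n : ℕ)
      (FR : Matrix (Fin n) (Fin n) (PS R)) (mR : Fin n → D.tgt),
      IsResolution (D.hom : PS R →+* D.tgt) FR mR →
      ∃ E : FibreDef (proj f) (normMap f) R,
        PlaneDef.Isomorphic E.comp D ∧
        Function.Surjective E.plane.hom ∧
        RingHom.ker E.plane.hom = Ideal.span {FR.det}) ∧
    FormallySmooth (DefFibre (proj f) (normMap f)) ∧
    FormallySmooth (DefArrow (normMap f)) := by
  have hsq := hf.squarefree
  have hf0 : f ≠ 0 := hsq.ne_zero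
  have hfu : ¬ IsUnit f := by
    intro hu
    have hle : Ideal.span {(MvPowerSeries.X 0 : PS k), MvPowerSeries.X 1} ≤
        RingHom.ker (MvPowerSeries.constantCoeff : PS k →+* k) := by
      rw [Ideal.span_le]
      rintro x (rfl | rfl)
      · exact constantCoeff_X 0
      · exact constantCoeff_X 1
    have h0 := hle hf.1
    rw [RingHom.mem_ker] at h0
    exact not_isUnit_zero (h0 ▸ MvPowerSeries.isUnit_iff_constantCoeff.mp hu)
  have := hf.isReduced
  have : Infinite k := IsAlgClosed.instInfinite
  obtain ⟨l, hl⟩ := exists_not_line_dvd hf0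
  obtain ⟨N, hN⟩ := exists_pow_mem_of_not_line_dvd hl
  obtain ⟨ι, hι⟩ := ps_exists_powerSeries_hom (constantCoeff_line l)
  -- `A` is a finite torsion-free algebra over `V = k[[s]]`, where `s` acts as `x - l y`
  let _ : Algebra (PowerSeries k) (CurveRing f) :=
    ((proj f).comp ι : PowerSeries k →+* CurveRing f).toAlgebra
  have hV : ∀ c, algebraMap (PowerSeries k) (CurveRing f) c = proj f (ι c) := fun _ => rfl
  have hVX : algebraMap (PowerSeries k) (CurveRing f) PowerSeries.X = proj f (line l) := by
    rw [hV, hι]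
  have hkA : IsScalarTower k (PowerSeries k) (CurveRing f) :=
    IsScalarTower.of_algebraMap_eq fun a => (((proj f).comp ι).commutes a).symm
  have hfin : Module.Finite (PowerSeries k) (CurveRing f) := finite_curveRing hι hV hN
  have hA := algebraMap_curveRing_mem hι hV hl
  have hc := isCompleteAt_powerSeries_X (k := k)
  have hX : Irreducible (PowerSeries.X : PowerSeries k) := PowerSeries.X_irreducible
  obtain ⟨hBfin, hrad, hden⟩ := normalization_of_finite hc hX hA
  have hkB : IsScalarTower k (PowerSeries k) (Normalization f) :=
    IsScalarTower.of_algebraMap_eq fun a => by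
      rw [IsScalarTower.algebraMap_apply k (CurveRing f) (Normalization f),
        IsScalarTower.algebraMap_apply (PowerSeries k) (CurveRing f) (Normalization f),
        ← IsScalarTower.algebraMap_apply k (PowerSeries k) (CurveRing f)]
  have hgV : ∀ c, normMap f (algebraMap (PowerSeries k) (CurveRing f) c) =
      algebraMap (PowerSeries k) (Normalization f) c := fun c =>
    (IsScalarTower.algebraMap_apply (PowerSeries k) (CurveRing f) (Normalization f) c).symm
  have hinj : Function.Injective (normMap f) := fun a b hab =>
    IsFractionRing.injective (CurveRing f) (FractionRing (CurveRing f)) (congrArg Subtype.val hab)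
  have hB : ∀ c : PowerSeries k, c ≠ 0 →
      algebraMap (PowerSeries k) (Normalization f) c ∈ nonZeroDivisors (Normalization f) := by
    intro c h0
    rw [mem_nonZeroDivisors_iff_right]
    intro b hb
    have h1 : IsUnit (algebraMap (CurveRing f) (FractionRing (CurveRing f))
        (algebraMap (PowerSeries k) (CurveRing f) c)) :=
      IsLocalization.map_units _ (⟨_, hA c h0⟩ : nonZeroDivisors (CurveRing f))
    exact Subtype.ext (h1.mul_left_eq_zero.mp (congrArg Subtype.val hb))
  -- `s` is a parameter of `A` and of its normalization, with `x` and `y` in the radical of `(s)`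
  have hAX : ∀ a, algebraMap (PowerSeries k) (CurveRing f) PowerSeries.X * a = 0 → a = 0 :=
    (mem_nonZeroDivisors_iff.mp (hA _ hX.ne_zero)).1
  have hBX : ∀ b, algebraMap (PowerSeries k) (Normalization f) PowerSeries.X * b = 0 → b = 0 :=
    (mem_nonZeroDivisors_iff.mp (hB _ hX.ne_zero)).1
  have htA := isParameter_of_finite hc hX hAX
  have htB := isParameter_of_finite hc hX hBX
  have hgA : ∀ i, proj f (MvPowerSeries.X i) ∈
      (Ideal.span {algebraMap (PowerSeries k) (CurveRing f) PowerSeries.X}).radical := fun i => by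
    rw [hVX]
    exact curveRing_X_mem_radical hN i
  have hgB : ∀ i, ((normMap f).comp (proj f)) (MvPowerSeries.X i) ∈
      (Ideal.span {algebraMap (PowerSeries k) (Normalization f) PowerSeries.X}).radical :=
    fun i => by
      obtain ⟨n, hn⟩ := hgA i
      refine ⟨n, ?_⟩
      rw [Ideal.mem_span_singleton] at hn ⊢
      have := map_dvd (normMap f) hn
      rwa [map_pow, hgV] at this
  have := isTorsionFree_of_mem_nonZeroDivisors hA
  have := isTorsionFree_of_mem_nonZeroDivisors hB
  have hN' : proj f (line l) ∣ proj f (MvPowerSeries.X 1) ^ N := by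
    obtain ⟨a, b, hab⟩ := Ideal.mem_span_pair.mp hN
    have h0 : proj f f = 0 := Ideal.Quotient.eq_zero_iff_mem.mpr (Ideal.mem_span_singleton_self f)
    refine ⟨proj f a, ?_⟩
    rw [← map_pow, ← hab, map_add, map_mul, map_mul, h0, mul_zero, add_zero, mul_comm]
  have hres := exists_isResolution_of_curveRing hι hV hN' hf0 hfu (normMap f) hinj hgV fun b => by
    obtain ⟨c, hc0, a, ha⟩ := hden b
    exact ⟨c, hc0, a, by rw [← algebraMap_smul (CurveRing f) c b]; exact ha.symm⟩
  obtain ⟨n, F, m, hF, hdet⟩ := id hres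
  have hsec : HasSections (k := k) (Normalization f) :=
    (hrad PowerSeries.X).hasSections hc hX powerSeries_exists_dvd_sub hBX
  have hplane := hsec.formallySmooth_defPlane htB hgB
  have hfibre : FormallySmooth (DefFibre (proj f) (normMap f)) :=
    .of_bijective (compMorphism (proj f) (normMap f))
      (fun R => compMorphism_bijective hinj hf0 hF hdet R) hplane
  exact ⟨isIso_compMorphism hinj hf0 hF hdet, hres,
    fun R D n F m hF => exists_lift_resolution D hF,
    fun R D n FR mR hFR => exists_fibreDef hf0 hF hdet D hFR,
    hfibre,
    defArrow_formallySmooth hfibre fun R D => D.exists_fibreDef htA hgA⟩
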